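/- (1) Let $1\le r\le n$, let $\mathcal{O}=\mathcal{O}_{\mathbb{C}^n,0}$ be the ring of germs at the origin of holomorphic functions on $\mathbb{C}^n$, let $\mathcal{D}=\mathcal{D}_{\mathbb{C}^n,0}$ be the ring of germs at the origin of linear differential operators with holomorphic coefficients, and put $f=x_1\cdots x_r$. In the left $\mathcal{D}$-module $\mathcal{O}[1/f]$ of germs of meromorphic functions with poles along $f=0$, the annihilator of $1/f$ is the left ideal $$\mathrm{Ann}_{\mathcal{D}}(1/f)=\mathcal{D}(\partial_{r+1},\dots,\partial_n,\;x_1\partial_1+1,\dots,x_r\partial_r+1),$$ and $1/f$ generates the module: $\mathcal{D}\cdot\tfrac1f=\mathcal{O}[1/f]$. Consequently $\mathcal{D}/\mathcal{D}(\partial_{r+1},\dots,\partial_n,x_1\partial_1+1,\dots,x_r\partial_r+1)\simeq\mathcal{O}[1/f]$. (2) The logarithmic comparison theorem holds for normal crossing divisors. That is, let $X$ be a complex manifold of dimension $n$ and let $D\subset X$ be a closed subset such that around every point of $X$ there are holomorphic coordinates $(x_1,\dots,x_n)$, centred at the point, in which $D=\{x_1\cdots x_r=0\}$ for some $0\le r\le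 n$ (with $r=0$ at points outside $D$). Let $\Omega_X^\bullet(\star D)$ be the complex of sheaves of meromorphic differential forms with poles along $D$, and $\Omega_X^\bullet(\log D)$ its subcomplex of logarithmic forms, that is of the forms $\omega$ such that $h\omega$ and $h\,d\omega$ are holomorphic for a reduced local equation $h$ of $D$. Then reduced local equations of $D$ exist at every point, and the inclusion $\Omega_X^\bullet(\log D)\hookrightarrow\Omega_X^\bullet(\star D)$ is a quasi-isomorphism, i.e. it induces isomorphisms on the cohomology of the stalks at every point of $X$. -/

import Mathlib

open scoped Topology Manifold ContDiff
open Filter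

noncomputable section

namespace LogComparison

/-! ### Algebras of differential operators and their action on localizations

Let `A` be a commutative `ℂ`-algebra and `δᵢ` a family of `ℂ`-linear derivations of `A`. -/

section Operators

set_option linter.unusedSectionVars false

variable {A : Type*} [CommRing A] [Algebra ℂ A] {ι : Type*}

/-- The algebra of operators on `A` generated by the multiplications by elements of `A` and by the
derivations `δᵢ`. -/
def opAlgebra (δ : ι → Derivation ℂ A A) : Subalgebra ℂ (Module.End ℂ A) :=
  Algebra.adjoin ℂ (Set.range (LinearMap.mulLeft ℂ) ∪ Set.range fun i => (δ i : A →ₗ[ℂ] A))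

variable (S : Type*) [CommRing S] [Algebra ℂ S] [Algebra A S] [IsScalarTower ℂ A S]
  (f : A)

/-- The ring homomorphism `a ↦ a + ε δ(a)` into the dual numbers over `S = A[1/f]`. -/
def dualHom (δ : Derivation ℂ A A) : A →+* TrivSqZeroExt S S where
  toFun a := TrivSqZeroExt.inl (algebraMap A S a) + TrivSqZeroExt.inr (algebraMap A S (δ a))
  map_one' := by refine TrivSqZeroExt.ext ?_ ?_ <;> simp
  map_zero' := by refine TrivSqZeroExt.ext ?_ ?_ <;> simp
  map_add' a b := by
    refine TrivSqZeroExt.ext (by simp) ?_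
    simp only [TrivSqZeroExt.snd_add, TrivSqZeroExt.snd_inl, TrivSqZeroExt.snd_inr, map_add,
      zero_add]
  map_mul' a b := by
    refine TrivSqZeroExt.ext (by simp) ?_
    simp only [TrivSqZeroExt.snd_add, TrivSqZeroExt.snd_inl, TrivSqZeroExt.snd_inr,
      TrivSqZeroExt.snd_mul, TrivSqZeroExt.fst_add, TrivSqZeroExt.fst_inl, TrivSqZeroExt.fst_inr,
      Derivation.leibniz, smul_eq_mul, map_add, map_mul, zero_add, add_zero,
      MulOpposite.smul_eq_mul_unop, MulOpposite.unop_op]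
    ring

/-- The extension of `a ↦ a + ε δ(a)` to `S = A[1/f]`. -/
def dualLift [IsLocalization.Away f S] (δ : Derivation ℂ A A) : S →+* TrivSqZeroExt S S :=
  IsLocalization.Away.lift f (g := dualHom S δ) (by
    rw [TrivSqZeroExt.isUnit_iff_isUnit_fst]
    simpa [dualHom] using IsLocalization.Away.algebraMap_isUnit (S := S) f)

theorem dualLift_algebraMap [IsLocalization.Away f S] (δ : Derivation ℂ A A) (a : A) :
    dualLift S f δ (algebraMap A S a) =
      TrivSqZeroExt.inl (algebraMap A S a) + TrivSqZeroExt.inr (algebraMap A S (δ a)) :=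
  IsLocalization.Away.lift_eq f _ a

theorem dualLift_fst [IsLocalization.Away f S] (δ : Derivation ℂ A A) (s : S) :
    (dualLift S f δ s).fst = s := by
  have h : ((TrivSqZeroExt.fstHom S S S).toRingHom.comp (dualLift S f δ)) = RingHom.id S := by
    refine IsLocalization.ringHom_ext (Submonoid.powers f) (RingHom.ext fun a => ?_)
    simp [dualLift_algebraMap]
  exact congrArg (fun φ : S →+* S => φ s) h

/-- The unique extension of a derivation of `A` to a derivation of `S = A[1/f]`
(the quotient rule). -/
def locDer [IsLocalization.Away f S] (δ : Derivation ℂ A A) : Derivation ℂ S S :=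
  Derivation.mk'
    { toFun := fun s => (dualLift S f δ s).snd
      map_add' := fun s t => by simp
      map_smul' := fun c s => by
        rw [Algebra.smul_def, IsScalarTower.algebraMap_apply ℂ A S, map_mul,
          dualLift_algebraMap]
        simp [Algebra.smul_def, IsScalarTower.algebraMap_apply ℂ A S] }
    (fun s t => by simp [dualLift_fst, mul_comm])

theorem locDer_algebraMap [IsLocalization.Away f S] (δ : Derivation ℂ A A) (a : A) :
    locDer S f δ (algebraMap A S a) = algebraMap A S (δ a) := by
  change (dualLift S f δ _).snd = _
  rw [dualLift_algebraMap, TrivSqZeroExt.snd_add, TrivSqZeroExt.snd_inl, TrivSqZeroExt.snd_inr,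
    zero_add]

variable {S}

/-- Operators of order `< k` relative to `f`: those killed by `k` commutators with `f`. -/
def OrdLT : ℕ → Module.End ℂ S → Prop
  | 0, Q => Q = 0
  | k + 1, Q => OrdLT k (LinearMap.mulLeft ℂ (algebraMap A S f) * Q -
      Q * LinearMap.mulLeft ℂ (algebraMap A S f))

theorem OrdLT.zero (k : ℕ) : OrdLT f k (0 : Module.End ℂ S) := by
  induction k with
  | zero => rfl
  | succ k ih => simpa [OrdLT] using ih

theorem OrdLT.succ {k : ℕ} {Q : Module.End ℂ S} (h : OrdLT f k Q) : OrdLT f (k + 1) Q := by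
  induction k generalizing Q with
  | zero => rw [show Q = 0 from h]; exact OrdLT.zero f 1
  | succ k ih => exact ih h

theorem OrdLT.mono {k l : ℕ} (hkl : k ≤ l) {Q : Module.End ℂ S} (h : OrdLT f k Q) :
    OrdLT f l Q := by
  induction hkl with
  | refl => exact h
  | step _ ih => exact ih.succ

theorem OrdLT.add {k : ℕ} {Q R : Module.End ℂ S} (h : OrdLT f k Q) (h' : OrdLT f k R) :
    OrdLT f k (Q + R) := by
  induction k generalizing Q R with
  | zero => rw [show Q = 0 from h, show R = 0 from h']; exact add_zero _
  | succ k ih =>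
    have := ih h h'
    simp only [OrdLT]
    convert this using 1
    simp only [mul_add, add_mul]
    abel

theorem OrdLT.mul {k l : ℕ} {Q R : Module.End ℂ S} (h : OrdLT f k Q) (h' : OrdLT f l R) :
    OrdLT f (k + l) (Q * R) := by
  induction k generalizing Q R l with
  | zero => rw [show Q = 0 from h, zero_mul]; exact OrdLT.zero f _
  | succ k ih =>
    induction l generalizing R with
    | zero => rw [show R = 0 from h', mul_zero]; exact OrdLT.zero f _
    | succ l ihl =>
      have h1 := ih h h'
      have h2 := ihl h'
      have h3 := OrdLT.add f (OrdLT.mono f (le_of_eq (by omega : k + (l + 1) = k + 1 + l)) h1) h2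
      change OrdLT f (k + 1 + l) _
      convert h3 using 1
      simp only [mul_sub, sub_mul, mul_assoc]
      abel

/-- An operator of finite order on `A[1/f]` that vanishes on `A` is zero. -/
theorem OrdLT.eq_zero [IsLocalization.Away f S] {k : ℕ} {Q : Module.End ℂ S} (h : OrdLT f k Q)
    (h0 : ∀ a : A, Q (algebraMap A S a) = 0) : Q = 0 := by
  induction k generalizing Q with
  | zero => exact h
  | succ k ih =>
    have h1 := ih h fun a => by simp [← map_mul, h0]
    have hc : ∀ (m : ℕ) (s : S), Q (algebraMap A S f ^ m * s) = algebraMap A S f ^ m * Q s := by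
      intro m
      induction m with
      | zero => simp
      | succ m ihm =>
        intro s
        have := congrArg (fun L => L (algebraMap A S f ^ m * s)) h1
        simp only [LinearMap.sub_apply, Module.End.mul_apply, LinearMap.mulLeft_apply,
          LinearMap.zero_apply, sub_eq_zero] at this
        rw [pow_succ', mul_assoc, ← this, ihm, mul_assoc]
    ext s
    obtain ⟨m, a, ha⟩ := IsLocalization.Away.surj f s
    have hu : IsUnit (algebraMap A S f ^ m) :=
      (IsLocalization.Away.algebraMap_isUnit f).pow m
    refine hu.mul_left_cancel ?_
    rw [← hc, mul_comm, ha, h0]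
    simp

variable (S) (δ : ι → Derivation ℂ A A) [IsLocalization.Away f S]

/-- The algebra generated by the pairs formed of a multiplication (resp. a derivation `δᵢ`) on
`A` and of its extension to `S = A[1/f]`. -/
def opPairs : Subalgebra ℂ (Module.End ℂ A × Module.End ℂ S) :=
  Algebra.adjoin ℂ
    ((Set.range fun a : A => (LinearMap.mulLeft ℂ a, LinearMap.mulLeft ℂ (algebraMap A S a))) ∪
    Set.range fun i : ι => ((δ i : A →ₗ[ℂ] A), (locDer S f (δ i) : S →ₗ[ℂ] S)))

theorem opPairs_spec {P : Module.End ℂ A × Module.End ℂ S} (hP : P ∈ opPairs S f δ) :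
    (∃ k, OrdLT f k P.2) ∧ ∀ a, P.2 (algebraMap A S a) = algebraMap A S (P.1 a) := by
  induction hP using Algebra.adjoin_induction with
  | mem P hP =>
    rcases hP with ⟨a, rfl⟩ | ⟨i, rfl⟩
    · refine ⟨⟨1, ?_⟩, fun b => by simp⟩
      change _ - _ = _
      ext s
      simp [mul_left_comm]
    · refine ⟨⟨2, ?_⟩, fun b => locDer_algebraMap S f _ b⟩
      change _ - _ = _
      ext s
      simp
      ring
  | algebraMap c =>
    have h1 : (algebraMap ℂ (Module.End ℂ A × Module.End ℂ S) c).1 = algebraMap ℂ _ c := rfl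
    have h2 : (algebraMap ℂ (Module.End ℂ A × Module.End ℂ S) c).2 = algebraMap ℂ _ c := rfl
    rw [h1, h2]
    refine ⟨⟨1, sub_eq_zero.2 (Algebra.commutes c _).symm⟩, fun b => ?_⟩
    rw [Module.algebraMap_end_apply, Module.algebraMap_end_apply]
    exact ((IsScalarTower.toAlgHom ℂ A S).toLinearMap.map_smul c b).symm
  | add P Q _ _ h h' =>
    obtain ⟨⟨k, hk⟩, h⟩ := h
    obtain ⟨⟨l, hl⟩, h'⟩ := h'
    exact ⟨⟨max k l, (hk.mono f (le_max_left _ _)).add f (hl.mono f (le_max_right _ _))⟩,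
      fun a => by simp [h, h']⟩
  | mul P Q _ _ h h' =>
    obtain ⟨⟨k, hk⟩, h⟩ := h
    obtain ⟨⟨l, hl⟩, h'⟩ := h'
    exact ⟨⟨k + l, hk.mul f hl⟩, fun a => by simp [h, h']⟩

theorem opPairs_map : (opPairs S f δ).map (AlgHom.fst ℂ _ _) = opAlgebra δ := by
  rw [opPairs, AlgHom.map_adjoin, Set.image_union, ← Set.range_comp, ← Set.range_comp]
  rfl

/-- The first projection from the algebra of pairs to the algebra of operators on `A`. -/
def opPairsFst : opPairs S f δ →ₐ[ℂ] opAlgebra δ :=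
  ((AlgHom.fst ℂ _ _).comp (opPairs S f δ).val).codRestrict (opAlgebra δ) fun P =>
    (opPairs_map S f δ).le ⟨P.1, P.2, rfl⟩

theorem opPairsFst_bijective : Function.Bijective (opPairsFst S f δ) := by
  constructor
  · rw [← AlgHom.coe_toRingHom, injective_iff_map_eq_zero]
    intro P hP
    have h1 : P.1.1 = 0 := congrArg Subtype.val hP
    obtain ⟨⟨k, hk⟩, h⟩ := opPairs_spec S f δ P.2
    have h2 : P.1.2 = 0 := hk.eq_zero f fun a => by
      rw [h, h1]
      simp
    exact Subtype.ext (Prod.ext h1 h2)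
  · intro P
    obtain ⟨Q, hQ, h⟩ := (opPairs_map S f δ).ge P.2
    exact ⟨⟨Q, hQ⟩, Subtype.ext h⟩

/-- The action of the algebra of operators on `S = A[1/f]`, extending its action on `A`. -/
def opAction : opAlgebra δ →ₐ[ℂ] Module.End ℂ S :=
  ((AlgHom.snd ℂ _ _).comp (opPairs S f δ).val).comp
    (AlgEquiv.ofBijective _ (opPairsFst_bijective S f δ)).symm.toAlgHom

theorem opAction_fst (P : opPairs S f δ) : opAction S f δ (opPairsFst S f δ P) = P.1.2 := by
  have : (AlgEquiv.ofBijective _ (opPairsFst_bijective S f δ)).symm (opPairsFst S f δ P) = P :=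
    (AlgEquiv.ofBijective _ (opPairsFst_bijective S f δ)).symm_apply_apply P
  exact congrArg (fun P : opPairs S f δ => P.1.2) this

theorem opAction_algebraMap (P : opAlgebra δ) (a : A) :
    opAction S f δ P (algebraMap A S a) = algebraMap A S (P.1 a) := by
  obtain ⟨P, rfl⟩ := (opPairsFst_bijective S f δ).2 P
  rw [opAction_fst]
  exact (opPairs_spec S f δ P.2).2 a

end Operators

/-! ### Germs at the origin of holomorphic functions and of differential operators -/

instance germAlgebra {α : Type*} (l : Filter α) : Algebra ℂ (Germ l ℂ) :=
  Algebra.ofModule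
    (fun r x y => by
      induction x using Germ.inductionOn with | _ x =>
      induction y using Germ.inductionOn with | _ y =>
      exact congrArg Germ.ofFun (smul_mul_assoc r x y))
    (fun r x y => by
      induction x using Germ.inductionOn with | _ x =>
      induction y using Germ.inductionOn with | _ y =>
      exact congrArg Germ.ofFun (mul_smul_comm r x y))

/-- The algebra of germs at the origin of holomorphic functions on `ℂⁿ`, as a subalgebra of the
germs of all functions. -/
def holSubalgebra (n : ℕ) : Subalgebra ℂ (Germ (𝓝 (0 : Fin n → ℂ)) ℂ) where
  carrier := {φ | ∃ g : (Fin n → ℂ) → ℂ, AnalyticAt ℂ g 0 ∧ φ = (g : Germ _ ℂ)}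
  mul_mem' := by
    rintro _ _ ⟨g, hg, rfl⟩ ⟨g', hg', rfl⟩
    exact ⟨g * g', hg.mul hg', rfl⟩
  add_mem' := by
    rintro _ _ ⟨g, hg, rfl⟩ ⟨g', hg', rfl⟩
    exact ⟨g + g', hg.add hg', rfl⟩
  algebraMap_mem' c := ⟨fun _ => c, analyticAt_const, by
    rw [Algebra.algebraMap_eq_smul_one]
    refine (Germ.coe_smul c (1 : (Fin n → ℂ) → ℂ)).symm.trans (congrArg Germ.ofFun ?_)
    funext x
    simp⟩

/-- The ring `𝒪_{ℂⁿ,0}` of germs at the origin of holomorphic functions on `ℂⁿ`. -/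
def HolGerm (n : ℕ) : Type := holSubalgebra n

instance (n : ℕ) : CommRing (HolGerm n) := inferInstanceAs (CommRing (holSubalgebra n))

instance (n : ℕ) : Algebra ℂ (HolGerm n) := inferInstanceAs (Algebra ℂ (holSubalgebra n))

variable {n : ℕ}

/-- The germ at the origin of a holomorphic function. -/
def HolGerm.mk (g : (Fin n → ℂ) → ℂ) (hg : AnalyticAt ℂ g 0) : HolGerm n :=
  ⟨(g : Germ _ ℂ), g, hg, rfl⟩

theorem HolGerm.exists_rep (φ : HolGerm n) : ∃ g hg, φ = HolGerm.mk g hg := by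
  obtain ⟨_, g, hg, rfl⟩ := φ
  exact ⟨g, hg, rfl⟩

theorem HolGerm.mk_eq_mk {g g' : (Fin n → ℂ) → ℂ} {hg : AnalyticAt ℂ g 0}
    {hg' : AnalyticAt ℂ g' 0} : HolGerm.mk g hg = HolGerm.mk g' hg' ↔ g =ᶠ[𝓝 0] g' :=
  Subtype.ext_iff.trans Germ.coe_eq

/-- The germ of the coordinate function `xᵢ`. -/
def coord (i : Fin n) : HolGerm n :=
  HolGerm.mk (fun x => x i)
    ((ContinuousLinearMap.proj (R := ℂ) (φ := fun _ : Fin n => ℂ) i).analyticAt 0)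

/-- The `i`-th partial derivative of a function. -/
def pdFun (i : Fin n) (g : (Fin n → ℂ) → ℂ) (x : Fin n → ℂ) : ℂ :=
  fderiv ℂ g x (Pi.single i 1)

theorem pdFun_analyticAt (i : Fin n) {g : (Fin n → ℂ) → ℂ} {x : Fin n → ℂ}
    (hg : AnalyticAt ℂ g x) : AnalyticAt ℂ (pdFun i g) x :=
  ((ContinuousLinearMap.apply ℂ ℂ (Pi.single i (1 : ℂ) : Fin n → ℂ)).analyticAt _).comp
    (f := fderiv ℂ g) hg.fderiv

/-- The partial derivative on germs of functions. -/
def pdGerm (i : Fin n) : Germ (𝓝 (0 : Fin n → ℂ)) ℂ → Germ (𝓝 (0 : Fin n → ℂ)) ℂ :=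
  Germ.map' (pdFun i) fun _ _ h =>
    (EventuallyEq.fderiv (𝕜 := ℂ) h).mono fun _ hx =>
      congrArg (fun L => L (Pi.single i (1 : ℂ))) hx

/-- The partial derivative `∂ᵢ` on `𝒪_{ℂⁿ,0}`. -/
def pd (i : Fin n) : Derivation ℂ (HolGerm n) (HolGerm n) :=
  Derivation.mk'
    { toFun := fun φ => ⟨pdGerm i φ.1, by
        obtain ⟨g, hg, h⟩ := φ.2
        rw [h]
        exact ⟨pdFun i g, pdFun_analyticAt i hg, rfl⟩⟩
      map_add' := by
        rintro ⟨_, g, hg, rfl⟩ ⟨_, g', hg', rfl⟩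
        refine Subtype.ext (Germ.coe_eq.2 ?_)
        filter_upwards [hg.eventually_analyticAt, hg'.eventually_analyticAt] with x h h'
        exact congrArg (fun L => L (Pi.single i (1 : ℂ)))
          (fderiv_add h.differentiableAt h'.differentiableAt)
      map_smul' := by
        rintro c ⟨_, g, hg, rfl⟩
        refine Subtype.ext (Germ.coe_eq.2 ?_)
        filter_upwards [hg.eventually_analyticAt] with x h
        exact congrArg (fun L => L (Pi.single i (1 : ℂ))) (fderiv_const_smul h.differentiableAt c) }
    (by
      rintro ⟨_, g, hg, rfl⟩ ⟨_, g', hg', rfl⟩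
      refine Subtype.ext (Germ.coe_eq.2 ?_)
      filter_upwards [hg.eventually_analyticAt, hg'.eventually_analyticAt] with x h h'
      exact congrArg (fun L => L (Pi.single i (1 : ℂ)))
          (fderiv_mul h.differentiableAt h'.differentiableAt))

theorem pd_mk (i : Fin n) (g : (Fin n → ℂ) → ℂ) (hg : AnalyticAt ℂ g 0) :
    pd i (HolGerm.mk g hg) = HolGerm.mk (pdFun i g) (pdFun_analyticAt i hg) :=
  rfl

/-- The ring `𝒟_{ℂⁿ,0}` of germs at the origin of linear differential operators with holomorphic
coefficients: the operators on `𝒪_{ℂⁿ,0}` generated by the multiplications by elements of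
`𝒪_{ℂⁿ,0}` and by the `∂ᵢ`, i.e. the finite sums `∑ c_α ∂^α`. -/
def DiffOp (n : ℕ) : Type := opAlgebra (A := HolGerm n) pd

instance (n : ℕ) : Ring (DiffOp n) := inferInstanceAs (Ring (opAlgebra (A := HolGerm n) pd))

instance (n : ℕ) : Algebra ℂ (DiffOp n) :=
  inferInstanceAs (Algebra ℂ (opAlgebra (A := HolGerm n) pd))

/-- A holomorphic function germ, as a differential operator of order zero. -/
def DiffOp.mul (a : HolGerm n) : DiffOp n :=
  ⟨LinearMap.mulLeft ℂ a, Algebra.subset_adjoin (Or.inl ⟨a, rfl⟩)⟩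

/-- The partial derivative `∂ᵢ`, as an element of `𝒟_{ℂⁿ,0}`. -/
def DiffOp.del (i : Fin n) : DiffOp n :=
  ⟨(pd i : HolGerm n →ₗ[ℂ] HolGerm n), Algebra.subset_adjoin (Or.inr ⟨i, rfl⟩)⟩

/-- The ring `𝒪_{ℂⁿ,0}[1/f]` of germs at the origin of meromorphic functions with poles along
`f = 0`. -/
def MeroGerm (f : HolGerm n) : Type := Localization.Away f

section MeroGerm

variable (f : HolGerm n)

instance : CommRing (MeroGerm f) := inferInstanceAs (CommRing (Localization.Away f))

instance : Algebra ℂ (MeroGerm f) := inferInstanceAs (Algebra ℂ (Localization.Away f))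

instance : Algebra (HolGerm n) (MeroGerm f) :=
  inferInstanceAs (Algebra (HolGerm n) (Localization.Away f))

instance : IsScalarTower ℂ (HolGerm n) (MeroGerm f) :=
  inferInstanceAs (IsScalarTower ℂ (HolGerm n) (Localization.Away f))

instance : IsLocalization.Away f (MeroGerm f) :=
  inferInstanceAs (IsLocalization.Away f (Localization.Away f))

/-- The left `𝒟_{ℂⁿ,0}`-module structure of `𝒪_{ℂⁿ,0}[1/f]`. -/
instance : Module (DiffOp n) (MeroGerm f) :=
  Module.compHom _ (opAction (MeroGerm f) f pd).toRingHom

theorem mul_smul_eq (a : HolGerm n) (s : MeroGerm f) :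
    DiffOp.mul a • s = algebraMap (HolGerm n) (MeroGerm f) a * s :=
  congrArg (fun L : Module.End ℂ (MeroGerm f) => L s)
    (opAction_fst (MeroGerm f) f pd ⟨_, Algebra.subset_adjoin (Or.inl ⟨a, rfl⟩)⟩)

theorem del_smul_eq (i : Fin n) (s : MeroGerm f) :
    DiffOp.del i • s = locDer (MeroGerm f) f (pd i) s :=
  congrArg (fun L : Module.End ℂ (MeroGerm f) => L s)
    (opAction_fst (MeroGerm f) f pd ⟨_, Algebra.subset_adjoin (Or.inr ⟨i, rfl⟩)⟩)

theorem smul_algebraMap_eq (P : DiffOp n) (a : HolGerm n) :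
    P • algebraMap (HolGerm n) (MeroGerm f) a = algebraMap (HolGerm n) (MeroGerm f) (P.1 a) :=
  opAction_algebraMap (MeroGerm f) f pd P a

/-- The meromorphic germ `1/f`. -/
def MeroGerm.inv : MeroGerm f := IsLocalization.Away.invSelf f

end MeroGerm

/-- The equation `x₁ ⋯ x_r` of a normal crossing divisor, in `𝒪_{ℂⁿ,0}`. -/
def crossing (n r : ℕ) : HolGerm n := ∏ i : Fin n with i.val < r, coord i

/-! ### Germs of meromorphic and logarithmic differential forms

A divisor is considered near a point `p` of `ℂⁿ`; `U` is the complement of its support. -/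

/-- Alternating `q`-forms on `ℂⁿ`. -/
abbrev AltForm (n q : ℕ) : Type := (Fin n → ℂ) [⋀^Fin q]→L[ℂ] ℂ

/-- `h` is a reduced local equation at `p` of the hypersurface with complement `U`: it is
holomorphic and not identically zero near `p`, the hypersurface is `{h = 0}` near `p`, and `h`
divides in `𝒪_{ℂⁿ,p}` every holomorphic germ vanishing on the hypersurface. -/
structure IsReducedEquation (U : TopologicalSpace.Opens (Fin n → ℂ)) (p : Fin n → ℂ)
    (h : (Fin n → ℂ) → ℂ) : Prop where
  analyticAt : AnalyticAt ℂ h p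
  ne_zero : ∃ᶠ x in 𝓝 p, h x ≠ 0
  eq_zero_iff : ∀ᶠ x in 𝓝 p, h x = 0 ↔ x ∉ U
  dvd : ∀ g : (Fin n → ℂ) → ℂ, AnalyticAt ℂ g p → (∀ᶠ x in 𝓝 p, x ∉ U → g x = 0) →
    ∃ a : (Fin n → ℂ) → ℂ, AnalyticAt ℂ a p ∧ g =ᶠ[𝓝 p] a * h

section Forms

variable (U : TopologicalSpace.Opens (Fin n → ℂ)) (p : Fin n → ℂ)

/-- The germs at `p` of (arbitrary) differential `q`-forms on `U`. -/
def FormGerm (q : ℕ) : Type := Germ (𝓝[U] p) (AltForm n q)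

instance (q : ℕ) : AddCommGroup (FormGerm U p q) :=
  inferInstanceAs (AddCommGroup (Germ (𝓝[U] p) (AltForm n q)))

instance (q : ℕ) : Module ℂ (FormGerm U p q) :=
  inferInstanceAs (Module ℂ (Germ (𝓝[U] p) (AltForm n q)))

/-- The germ of a differential form. -/
def FormGerm.mk {q : ℕ} (α : (Fin n → ℂ) → AltForm n q) : FormGerm U p q :=
  (α : Germ (𝓝[U] p) (AltForm n q))

theorem FormGerm.exists_rep {q : ℕ} (φ : FormGerm U p q) : ∃ α, φ = FormGerm.mk U p α := by
  induction φ using Germ.inductionOn with | _ α =>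
  exact ⟨α, rfl⟩

theorem FormGerm.mk_eq_mk {q : ℕ} {α β : (Fin n → ℂ) → AltForm n q} :
    FormGerm.mk U p α = FormGerm.mk U p β ↔ α =ᶠ[𝓝[U] p] β :=
  Germ.coe_eq

/-- Multiplication of germs of forms by a function. -/
def mulBy (g : (Fin n → ℂ) → ℂ) (q : ℕ) : FormGerm U p q →ₗ[ℂ] FormGerm U p q where
  toFun := Germ.map₂ (· • ·) (g : Germ (𝓝[U] p) ℂ)
  map_add' φ ψ := by
    induction φ using Germ.inductionOn with | _ α =>
    induction ψ using Germ.inductionOn with | _ β =>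
    exact congrArg Germ.ofFun (smul_add g α β)
  map_smul' c φ := by
    induction φ using Germ.inductionOn with | _ α =>
    exact congrArg Germ.ofFun (funext fun x => smul_comm (g x) c (α x))

theorem mulBy_mk (g : (Fin n → ℂ) → ℂ) {q : ℕ} (α : (Fin n → ℂ) → AltForm n q) :
    mulBy U p g q (FormGerm.mk U p α) = FormGerm.mk U p (g • α) :=
  rfl

theorem mulBy_mulBy (g g' : (Fin n → ℂ) → ℂ) {q : ℕ} (φ : FormGerm U p q) :
    mulBy U p (g * g') q φ = mulBy U p g q (mulBy U p g' q φ) := by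
  obtain ⟨α, rfl⟩ := φ.exists_rep
  exact congrArg Germ.ofFun (funext fun x => mul_smul (g x) (g' x) (α x))

/-- The exterior derivative on germs at `p` of differential forms on `U`
(junk off the differentiable ones). -/
def extGerm (q : ℕ) : FormGerm U p q → FormGerm U p (q + 1) :=
  Germ.map' extDeriv fun α β h => by
    filter_upwards [eventually_eventually_nhdsWithin.2 h, self_mem_nhdsWithin] with x hx hxU
    rw [U.isOpen.nhdsWithin_eq hxU] at hx
    exact EventuallyEq.extDeriv_eq hx

theorem extGerm_mk {q : ℕ} (α : (Fin n → ℂ) → AltForm n q) :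
    extGerm U p q (FormGerm.mk U p α) = FormGerm.mk U p (extDeriv α) :=
  rfl

theorem extDeriv_analyticAt {q : ℕ} {η : (Fin n → ℂ) → AltForm n q} (hη : AnalyticAt ℂ η p) :
    AnalyticAt ℂ (extDeriv η) p := by
  let Λ : ((Fin n → ℂ) →L[ℂ] AltForm n q) →L[ℂ] AltForm n (q + 1) :=
    ContinuousAlternatingMap.alternatizeUncurryFinCLM ℂ (Fin n → ℂ) ℂ
  exact (Λ.analyticAt (fderiv ℂ η p)).comp hη.fderiv

/-- The germs of forms on `U` that extend holomorphically across `p`. -/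
def regForm (q : ℕ) : Submodule ℂ (FormGerm U p q) where
  carrier := {φ | ∃ η : (Fin n → ℂ) → AltForm n q, AnalyticAt ℂ η p ∧ φ = FormGerm.mk U p η}
  zero_mem' := ⟨0, analyticAt_const, rfl⟩
  add_mem' := by
    rintro _ _ ⟨η, hη, rfl⟩ ⟨ξ, hξ, rfl⟩
    exact ⟨η + ξ, hη.add hξ, rfl⟩
  smul_mem' := by
    rintro c _ ⟨η, hη, rfl⟩
    exact ⟨c • η, analyticAt_const.smul hη, rfl⟩

theorem mulBy_mem_regForm {q : ℕ} {g : (Fin n → ℂ) → ℂ} (hg : AnalyticAt ℂ g p)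
    {φ : FormGerm U p q} (hφ : φ ∈ regForm U p q) : mulBy U p g q φ ∈ regForm U p q := by
  obtain ⟨η, hη, rfl⟩ := hφ
  exact ⟨g • η, hg.smul hη, rfl⟩

variable {U p} {h : (Fin n → ℂ) → ℂ} (H : IsReducedEquation U p h)

/-- The stalk at `p` of the sheaf of meromorphic `q`-forms with poles along the divisor: the germs
`φ` such that `h ^ k • φ` is holomorphic for some `k`. -/
def meroForm (q : ℕ) : Submodule ℂ (FormGerm U p q) where
  carrier := {φ | ∃ k : ℕ, mulBy U p (h ^ k) q φ ∈ regForm U p q}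
  zero_mem' := ⟨0, by rw [map_zero]; exact zero_mem _⟩
  add_mem' := by
    rintro φ ψ ⟨k, hk⟩ ⟨l, hl⟩
    refine ⟨k + l, ?_⟩
    rw [map_add, pow_add]
    refine add_mem ?_ ?_
    · rw [mul_comm, mulBy_mulBy]
      exact mulBy_mem_regForm U p (H.analyticAt.pow l) hk
    · rw [mulBy_mulBy]
      exact mulBy_mem_regForm U p (H.analyticAt.pow k) hl
  smul_mem' := by
    rintro c φ ⟨k, hk⟩
    exact ⟨k, by rw [map_smul]; exact Submodule.smul_mem _ c hk⟩

theorem meroForm_exists_rep {q : ℕ} (φ : meroForm H q) :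
    ∃ (k : ℕ) (α η : (Fin n → ℂ) → AltForm n q), φ.1 = FormGerm.mk U p α ∧ AnalyticAt ℂ η p ∧
      ∀ᶠ x in 𝓝[U] p, AnalyticAt ℂ α x ∧ η =ᶠ[𝓝 x] h ^ k • α := by
  obtain ⟨φ, k, η, hη, hφ⟩ := φ
  obtain ⟨α, rfl⟩ := φ.exists_rep
  refine ⟨k, α, η, rfl, hη, ?_⟩
  have h0 : ∀ᶠ x in 𝓝[U] p, (h ^ k • α) x = η x := Germ.coe_eq.1 hφ
  filter_upwards [eventually_eventually_nhdsWithin.2 h0, self_mem_nhdsWithin,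
    nhdsWithin_le_nhds H.eq_zero_iff.eventually_nhds,
    nhdsWithin_le_nhds H.analyticAt.eventually_analyticAt,
    nhdsWithin_le_nhds hη.eventually_analyticAt] with x hx hxU hz hh hη'
  rw [U.isOpen.nhdsWithin_eq hxU] at hx
  refine ⟨?_, EventuallyEq.symm hx⟩
  have hne : h x ≠ 0 := fun h0 => hz.self_of_nhds.1 h0 hxU
  refine (((hh.pow k).inv (pow_ne_zero k hne)).smul hη').congr ?_
  filter_upwards [hx, U.isOpen.mem_nhds hxU, hz] with y hy hyU hzy
  have hney : h y ≠ 0 := fun h0 => hzy.1 h0 hyU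
  rw [Pi.smul_apply', ← hy]
  exact inv_smul_smul₀ (pow_ne_zero k hney) _

theorem extDeriv_pow_smul {q : ℕ} {α : (Fin n → ℂ) → AltForm n q} {x : Fin n → ℂ}
    (hh : DifferentiableAt ℂ h x) (hα : DifferentiableAt ℂ α x) (k : ℕ) :
    extDeriv (h ^ k • α) x = h x ^ k • extDeriv α x + (k * h x ^ (k - 1)) •
      ContinuousAlternatingMap.alternatizeUncurryFin ((fderiv ℂ h x).smulRight (α x)) := by
  have h1 := ((hh.hasFDerivAt.pow k).smul hα.hasFDerivAt).fderiv
  have h2 : fderiv ℂ (h ^ k • α) x = h x ^ k • fderiv ℂ α x +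
      (k * h x ^ (k - 1)) • (fderiv ℂ h x).smulRight (α x) := by
    refine h1.trans ?_
    congr 1
    ext v w
    simp [mul_assoc]
  rw [extDeriv, h2, ContinuousAlternatingMap.alternatizeUncurryFin_add,
    ContinuousAlternatingMap.alternatizeUncurryFin_smul,
    ContinuousAlternatingMap.alternatizeUncurryFin_smul]
  rfl

theorem extGerm_mem (q : ℕ) (φ : meroForm H q) : extGerm U p q φ.1 ∈ meroForm H (q + 1) := by
  obtain ⟨k, α, η, hφ, hη, hα⟩ := meroForm_exists_rep H φ
  rw [hφ, extGerm_mk]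
  refine ⟨k + 1, (k + 1 : ℂ) • h • extDeriv η - (k : ℂ) • extDeriv (h • η), ?_, ?_⟩
  · exact (analyticAt_const.smul (H.analyticAt.smul (extDeriv_analyticAt p hη))).sub
      (analyticAt_const.smul (extDeriv_analyticAt p (H.analyticAt.smul hη)))
  · refine Germ.coe_eq.2 ?_
    filter_upwards [hα, nhdsWithin_le_nhds H.analyticAt.eventually_analyticAt]
      with x ⟨hαx, hx⟩ hh
    have h1 : extDeriv η x = _ := hx.extDeriv_eq.trans
      (extDeriv_pow_smul hh.differentiableAt hαx.differentiableAt k)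
    have h2 : h • η =ᶠ[𝓝 x] h ^ (k + 1) • α := by
      filter_upwards [hx] with y hy
      rw [Pi.smul_apply', hy, pow_succ']
      exact smul_smul _ _ _
    have h3 : extDeriv (h • η) x = _ := h2.extDeriv_eq.trans
      (extDeriv_pow_smul hh.differentiableAt hαx.differentiableAt (k + 1))
    have h4 : (k : ℂ) * (h x * h x ^ (k - 1)) = k * h x ^ k := by
      cases k with
      | zero => simp
      | succ k => rw [Nat.add_sub_cancel, pow_succ']
    simp only [Pi.smul_apply', Pi.smul_apply, Pi.sub_apply, Pi.pow_apply, h1, h3]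
    generalize ContinuousAlternatingMap.alternatizeUncurryFin
      ((fderiv ℂ h x).smulRight (α x)) = W
    generalize extDeriv α x = V
    ext v
    simp only [ContinuousAlternatingMap.smul_apply, ContinuousAlternatingMap.add_apply,
      ContinuousAlternatingMap.sub_apply, smul_eq_mul, Nat.cast_add, Nat.cast_one,
      Nat.add_sub_cancel]
    linear_combination (-(k + 1 : ℂ) * W v) * h4

/-- The exterior derivative of germs of meromorphic forms. -/
def meroD (q : ℕ) : meroForm H q →ₗ[ℂ] meroForm H (q + 1) where
  toFun φ := ⟨extGerm U p q φ.1, extGerm_mem H q φ⟩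
  map_add' φ ψ := by
    obtain ⟨_, α, _, hφ, _, hα⟩ := meroForm_exists_rep H φ
    obtain ⟨_, β, _, hψ, _, hβ⟩ := meroForm_exists_rep H ψ
    refine Subtype.ext ?_
    change extGerm U p q (φ.1 + ψ.1) = extGerm U p q φ.1 + extGerm U p q ψ.1
    rw [hφ, hψ]
    refine Germ.coe_eq.2 ?_
    filter_upwards [hα, hβ] with x hαx hβx
    exact extDeriv_add hαx.1.differentiableAt hβx.1.differentiableAt
  map_smul' c φ := by
    obtain ⟨_, α, _, hφ, _, hα⟩ := meroForm_exists_rep H φ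
    refine Subtype.ext ?_
    change extGerm U p q (c • φ.1) = c • extGerm U p q φ.1
    rw [hφ]
    refine Germ.coe_eq.2 (Eventually.of_forall fun x => ?_)
    exact extDeriv_smul c α

theorem meroD_meroD (q : ℕ) (φ : meroForm H q) : meroD H (q + 1) (meroD H q φ) = 0 := by
  obtain ⟨_, α, _, hφ, _, hα⟩ := meroForm_exists_rep H φ
  refine Subtype.ext ?_
  change extGerm U p (q + 1) (extGerm U p q φ.1) = 0
  rw [hφ]
  refine Germ.coe_eq.2 ?_
  filter_upwards [hα] with x hαx
  exact extDeriv_extDeriv_apply (r := ω) hαx.1.contDiffAt le_top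

/-- The stalk at `p` of the sheaf of logarithmic `q`-forms: the germs of meromorphic forms `φ` such
that `h • φ` and `h • dφ` are holomorphic. -/
def logForm (q : ℕ) : Submodule ℂ (meroForm H q) where
  carrier := {φ | mulBy U p h q φ.1 ∈ regForm U p q ∧
    mulBy U p h (q + 1) (meroD H q φ).1 ∈ regForm U p (q + 1)}
  zero_mem' := by
    simp only [Set.mem_ofPred_eq, map_zero, ZeroMemClass.coe_zero]
    exact ⟨zero_mem _, zero_mem _⟩
  add_mem' := by
    rintro φ ψ ⟨h1, h2⟩ ⟨h3, h4⟩
    simp only [Set.mem_ofPred_eq, map_add, Submodule.coe_add]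
    exact ⟨add_mem h1 h3, add_mem h2 h4⟩
  smul_mem' := by
    rintro c φ ⟨h1, h2⟩
    simp only [Set.mem_ofPred_eq, map_smul, Submodule.coe_smul]
    exact ⟨Submodule.smul_mem _ c h1, Submodule.smul_mem _ c h2⟩

/-- The exterior derivative of germs of logarithmic forms. -/
def logD (q : ℕ) : logForm H q →ₗ[ℂ] logForm H (q + 1) :=
  (meroD H q).restrict fun φ hφ => ⟨hφ.2, by
    rw [meroD_meroD, ZeroMemClass.coe_zero, map_zero]
    exact zero_mem _⟩

/-- The stalk at `p` of the complex of meromorphic forms with poles along the divisor. -/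
def meroComplex : CochainComplex (ModuleCat.{0} ℂ) ℕ :=
  CochainComplex.of (fun q => ModuleCat.of ℂ (meroForm H q)) (fun q => ModuleCat.ofHom (meroD H q))
    fun q => by
      ext φ
      exact congrArg _ (meroD_meroD H q φ)

/-- The stalk at `p` of the complex of logarithmic forms. -/
def logComplex : CochainComplex (ModuleCat.{0} ℂ) ℕ :=
  CochainComplex.of (fun q => ModuleCat.of ℂ (logForm H q)) (fun q => ModuleCat.ofHom (logD H q))
    fun q => by
      ext φ
      exact congrArg Subtype.val (meroD_meroD H q φ.1)

theorem meroComplex_d (q : ℕ) :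
    (meroComplex H).d q (q + 1) = ModuleCat.ofHom (meroD H q) :=
  CochainComplex.of_d (X := fun q => ModuleCat.of ℂ (meroForm H q))
    (fun q => ModuleCat.ofHom (meroD H q)) q

theorem logComplex_d (q : ℕ) : (logComplex H).d q (q + 1) = ModuleCat.ofHom (logD H q) :=
  CochainComplex.of_d (X := fun q => ModuleCat.of ℂ (logForm H q))
    (fun q => ModuleCat.ofHom (logD H q)) q

/-- The inclusion of the complex of logarithmic forms into the complex of meromorphic forms, on the
stalks at `p`. -/
def logInclusion : logComplex H ⟶ meroComplex H :=
  CochainComplex.ofHom (fun q => ModuleCat.ofHom (logForm H q).subtype) fun q => by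
    rw [meroComplex_d, logComplex_d]
    rfl

end Forms

/-! ### Divisors in complex manifolds -/

section Manifold

open TopologicalSpace

variable {X : Type*} [TopologicalSpace X] [ChartedSpace (Fin n → ℂ) X]

/-- The complement of `D`, read in the chart `e`. -/
def chartCompl (D : Closeds X) (e : OpenPartialHomeomorph X (Fin n → ℂ)) : Opens (Fin n → ℂ) :=
  ⟨e.target ∩ e.symm ⁻¹' (D : Set X)ᶜ, e.isOpen_inter_preimage_symm D.isClosed.isOpen_compl⟩

/-- `D` is a normal crossing divisor: near every point there are holomorphic coordinates
`(x₁, …, xₙ)`, centred at the point, in which `D` is `{x₁ ⋯ x_r = 0}` for some `0 ≤ r ≤ n`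
(`r = 0` at the points outside `D`). -/
def IsNormalCrossing (D : Closeds X) : Prop :=
  ∀ p : X, ∃ e ∈ IsManifold.maximalAtlas 𝓘(ℂ, Fin n → ℂ) ω X, p ∈ e.source ∧ e p = 0 ∧
    ∃ r ≤ n, ∀ x ∈ e.source, x ∈ D ↔ ∏ i : Fin n with i.val < r, e x i = 0

/-- The logarithmic comparison theorem holds for the hypersurface `D`: the inclusion
`Ω_X^•(log D) ↪ Ω_X^•(⋆D)` is a quasi-isomorphism of complexes of sheaves, that is, it is one on
the stalks at every point `p`. The stalks are read in an arbitrary chart around `p`, and they are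
formed with an arbitrary reduced local equation of `D`, the existence of which is part of `D` being
a hypersurface. -/
def SatisfiesLCT (D : Closeds X) : Prop :=
  ∀ e ∈ IsManifold.maximalAtlas 𝓘(ℂ, Fin n → ℂ) ω X, ∀ p ∈ e.source,
    (∃ h, IsReducedEquation (chartCompl D e) (e p) h) ∧
    ∀ (h : (Fin n → ℂ) → ℂ) (H : IsReducedEquation (chartCompl D e) (e p) h),
      QuasiIso (logInclusion H)

end Manifold

end LogComparison

end

/-!
The annihilator. For `f = x₁ ⋯ x_r`, the germ `∂^m (1/f)` is a nonzero multiple of `x^(-m)/f` if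
all the indices of the multi-index `m` are `< r`, and zero otherwise (`exists_delPow_smul_inv`).
In particular every `1/f^k` is in `𝒟 · 1/f`, so that `1/f` generates `𝒪[1/f]` (`span_inv_eq_top`).
If `P = ∑ c_m ∂^m` annihilates `1/f`, its coefficients `c_m` of highest order, for `m` with
indices `< r`, lie in the ideal of the `xᵢ`, `i ∈ m` (`coeff_mem_of_smul_inv_eq_zero`): the symbol
of `P` is in the ideal of the symbols of the generators. This is proved by applying partial
derivatives to the relation `∑ k_m c_m x^(A - m) = 0` obtained by clearing the denominators. Since
`xᵢ ∂^m` is of order `< |m|` modulo the ideal of the `∂ᵢ` and the `xᵢ∂ᵢ + 1` when `i ∈ m`, the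
order of `P` can be lowered modulo this ideal until `P` vanishes
(`mem_logIdeal_of_mem_ordFiltration`).

The comparison theorem. Let `ξ` be coordinates at a point in which the divisor is `ξ₁ ⋯ ξ_r = 0`.
A germ of function vanishing on the divisor is divisible by `ξ₁ ⋯ ξ_r`, by Hadamard's lemma, so
that `ξ₁ ⋯ ξ_r` is a reduced equation, equal to any other one up to a unit. Forms on the
complement are written in the logarithmic coframe `dξ₁/ξ₁, …, dξ_r/ξ_r, dξ_{r+1}, …, dξₙ`, whose
members are closed; `poleForm r ξ N a` is the form with coefficients `ξ^(-N) a`, and `d` acts on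
`a` by `frameD`, which preserves holomorphy (`extDeriv_poleForm`). The contraction `ι` with the
logarithmic vector field `ξⱼ ∂/∂ξⱼ` satisfies Cartan's formula (`contr_frameD_add`): on the
coefficients of `ξ^(-N) a`, the operator `ι d + d ι` is `ξⱼ ∂/∂ξⱼ - Nⱼ`. It has two consequences.

First, the logarithmic forms are those with holomorphic coefficients in the coframe
(`mem_logForm_iff`): if `ξ^(-1) a` and its differential have simple poles, then the two terms on
the left of Cartan's formula vanish on `ξⱼ = 0`, hence `a` does, for every `j`, and `a` is
divisible by `ξ₁ ⋯ ξ_r`. Second, if `η = ξ^(-N) a` has `Nⱼ > 0` and `dη` has a pole of order `<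
Nⱼ` along `ξⱼ = 0`, then `η + d(ι η)/Nⱼ` has a pole of order `< Nⱼ` there (`HasPole.reduce_succ`).
By induction, a meromorphic form with a logarithmic differential is the sum of a logarithmic form
and of an exact one (`exists_add_meroD_mem_logForm`), and this implies that the inclusion is a
quasi-isomorphism (`quasiIso_of_forall_exists`).
-/

noncomputable section

namespace LogComparison

/-! ### Division of analytic functions -/

section Division

variable {𝕜 E F : Type*} [NontriviallyNormedField 𝕜] [NormedAddCommGroup E] [NormedSpace 𝕜 E]
  [NormedAddCommGroup F] [NormedSpace 𝕜 F]

/-- The term of degree `k` of the quotient by `ℓ` of `g x - g (x - ℓ x • e)`, where `g` has the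
power series `p`: it comes from the telescoping of
`p (k + 1) (x, …, x) - p (k + 1) (π x, …, π x)`, with `π x = x - ℓ x • e`. -/
def quotientSeries (p : FormalMultilinearSeries 𝕜 E F) (ℓ : E →L[𝕜] 𝕜) (e : E) :
    FormalMultilinearSeries 𝕜 E F := fun k =>
  ∑ j : Fin (k + 1), ((p (k + 1)).curryMid j e).compContinuousLinearMap fun i : Fin k =>
    if i.castSucc < j then ContinuousLinearMap.id 𝕜 E
    else ContinuousLinearMap.id 𝕜 E - ℓ.smulRight e

theorem quotientSeries_apply (p : FormalMultilinearSeries 𝕜 E F) (ℓ : E →L[𝕜] 𝕜) (e x : E)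
    (k : ℕ) :
    ℓ x • quotientSeries p ℓ e k (fun _ => x) =
      p (k + 1) (fun _ => x) - p (k + 1) (fun _ => x - ℓ x • e) := by
  let t : ℕ → F := fun j => p (k + 1) fun i => if i.val < j then x else x - ℓ x • e
  have h1 : p (k + 1) (fun _ => x) = t (k + 1) := by
    refine congrArg (p (k + 1)) (funext fun i => ?_)
    rw [if_pos i.2]
  have h0 : p (k + 1) (fun _ => x - ℓ x • e) = t 0 := by
    refine congrArg (p (k + 1)) (funext fun i => ?_)
    rw [if_neg (by omega)]
  rw [h1, h0, ← Finset.sum_range_sub, ← Fin.sum_univ_eq_sum_range fun j => t (j + 1) - t j,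
    quotientSeries, _root_.sum_apply, Finset.smul_sum]
  refine Finset.sum_congr rfl fun j _ => ?_
  let w : Fin (k + 1) → E := fun i => if i.val < j.val then x else x - ℓ x • e
  have h2 : t (j + 1) = p (k + 1) (Function.update w j x) := by
    refine congrArg (p (k + 1)) (funext fun i => ?_)
    by_cases hij : i = j
    · subst hij; simp
    · rw [Function.update_of_ne hij]
      have : i.val ≠ j.val := fun h => hij (Fin.ext h)
      exact if_congr (by omega) rfl rfl
  have h3 : t j = p (k + 1) (Function.update w j (x - ℓ x • e)) := by
    refine congrArg (p (k + 1)) (funext fun i => ?_)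
    by_cases hij : i = j
    · subst hij; simp
    · rw [Function.update_of_ne hij]
  rw [h2, h3, ← ContinuousMultilinearMap.map_update_sub, sub_sub_cancel,
    ContinuousMultilinearMap.map_update_smul]
  congr 1
  rw [ContinuousMultilinearMap.compContinuousLinearMap_apply,
    ContinuousMultilinearMap.curryMid_apply]
  refine congrArg (p (k + 1)) ?_
  rw [Fin.insertNth_eq_iff]
  refine ⟨by simp, funext fun i => ?_⟩
  rw [Fin.removeNth, Function.update_of_ne (Fin.succAbove_ne j i)]
  simp only [w]
  by_cases hij : i.castSucc < j
  · rw [if_pos hij, Fin.succAbove_of_castSucc_lt _ _ hij]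
    exact (if_pos hij).symm
  · rw [if_neg hij, Fin.succAbove_of_le_castSucc _ _ (not_lt.1 hij), if_neg]
    · simp
    · have := not_lt.1 hij
      simp only [Fin.le_def, Fin.val_castSucc] at this
      simp only [Fin.val_succ]
      omega

theorem norm_quotientSeries_le (p : FormalMultilinearSeries 𝕜 E F) (ℓ : E →L[𝕜] 𝕜) (e : E)
    (k : ℕ) : ‖quotientSeries p ℓ e k‖ ≤
      (k + 1) * (‖p (k + 1)‖ * ‖e‖ * (1 + ‖ℓ.smulRight e‖) ^ k) := by
  have hle (j : Fin (k + 1)) (i : Fin k) : ‖(if i.castSucc < j then ContinuousLinearMap.id 𝕜 E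
      else ContinuousLinearMap.id 𝕜 E - ℓ.smulRight e)‖ ≤ 1 + ‖ℓ.smulRight e‖ := by
    split
    · exact ContinuousLinearMap.norm_id_le.trans (le_add_of_nonneg_right (norm_nonneg _))
    · exact (norm_sub_le _ _).trans (add_le_add_left ContinuousLinearMap.norm_id_le _)
  refine (norm_sum_le _ _).trans ((Finset.sum_le_card_nsmul _ _
    (‖p (k + 1)‖ * ‖e‖ * (1 + ‖ℓ.smulRight e‖) ^ k) fun j _ => ?_).trans_eq (by simp))
  refine (ContinuousMultilinearMap.norm_compContinuousLinearMap_le _ _).trans ?_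
  gcongr
  · exact ((ContinuousMultilinearMap.curryMid j (p (k + 1))).le_opNorm e).trans_eq
      (by rw [ContinuousMultilinearMap.norm_curryMid])
  · refine (Finset.prod_le_prod (fun i _ => norm_nonneg _) fun i _ => hle j i).trans_eq ?_
    simp

theorem quotientSeries_radius_pos {p : FormalMultilinearSeries 𝕜 E F} (hp : 0 < p.radius)
    (ℓ : E →L[𝕜] 𝕜) (e : E) : 0 < (quotientSeries p ℓ e).radius := by
  obtain ⟨r, hr0, hr⟩ := ENNReal.lt_iff_exists_nnreal_btwn.1 hp
  rw [ENNReal.coe_pos] at hr0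
  obtain ⟨C, hC0, hC⟩ := p.norm_mul_pow_le_of_lt_radius hr
  set M : NNReal := 1 + ‖ℓ.smulRight e‖₊ with hM
  have hMpos : 0 < M := by positivity
  have hρ : 0 < r / (2 * M) := by positivity
  refine lt_of_lt_of_le (ENNReal.coe_pos.2 hρ)
    (FormalMultilinearSeries.le_radius_of_bound _ (C * ‖e‖ / r) fun k => ?_)
  have hM' : (1 : ℝ) + ‖ℓ.smulRight e‖ = M := by simp [hM]
  have hk := norm_quotientSeries_le p ℓ e k
  rw [hM'] at hk
  have hr' : (0 : ℝ) < r := hr0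
  have hM0 : (0 : ℝ) < M := hMpos
  have h2k : ((k : ℝ) + 1) ≤ 2 ^ k := by exact_mod_cast Nat.lt_two_pow_self
  calc ‖quotientSeries p ℓ e k‖ * ((r / (2 * M) : NNReal) : ℝ) ^ k
      ≤ (k + 1) * (‖p (k + 1)‖ * ‖e‖ * (M : ℝ) ^ k) * ((r / (2 * M) : NNReal) : ℝ) ^ k := by gcongr
    _ = (k + 1) / 2 ^ k * (‖p (k + 1)‖ * (r : ℝ) ^ (k + 1)) * (‖e‖ / r) := by
        push_cast
        rw [div_pow, mul_pow, pow_succ]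
        field_simp
    _ ≤ 1 * C * (‖e‖ / r) := by
        gcongr
        · rw [div_le_one (by positivity)]
          exact h2k
        · exact hC (k + 1)
    _ = C * ‖e‖ / r := by ring

/-- Hadamard's lemma for analytic functions. -/
theorem exists_analyticAt_sub_eq_smul [CompleteSpace F] {g : E → F} (hg : AnalyticAt 𝕜 g 0)
    (ℓ : E →L[𝕜] 𝕜) (e : E) :
    ∃ a : E → F, AnalyticAt 𝕜 a 0 ∧ ∀ᶠ x in 𝓝 0, g x - g (x - ℓ x • e) = ℓ x • a x := by
  obtain ⟨p, R, hp⟩ := hg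
  have hq := (quotientSeries p ℓ e).hasFPowerSeriesOnBall
    (quotientSeries_radius_pos (hp.r_pos.trans_le hp.r_le) ℓ e)
  refine ⟨_, hq.analyticAt, ?_⟩
  have hc : Tendsto (fun x : E => x - ℓ x • e) (𝓝 0) (𝓝 0) := by
    have : Continuous fun x : E => x - ℓ x • e := by fun_prop
    simpa using this.tendsto 0
  have hR : ∀ᶠ x : E in 𝓝 0, x ∈ Metric.eball (0 : E) R := Metric.eball_mem_nhds 0 hp.r_pos
  filter_upwards [hR, hc.eventually hR, Metric.eball_mem_nhds (0 : E) hq.r_pos] with x h1 h2 h3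
  have s1 := (hasSum_nat_add_iff' 1).2 (hp.hasSum h1)
  have s2 := (hasSum_nat_add_iff' 1).2 (hp.hasSum h2)
  have s3 := (hq.hasSum h3).const_smul (ℓ x)
  simp only [quotientSeries_apply, zero_add] at s1 s2 s3
  have := (s1.sub s2).unique s3
  rw [← this]
  simp only [Finset.range_one, Finset.sum_singleton]
  rw [show (p 0 fun _ => x) = p 0 fun _ => x - ℓ x • e from
    congrArg (p 0) (Subsingleton.elim _ _)]
  abel

end Division

/-- Germs of analytic functions have no zero divisors. -/
theorem eventually_eq_zero_of_smul_eq_zero {E F : Type*} [NormedAddCommGroup E] [NormedSpace ℂ E]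
    [NormedAddCommGroup F] [NormedSpace ℂ F] [CompleteSpace F]
    {f : E → ℂ} {g : E → F} {x : E} (hf : AnalyticAt ℂ f x) (hg : AnalyticAt ℂ g x)
    (hf0 : ∃ᶠ y in 𝓝 x, f y ≠ 0) (h : ∀ᶠ y in 𝓝 x, f y • g y = 0) : ∀ᶠ y in 𝓝 x, g y = 0 := by
  obtain ⟨ε, hε, hb⟩ := Metric.eventually_nhds_iff_ball.1
    ((hf.eventually_analyticAt.and hg.eventually_analyticAt).and h)
  obtain ⟨y, hy0, hyb⟩ := (hf0.and_eventually (Metric.ball_mem_nhds x hε)).exists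
  have hy : ∀ᶠ z in 𝓝 y, g z = 0 := by
    filter_upwards [(hb y hyb).1.1.continuousAt.eventually_ne hy0,
      Metric.isOpen_ball.mem_nhds hyb] with z hz hzb
    exact (smul_eq_zero.1 (hb z hzb).2).resolve_left hz
  have := AnalyticOnNhd.eqOn_zero_of_preconnected_of_eventuallyEq_zero
    (fun z hz => (hb z hz).1.2) (convex_ball x ε).isPreconnected hyb hy
  filter_upwards [Metric.ball_mem_nhds x hε] with z hz using this hz

variable {n : ℕ}

/-! ### The ring of holomorphic germs at the origin -/

instance : Nontrivial (HolGerm n) := by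
  refine ⟨0, 1, fun h => ?_⟩
  have h0 : (fun _ : Fin n → ℂ => (0 : ℂ)) =ᶠ[𝓝 0] fun _ => 1 :=
    Germ.coe_eq.1 (congrArg Subtype.val h)
  exact zero_ne_one h0.self_of_nhds

instance : NoZeroDivisors (HolGerm n) where
  eq_zero_or_eq_zero_of_mul_eq_zero {φ ψ} h := by
    obtain ⟨f, hf, rfl⟩ := φ.exists_rep
    obtain ⟨g, hg, rfl⟩ := ψ.exists_rep
    have h0 : ∀ᶠ x in 𝓝 0, f x • g x = 0 := Germ.coe_eq.1 (congrArg Subtype.val h)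
    by_cases hf0 : ∃ᶠ x in 𝓝 0, f x ≠ 0
    · exact .inr (Subtype.ext (Germ.coe_eq.2 (eventually_eq_zero_of_smul_eq_zero hf hg hf0 h0)))
    · exact .inl (Subtype.ext (Germ.coe_eq.2 (by
        filter_upwards [not_frequently.1 hf0] with x hx using not_not.1 hx)))

instance : IsDomain (HolGerm n) := NoZeroDivisors.to_isDomain _

/-- The projection of `ℂⁿ` onto the coordinate hyperplane `xᵢ = 0`. -/
def hyperProj (i : Fin n) (x : Fin n → ℂ) : Fin n → ℂ := x - x i • Pi.single i 1

theorem hyperProj_analyticAt (i : Fin n) (x : Fin n → ℂ) : AnalyticAt ℂ (hyperProj i) x :=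
  (ContinuousLinearMap.id ℂ (Fin n → ℂ) -
    (ContinuousLinearMap.proj (R := ℂ) (φ := fun _ : Fin n => ℂ) i).smulRight
      (Pi.single i (1 : ℂ) : Fin n → ℂ)).analyticAt x

theorem hyperProj_zero (i : Fin n) : hyperProj i 0 = 0 := by simp [hyperProj]

theorem tendsto_hyperProj (i : Fin n) : Tendsto (hyperProj i) (𝓝 0) (𝓝 0) := by
  simpa only [hyperProj_zero] using (hyperProj_analyticAt i 0).continuousAt.tendsto

theorem hyperProj_apply_self (i : Fin n) (x : Fin n → ℂ) : hyperProj i x i = 0 := by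
  simp [hyperProj]

theorem hyperProj_apply_ne {i j : Fin n} (h : j ≠ i) (x : Fin n → ℂ) :
    hyperProj i x j = x j := by
  simp [hyperProj, h]

/-- The substitution `xᵢ = 0` in holomorphic germs. -/
def restr (i : Fin n) : HolGerm n →+* HolGerm n where
  toFun φ := ⟨φ.1.compTendsto _ (tendsto_hyperProj i), by
    obtain ⟨g, hg, h⟩ := φ.2
    rw [h]
    refine ⟨g ∘ hyperProj i, ?_, rfl⟩
    exact AnalyticAt.comp (by rwa [hyperProj_zero]) (hyperProj_analyticAt i 0)⟩
  map_one' := rfl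
  map_zero' := rfl
  map_add' := by
    rintro ⟨_, g, hg, rfl⟩ ⟨_, g', hg', rfl⟩
    rfl
  map_mul' := by
    rintro ⟨_, g, hg, rfl⟩ ⟨_, g', hg', rfl⟩
    rfl

theorem restr_mk (i : Fin n) (g : (Fin n → ℂ) → ℂ) (hg : AnalyticAt ℂ g 0) :
    restr i (HolGerm.mk g hg) = HolGerm.mk (g ∘ hyperProj i)
      (AnalyticAt.comp (by rwa [hyperProj_zero]) (hyperProj_analyticAt i 0)) := rfl

theorem restr_coord_self (i : Fin n) : restr i (coord i) = 0 :=
  Subtype.ext (Germ.coe_eq.2 (Eventually.of_forall fun x => hyperProj_apply_self i x))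

theorem restr_coord_of_ne {i j : Fin n} (h : j ≠ i) : restr i (coord j) = coord j :=
  Subtype.ext (Germ.coe_eq.2 (Eventually.of_forall fun x => hyperProj_apply_ne h x))

theorem exists_sub_restr_eq (i : Fin n) (φ : HolGerm n) : ∃ a, φ - restr i φ = coord i * a := by
  obtain ⟨g, hg, rfl⟩ := φ.exists_rep
  obtain ⟨a, ha, h⟩ := exists_analyticAt_sub_eq_smul hg
    (ContinuousLinearMap.proj (R := ℂ) (φ := fun _ : Fin n => ℂ) i) (Pi.single i (1 : ℂ))
  exact ⟨HolGerm.mk a ha, Subtype.ext (Germ.coe_eq.2 h)⟩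

theorem coord_dvd_iff (i : Fin n) (φ : HolGerm n) : coord i ∣ φ ↔ restr i φ = 0 := by
  constructor
  · rintro ⟨a, rfl⟩
    rw [map_mul, restr_coord_self, zero_mul]
  · intro h
    obtain ⟨a, ha⟩ := exists_sub_restr_eq i φ
    exact ⟨a, by rw [← ha, h, sub_zero]⟩

theorem pdFun_coord (i j : Fin n) (x : Fin n → ℂ) :
    pdFun i (fun x => x j) x = if i = j then 1 else 0 := by
  have : fderiv ℂ (fun x : Fin n → ℂ => x j) x = ContinuousLinearMap.proj j :=
    (ContinuousLinearMap.proj (R := ℂ) (φ := fun _ : Fin n => ℂ) j).fderiv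
  rw [pdFun, this, ContinuousLinearMap.proj_apply, Pi.single_apply]
  exact if_congr eq_comm rfl rfl

theorem pd_coord_self (i : Fin n) : pd i (coord i) = 1 :=
  Subtype.ext (Germ.coe_eq.2 (Eventually.of_forall fun x => by simp [pdFun_coord]))

theorem pd_coord_of_ne {i j : Fin n} (h : i ≠ j) : pd i (coord j) = 0 :=
  Subtype.ext (Germ.coe_eq.2 (Eventually.of_forall fun x => by simp [pdFun_coord, h]))

theorem coord_ne_zero (i : Fin n) : coord i ≠ 0 := fun h => by
  simpa [h] using pd_coord_self i

theorem pd_comm (i j : Fin n) (φ : HolGerm n) : pd i (pd j φ) = pd j (pd i φ) := by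
  obtain ⟨g, hg, rfl⟩ := φ.exists_rep
  refine Subtype.ext (Germ.coe_eq.2 ?_)
  filter_upwards [hg.eventually_analyticAt] with x hx
  have h1 (k l : Fin n) : pdFun k (pdFun l g) x =
      fderiv ℂ (fderiv ℂ g) x (Pi.single k 1) (Pi.single l 1) := by
    change fderiv ℂ (fun y => fderiv ℂ g y (Pi.single l 1)) x (Pi.single k 1) = _
    rw [fderiv_clm_apply hx.fderiv.differentiableAt (differentiableAt_const _)]
    simp
  rw [h1, h1]
  exact (hx.contDiffAt (n := ω)).isSymmSndFDerivAt (by simp) _ _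

theorem prod_coord_val (S : Finset (Fin n)) : (∏ i ∈ S, coord i : HolGerm n).1 =
    ((fun x => ∏ i ∈ S, x i : (Fin n → ℂ) → ℂ) : Germ (𝓝 (0 : Fin n → ℂ)) ℂ) := by
  induction S using Finset.induction_on with
  | empty => rfl
  | insert i S hi ih =>
    simp only [Finset.prod_insert hi]
    change (coord i).1 * (∏ i ∈ S, coord i : HolGerm n).1 = _
    rw [ih]
    rfl

theorem restr_prod_coord {S : Finset (Fin n)} {i : Fin n} (hi : i ∉ S) :
    restr i (∏ j ∈ S, coord j) = ∏ j ∈ S, coord j := by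
  rw [map_prod]
  exact Finset.prod_congr rfl fun j hj => restr_coord_of_ne fun h => hi (h ▸ hj)

/-- A germ that vanishes on each of the hyperplanes `xᵢ = 0`, `i ∈ S`, is divisible by `∏ xᵢ`. -/
theorem prod_coord_dvd {S : Finset (Fin n)} {φ : HolGerm n} (h : ∀ i ∈ S, restr i φ = 0) :
    ∏ i ∈ S, coord i ∣ φ := by
  induction S using Finset.induction_on with
  | empty => simp
  | insert i S hi ih =>
    obtain ⟨a, rfl⟩ := ih fun j hj => h j (Finset.mem_insert_of_mem hj)
    have h0 := h i (Finset.mem_insert_self i S)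
    rw [map_mul, restr_prod_coord hi] at h0
    have ha := (mul_eq_zero.1 h0).resolve_left
      (Finset.prod_ne_zero_iff.2 fun j _ => coord_ne_zero j)
    obtain ⟨b, rfl⟩ := (coord_dvd_iff i a).2 ha
    rw [Finset.prod_insert hi]
    exact ⟨b, by ring⟩

/-! ### Normal forms of differential operators -/

theorem DiffOp.ext {P Q : DiffOp n} (h : ∀ a, P.1 a = Q.1 a) : P = Q :=
  Subtype.ext (LinearMap.ext h)

/-- The embedding of `𝒪` in `𝒟`. -/
def mulHom : HolGerm n →+* DiffOp n where
  toFun := DiffOp.mul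
  map_one' := DiffOp.ext fun a => one_mul a
  map_zero' := DiffOp.ext fun a => zero_mul a
  map_add' b c := DiffOp.ext fun a => add_mul b c a
  map_mul' b c := DiffOp.ext fun a => mul_assoc b c a

theorem mulHom_apply (a : HolGerm n) : mulHom a = DiffOp.mul a := rfl

theorem del_mul_mulHom (i : Fin n) (a : HolGerm n) :
    DiffOp.del i * mulHom a = mulHom a * DiffOp.del i + mulHom (pd i a) :=
  DiffOp.ext fun b => by
    change pd i (a * b) = a * pd i b + pd i a * b
    rw [Derivation.leibniz, smul_eq_mul, smul_eq_mul, mul_comm b]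

theorem del_mul_del (i j : Fin n) :
    DiffOp.del i * DiffOp.del j = DiffOp.del j * DiffOp.del i :=
  DiffOp.ext fun a => pd_comm i j a

instance : LeftCommutative fun (i : Fin n) (P : DiffOp n) => DiffOp.del i * P :=
  ⟨fun i j P => by rw [← mul_assoc, del_mul_del, mul_assoc]⟩

/-- The operator `∂^m`; the multiset `m` of indices stands for a multi-index. -/
def delPow (m : Multiset (Fin n)) : DiffOp n := m.foldr (fun i P => DiffOp.del i * P) 1

theorem delPow_zero : delPow (0 : Multiset (Fin n)) = 1 := Multiset.foldr_zero _ _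

theorem delPow_cons (i : Fin n) (m : Multiset (Fin n)) :
    delPow (i ::ₘ m) = DiffOp.del i * delPow m := Multiset.foldr_cons _ _ _ _

theorem del_mul_delPow (i : Fin n) (m : Multiset (Fin n)) :
    DiffOp.del i * delPow m = delPow m * DiffOp.del i := by
  induction m using Multiset.induction_on with
  | empty => rw [delPow_zero, mul_one, one_mul]
  | cons j m ih => rw [delPow_cons, ← mul_assoc, del_mul_del, mul_assoc, ih, mul_assoc]

/-- The operator `∑ c_m ∂^m` with coefficients `c`. -/
def opOfCoeff : (Multiset (Fin n) →₀ HolGerm n) →+ DiffOp n :=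
  Finsupp.liftAddHom fun m => (AddMonoidHom.mulRight (delPow m)).comp mulHom.toAddMonoidHom

theorem opOfCoeff_single (m : Multiset (Fin n)) (c : HolGerm n) :
    opOfCoeff (Finsupp.single m c) = mulHom c * delPow m :=
  Finsupp.liftAddHom_apply_single _ _ _

theorem opOfCoeff_apply (c : Multiset (Fin n) →₀ HolGerm n) :
    opOfCoeff c = ∑ m ∈ c.support, mulHom (c m) * delPow m := rfl

theorem DiffOp.induction {p : DiffOp n → Prop} (hmul : ∀ a, p (DiffOp.mul a))
    (hdel : ∀ i, p (DiffOp.del i)) (hadd : ∀ P Q, p P → p Q → p (P + Q))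
    (hcomp : ∀ P Q, p P → p Q → p (P * Q)) (P : DiffOp n) : p P := by
  obtain ⟨P, hP⟩ := P
  induction hP using Algebra.adjoin_induction with
  | mem P hP =>
    rcases hP with ⟨a, rfl⟩ | ⟨i, rfl⟩
    · exact hmul a
    · exact hdel i
  | algebraMap z =>
    have : DiffOp.mul (algebraMap ℂ (HolGerm n) z) =
        ⟨algebraMap ℂ _ z, Subalgebra.algebraMap_mem _ z⟩ :=
      DiffOp.ext fun a => (Algebra.smul_def z a).symm
    exact this ▸ hmul _
  | add P Q hP hQ h h' => exact hadd _ _ h h'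
  | mul P Q hP hQ h h' => exact hcomp _ _ h h'

theorem mul_mem_range_opOfCoeff (P : DiffOp n) : ∀ Q ∈ (opOfCoeff (n := n)).range,
    P * Q ∈ (opOfCoeff (n := n)).range := by
  induction P using DiffOp.induction with
  | hmul a =>
    rintro _ ⟨c, rfl⟩
    rw [opOfCoeff_apply, Finset.mul_sum]
    refine sum_mem fun m _ => ⟨Finsupp.single m (a * c m), ?_⟩
    rw [opOfCoeff_single, map_mul, mul_assoc, mulHom_apply]
  | hdel i =>
    rintro _ ⟨c, rfl⟩
    rw [opOfCoeff_apply, Finset.mul_sum]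
    refine sum_mem fun m _ => ⟨Finsupp.single (i ::ₘ m) (c m) +
      Finsupp.single m (pd i (c m)), ?_⟩
    rw [map_add, opOfCoeff_single, opOfCoeff_single, delPow_cons, ← mul_assoc, ← add_mul,
      ← del_mul_mulHom, mul_assoc]
  | hadd P P' ih ih' =>
    intro Q hQ
    rw [add_mul]
    exact add_mem (ih Q hQ) (ih' Q hQ)
  | hcomp P P' ih ih' =>
    intro Q hQ
    rw [mul_assoc]
    exact ih _ (ih' Q hQ)

theorem opOfCoeff_surjective : Function.Surjective (opOfCoeff (n := n)) := fun P => by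
  have h1 : (1 : DiffOp n) ∈ (opOfCoeff (n := n)).range :=
    ⟨Finsupp.single 0 1, by rw [opOfCoeff_single, map_one, delPow_zero, one_mul]⟩
  simpa using mul_mem_range_opOfCoeff P _ h1

/-- The left ideal generated by the `∂ᵢ`, `i ≥ r`, and by the `xᵢ∂ᵢ + 1`, `i < r`. -/
def logIdeal (n r : ℕ) : Ideal (DiffOp n) :=
  Ideal.span ({P | ∃ i : Fin n, r ≤ i.val ∧ P = DiffOp.del i} ∪
    {P | ∃ i : Fin n, i.val < r ∧ P = DiffOp.mul (coord i) * DiffOp.del i + 1})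

theorem delPow_mem_logIdeal {r : ℕ} {i : Fin n} (hi : r ≤ i.val) {m : Multiset (Fin n)}
    (him : i ∈ m) : delPow m ∈ logIdeal n r := by
  obtain ⟨m, rfl⟩ := Multiset.exists_cons_of_mem him
  rw [delPow_cons, del_mul_delPow]
  exact Ideal.mul_mem_left _ _ (Ideal.subset_span (.inl ⟨i, hi, rfl⟩))

theorem coord_mul_delPow_cons {r : ℕ} {i : Fin n} (hi : i.val < r) (m : Multiset (Fin n)) :
    mulHom (coord i) * delPow (i ::ₘ m) + ((m.count i + 1 : ℕ) : DiffOp n) * delPow m ∈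
      logIdeal n r := by
  induction m using Multiset.induction_on with
  | empty =>
    rw [delPow_cons, delPow_zero, mul_one]
    have h : DiffOp.mul (coord i) * DiffOp.del i + 1 ∈ logIdeal n r :=
      Ideal.subset_span (.inr ⟨i, hi, rfl⟩)
    simpa [mulHom_apply] using h
  | cons j m ih =>
    have h := Ideal.mul_mem_left _ (DiffOp.del j) ih
    rw [mul_add, ← mul_assoc, del_mul_mulHom, add_mul, mul_assoc, ← delPow_cons j,
      Multiset.cons_swap, ← mul_assoc _ _ (delPow m), ← (Nat.cast_commute _ (DiffOp.del j)).eq,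
      mul_assoc _ _ (delPow m), ← delPow_cons] at h
    by_cases hij : j = i
    · subst hij
      rw [pd_coord_self, map_one, one_mul] at h
      rw [Multiset.count_cons_self]
      convert h using 1
      push_cast
      rw [add_mul _ 1, one_mul]
      abel
    · rw [pd_coord_of_ne hij, map_zero, zero_mul, add_zero] at h
      rwa [Multiset.count_cons_of_ne (Ne.symm hij)]

/-! ### Monomials -/

/-- The monomial `x^m`. -/
def coordPow (m : Multiset (Fin n)) : HolGerm n := (m.map coord).prod

theorem coordPow_cons (i : Fin n) (m : Multiset (Fin n)) :
    coordPow (i ::ₘ m) = coord i * coordPow m := by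
  rw [coordPow, Multiset.map_cons, Multiset.prod_cons, coordPow]

theorem coordPow_add (m m' : Multiset (Fin n)) :
    coordPow (m + m') = coordPow m * coordPow m' := by
  rw [coordPow, Multiset.map_add, Multiset.prod_add, coordPow, coordPow]

theorem coordPow_ne_zero (m : Multiset (Fin n)) : coordPow m ≠ 0 :=
  Multiset.prod_ne_zero fun h => by
    obtain ⟨i, -, hi⟩ := Multiset.mem_map.1 h
    exact coord_ne_zero i hi

theorem exists_coordPow_eq_pow_mul (i : Fin n) (m : Multiset (Fin n)) :
    ∃ g, coordPow m = coord i ^ m.count i * g := by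
  obtain ⟨m', hm⟩ := Multiset.le_iff_exists_add.1 (Multiset.le_count_iff_replicate_le.1
    (le_refl (m.count i)))
  refine ⟨coordPow m', ?_⟩
  conv_lhs => rw [hm, coordPow_add]
  congr 1
  rw [coordPow, Multiset.map_replicate, Multiset.prod_replicate]

theorem coord_mul_pd_coordPow (i : Fin n) (m : Multiset (Fin n)) :
    coord i * pd i (coordPow m) = (m.count i : HolGerm n) * coordPow m := by
  induction m using Multiset.induction_on with
  | empty => simp [coordPow]
  | cons j m ih =>
    rw [coordPow_cons, Derivation.leibniz, smul_eq_mul, smul_eq_mul]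
    by_cases hij : i = j
    · subst hij
      rw [pd_coord_self, Multiset.count_cons_self]
      push_cast
      linear_combination coord i * ih
    · rw [pd_coord_of_ne hij, Multiset.count_cons_of_ne hij]
      linear_combination coord j * ih

theorem delPow_cons_apply (i : Fin n) (m : Multiset (Fin n)) (a : HolGerm n) :
    (delPow (i ::ₘ m)).1 a = pd i ((delPow m).1 a) := by
  rw [delPow_cons]; rfl

theorem delPow_cons_apply' (i : Fin n) (m : Multiset (Fin n)) (a : HolGerm n) :
    (delPow (i ::ₘ m)).1 a = (delPow m).1 (pd i a) := by
  rw [delPow_cons, del_mul_delPow]; rfl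

theorem pow_dvd_delPow_apply (i : Fin n) (m : Multiset (Fin n)) (e : ℕ) (g : HolGerm n) :
    coord i ^ e ∣ (delPow m).1 (coord i ^ (e + m.count i) * g) := by
  induction m using Multiset.induction_on generalizing e with
  | empty =>
    rw [delPow_zero]
    exact ⟨g, by rw [Multiset.count_zero, add_zero]; rfl⟩
  | cons j m ih =>
    rw [delPow_cons_apply]
    by_cases hij : i = j
    · subst hij
      obtain ⟨a, ha⟩ := ih (e + 1)
      rw [Multiset.count_cons_self, ← add_assoc, add_right_comm, ha, Derivation.leibniz,
        Derivation.leibniz_pow, pd_coord_self]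
      simp only [smul_eq_mul, nsmul_eq_mul, Nat.add_sub_cancel]
      exact ⟨coord i * pd i a + a * ((e + 1 : ℕ) : HolGerm n), by ring⟩
    · obtain ⟨a, ha⟩ := ih e
      rw [Multiset.count_cons_of_ne hij, ha, Derivation.leibniz, Derivation.leibniz_pow,
        pd_coord_of_ne (Ne.symm hij)]
      simp only [smul_eq_mul, nsmul_eq_mul, mul_zero, add_zero]
      exact ⟨pd j a, rfl⟩

theorem coord_dvd_delPow_apply_coordPow {i : Fin n} {m m' : Multiset (Fin n)}
    (h : m.count i < m'.count i) (g : HolGerm n) :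
    coord i ∣ (delPow m).1 (g * coordPow m') := by
  obtain ⟨g', hg'⟩ := exists_coordPow_eq_pow_mul i m'
  have h1 := pow_dvd_delPow_apply i m 1 (coord i ^ (m'.count i - m.count i - 1) * (g * g'))
  rw [pow_one] at h1
  rw [hg']
  convert h1 using 2
  rw [← mul_assoc (coord i ^ _) (coord i ^ _), ← pow_add,
    show 1 + m.count i + (m'.count i - m.count i - 1) = m'.count i by omega]
  ring

/-- Modulo an ideal that contains the `xᵢ`, `i ∈ m`, the operator `∂^m` sends `c x^m` to a nonzero
multiple of `c`. -/
theorem exists_delPow_apply_mul_coordPow {I : Ideal (HolGerm n)} (m : Multiset (Fin n))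
    (hm : ∀ i ∈ m, coord i ∈ I) (c : HolGerm n) :
    ∃ k : ℕ, k ≠ 0 ∧ (delPow m).1 (c * coordPow m) - (k : HolGerm n) * c ∈ I := by
  induction m using Multiset.induction_on generalizing c with
  | empty =>
    refine ⟨1, one_ne_zero, ?_⟩
    rw [delPow_zero]
    change c * coordPow 0 - _ ∈ I
    simp [coordPow]
  | cons i m ih =>
    obtain ⟨k, hk0, hk⟩ := ih (fun j hj => hm j (Multiset.mem_cons_of_mem hj)) c
    refine ⟨(m.count i + 1) * k, mul_ne_zero (Nat.succ_ne_zero _) hk0, ?_⟩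
    have h1 : pd i (c * coordPow (i ::ₘ m)) =
        pd i c * coordPow (i ::ₘ m) + (m.count i + 1 : ℕ) • (c * coordPow m) := by
      rw [Derivation.leibniz, smul_eq_mul, smul_eq_mul, coordPow_cons, Derivation.leibniz,
        smul_eq_mul, smul_eq_mul, pd_coord_self, coord_mul_pd_coordPow, nsmul_eq_mul]
      push_cast
      ring
    rw [delPow_cons_apply', h1, map_add, map_nsmul, nsmul_eq_mul]
    have h2 : (delPow m).1 (pd i c * coordPow (i ::ₘ m)) ∈ I :=
      I.mem_of_dvd (coord_dvd_delPow_apply_coordPow (by simp) _)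
        (hm i (Multiset.mem_cons_self i m))
    convert I.add_mem h2 (I.mul_mem_left ((m.count i + 1 : ℕ) : HolGerm n) hk) using 1
    push_cast
    ring

/-- The substitution `xᵢ = 0` for all `i ∈ S`, as an endomorphism of `𝒪`. -/
theorem exists_restr_finset (S : Finset (Fin n)) : ∃ ρ : HolGerm n →+* HolGerm n,
    (∀ i ∈ S, ρ (coord i) = 0) ∧ (∀ i ∉ S, ρ (coord i) = coord i) ∧
    ∀ φ, φ - ρ φ ∈ Ideal.span (coord '' (S : Set (Fin n))) := by
  induction S using Finset.induction_on with
  | empty => exact ⟨RingHom.id _, by simp, by simp, by simp⟩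
  | insert i S hi ih =>
    obtain ⟨ρ, h1, h2, h3⟩ := ih
    refine ⟨(restr i).comp ρ, fun j hj => ?_, fun j hj => ?_, fun φ => ?_⟩
    · rcases Finset.mem_insert.1 hj with rfl | hj
      · rw [RingHom.comp_apply, h2 j hi, restr_coord_self]
      · rw [RingHom.comp_apply, h1 j hj, map_zero]
    · rw [Finset.mem_insert, not_or] at hj
      rw [RingHom.comp_apply, h2 j hj.2, restr_coord_of_ne hj.1]
    · obtain ⟨a, ha⟩ := exists_sub_restr_eq i (ρ φ)
      have h4 : φ - ρ φ ∈ Ideal.span (coord '' ((insert i S : Finset (Fin n)) : Set (Fin n))) :=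
        Ideal.span_mono (Set.image_mono (by simp)) (h3 φ)
      have h5 : coord i * a ∈ Ideal.span (coord '' ((insert i S : Finset (Fin n)) :
          Set (Fin n))) :=
        Ideal.mul_mem_right _ _ (Ideal.subset_span ⟨i, by simp, rfl⟩)
      rw [← ha] at h5
      simpa using add_mem h4 h5

/-- The coordinates outside `S` are not zero divisors modulo the `xᵢ`, `i ∈ S`. -/
theorem mem_span_coord_of_mul_coordPow_mem {S : Finset (Fin n)} {m : Multiset (Fin n)}
    (hm : ∀ i ∈ m, i ∉ S) {c : HolGerm n}
    (h : c * coordPow m ∈ Ideal.span (coord '' (S : Set (Fin n)))) :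
    c ∈ Ideal.span (coord '' (S : Set (Fin n))) := by
  obtain ⟨ρ, h1, h2, h3⟩ := exists_restr_finset S
  have hker : Ideal.span (coord '' (S : Set (Fin n))) ≤ RingHom.ker ρ := by
    rw [Ideal.span_le]
    rintro _ ⟨i, hi, rfl⟩
    exact h1 i hi
  have h4 : ρ (coordPow m) = coordPow m := by
    rw [coordPow, map_multiset_prod, Multiset.map_map]
    exact congrArg _ (Multiset.map_congr rfl fun i hi => h2 i (hm i hi))
  have h5 : ρ (c * coordPow m) = 0 := hker h
  rw [map_mul, h4] at h5
  have h6 := h3 c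
  rwa [(mul_eq_zero.1 h5).resolve_right (coordPow_ne_zero m), sub_zero] at h6

/-! ### The action on `1/f` -/

section Action

variable {r : ℕ}

theorem pd_prod_coord_of_notMem {S : Finset (Fin n)} {i : Fin n} (hi : i ∉ S) :
    pd i (∏ j ∈ S, coord j) = 0 := by
  induction S using Finset.induction_on with
  | empty => simp
  | insert j S hj ih =>
    rw [Finset.mem_insert, not_or] at hi
    rw [Finset.prod_insert hj, Derivation.leibniz, ih hi.2, pd_coord_of_ne hi.1, smul_zero,
      smul_zero, add_zero]

theorem coord_mul_pd_crossing {i : Fin n} (hi : i.val < r) :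
    coord i * pd i (crossing n r) = crossing n r := by
  rw [crossing, ← Finset.mul_prod_erase _ _ (Finset.mem_filter.2 ⟨Finset.mem_univ i, hi⟩),
    Derivation.leibniz, pd_prod_coord_of_notMem (Finset.notMem_erase _ _), pd_coord_self]
  simp

theorem pd_crossing_of_le {i : Fin n} (hi : r ≤ i.val) : pd i (crossing n r) = 0 :=
  pd_prod_coord_of_notMem (by simpa using hi)

theorem crossing_ne_zero (n r : ℕ) : crossing n r ≠ 0 :=
  Finset.prod_ne_zero_iff.2 fun i _ => coord_ne_zero i

theorem algebraMap_meroGerm_injective (n r : ℕ) :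
    Function.Injective (algebraMap (HolGerm n) (MeroGerm (crossing n r))) :=
  IsLocalization.injective _ (powers_le_nonZeroDivisors_of_noZeroDivisors (crossing_ne_zero n r))

/-- `1/f`, for `f = x₁ ⋯ x_r`. -/
local notation "uf" => MeroGerm.inv (crossing n r)

/-- The inclusion of `𝒪` in `𝒪[1/f]`, for `f = x₁ ⋯ x_r`. -/
local notation "ιf" => algebraMap (HolGerm n) (MeroGerm (crossing n r))

theorem crossing_mul_inv : ιf (crossing n r) * uf = 1 :=
  IsLocalization.Away.mul_invSelf _

variable (n r) in
/-- The logarithmic derivative `∂ᵢf/f` of `f = x₁ ⋯ x_r`: it is `1/xᵢ` for `i < r` and `0` for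
`i ≥ r`. -/
def logDer (i : Fin n) : MeroGerm (crossing n r) :=
  uf * algebraMap (HolGerm n) (MeroGerm (crossing n r)) (pd i (crossing n r))

theorem coord_mul_logDer {i : Fin n} (hi : i.val < r) : ιf (coord i) * logDer n r i = 1 := by
  rw [logDer, mul_left_comm, ← map_mul, coord_mul_pd_crossing hi, mul_comm, crossing_mul_inv]

theorem logDer_of_le {i : Fin n} (hi : r ≤ i.val) : logDer n r i = 0 := by
  rw [logDer, pd_crossing_of_le hi, map_zero, mul_zero]

/-- The partial derivative on `𝒪[1/f]`, for `f = x₁ ⋯ x_r`. -/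
abbrev locPd (r : ℕ) (i : Fin n) :
    Derivation ℂ (MeroGerm (crossing n r)) (MeroGerm (crossing n r)) :=
  locDer (MeroGerm (crossing n r)) (crossing n r) (pd i)

theorem locDer_inv (i : Fin n) : locPd r i uf = -(logDer n r i * uf) := by
  have h := congrArg (locPd r i) (crossing_mul_inv (n := n) (r := r))
  simp only [Derivation.leibniz, Derivation.map_one_eq_zero, locDer_algebraMap,
    smul_eq_mul] at h
  rw [logDer]
  linear_combination uf * h - locPd r i uf * crossing_mul_inv (n := n) (r := r)

theorem locDer_logDer_self (i : Fin n) :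
    locPd r i (logDer n r i) = -(logDer n r i * logDer n r i) := by
  rcases lt_or_ge i.val r with hi | hi
  · have h := congrArg (locPd r i) (coord_mul_logDer hi)
    simp only [Derivation.leibniz, Derivation.map_one_eq_zero, locDer_algebraMap,
      smul_eq_mul, pd_coord_self, map_one] at h
    linear_combination logDer n r i * h - locPd r i (logDer n r i) * coord_mul_logDer hi
  · rw [logDer_of_le hi]
    simp

theorem locDer_logDer_of_ne {i j : Fin n} (hij : i ≠ j) : locPd r i (logDer n r j) = 0 := by
  rcases lt_or_ge j.val r with hj | hj
  · have h := congrArg (locPd r i) (coord_mul_logDer hj)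
    simp only [Derivation.leibniz, Derivation.map_one_eq_zero, locDer_algebraMap,
      smul_eq_mul, pd_coord_of_ne hij, map_zero] at h
    linear_combination logDer n r j * h - locPd r i (logDer n r j) * coord_mul_logDer hj
  · rw [logDer_of_le hj, map_zero]

variable (n r) in
/-- The monomial in the logarithmic derivatives `∂ᵢf/f` with multi-index `m`. -/
def logDerPow (m : Multiset (Fin n)) : MeroGerm (crossing n r) :=
  (m.map (logDer n r)).prod

theorem logDerPow_cons (i : Fin n) (m : Multiset (Fin n)) :
    logDerPow n r (i ::ₘ m) = logDer n r i * logDerPow n r m := by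
  rw [logDerPow, Multiset.map_cons, Multiset.prod_cons, logDerPow]

theorem locDer_logDerPow (i : Fin n) (m : Multiset (Fin n)) :
    locPd r i (logDerPow n r m) = -((m.count i : MeroGerm (crossing n r)) *
      (logDer n r i * logDerPow n r m)) := by
  induction m using Multiset.induction_on with
  | empty => simp [logDerPow]
  | cons j m ih =>
    simp only [logDerPow_cons, Derivation.leibniz, smul_eq_mul] at ih ⊢
    rw [ih]
    by_cases hij : i = j
    · subst hij
      have := locDer_logDer_self (r := r) i
      rw [this, Multiset.count_cons_self]
      push_cast
      ring
    · have := locDer_logDer_of_ne (r := r) hij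
      rw [this, Multiset.count_cons_of_ne hij]
      ring

variable (r) in
/-- `∂^m (1/f)` is a nonzero multiple of `x^(-m) / f`. -/
theorem exists_delPow_smul_inv (m : Multiset (Fin n)) : ∃ k : ℂ, k ≠ 0 ∧
    delPow m • uf = algebraMap ℂ (MeroGerm (crossing n r)) k * (logDerPow n r m * uf) := by
  induction m using Multiset.induction_on with
  | empty => exact ⟨1, one_ne_zero, by simp [delPow_zero, logDerPow]⟩
  | cons i m ih =>
    obtain ⟨k, hk0, hk⟩ := ih
    refine ⟨-((m.count i + 1 : ℕ) * k),
      neg_ne_zero.2 (mul_ne_zero (Nat.cast_ne_zero.2 (Nat.succ_ne_zero _)) hk0), ?_⟩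
    have h1 := locDer_inv (n := n) (r := r) i
    have h2 := locDer_logDerPow (r := r) i m
    rw [delPow_cons, mul_smul, hk, del_smul_eq, logDerPow_cons, Derivation.leibniz,
      Derivation.leibniz, Derivation.map_algebraMap, smul_zero, add_zero, h1, h2]
    simp only [smul_eq_mul, map_neg, map_mul, map_natCast]
    push_cast
    ring

theorem coordPow_mul_logDerPow {m : Multiset (Fin n)} (hm : ∀ i ∈ m, i.val < r) :
    ιf (coordPow m) * logDerPow n r m = 1 := by
  induction m using Multiset.induction_on with
  | empty => simp [coordPow, logDerPow]
  | cons i m ih =>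
    rw [coordPow_cons, logDerPow_cons, map_mul, mul_mul_mul_comm,
      coord_mul_logDer (hm i (Multiset.mem_cons_self i m)),
      ih fun j hj => hm j (Multiset.mem_cons_of_mem hj), one_mul]

theorem logDerPow_eq_zero {m : Multiset (Fin n)} {i : Fin n} (him : i ∈ m) (hi : r ≤ i.val) :
    logDerPow n r m = 0 :=
  Multiset.prod_eq_zero (Multiset.mem_map.2 ⟨i, him, logDer_of_le hi⟩)

theorem logDerPow_nsmul (k : ℕ) :
    logDerPow n r (k • (Finset.univ.filter fun i : Fin n => i.val < r).val) = uf ^ k := by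
  have h1 : logDerPow n r (Finset.univ.filter fun i : Fin n => i.val < r).val = uf := by
    have h := coordPow_mul_logDerPow (r := r)
      (m := (Finset.univ.filter fun i : Fin n => i.val < r).val) (by simp)
    have h' : coordPow (Finset.univ.filter fun i : Fin n => i.val < r).val = crossing n r := rfl
    rw [h'] at h
    linear_combination uf * h - logDerPow n r (Finset.univ.filter fun i : Fin n => i.val < r).val *
      crossing_mul_inv (n := n) (r := r)
  rw [logDerPow, Multiset.map_nsmul, Multiset.prod_nsmul, ← logDerPow, h1]

variable (n r) in
theorem span_inv_eq_top :
    Submodule.span (DiffOp n) {MeroGerm.inv (crossing n r)} = ⊤ := by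
  have hpow (k : ℕ) : uf ^ k ∈ Submodule.span (DiffOp n) {uf} := by
    cases k with
    | zero =>
      refine Submodule.mem_span_singleton.2 ⟨DiffOp.mul (crossing n r), ?_⟩
      rw [mul_smul_eq, crossing_mul_inv, pow_zero]
    | succ k =>
      obtain ⟨c, hc0, hc⟩ := exists_delPow_smul_inv r
        (k • (Finset.univ.filter fun i : Fin n => i.val < r).val)
      refine Submodule.mem_span_singleton.2 ⟨DiffOp.mul (algebraMap ℂ _ c⁻¹) *
        delPow (k • (Finset.univ.filter fun i : Fin n => i.val < r).val), ?_⟩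
      rw [mul_smul, hc, logDerPow_nsmul, mul_smul_eq, ← IsScalarTower.algebraMap_apply,
        ← mul_assoc, ← map_mul, inv_mul_cancel₀ hc0, map_one, one_mul, pow_succ]
  rw [eq_top_iff]
  intro s _
  obtain ⟨k, a, ha⟩ := IsLocalization.Away.surj (crossing n r) s
  have hs : s = DiffOp.mul a • uf ^ k := by
    rw [mul_smul_eq, ← ha, mul_assoc, ← mul_pow, crossing_mul_inv, one_pow, mul_one]
  rw [hs]
  exact Submodule.smul_mem _ _ (hpow k)

/-! ### The annihilator of `1/f` -/

variable (n r) in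
theorem logIdeal_le_torsionOf : logIdeal n r ≤ Ideal.torsionOf (DiffOp n)
    (MeroGerm (crossing n r)) (MeroGerm.inv (crossing n r)) := by
  rw [logIdeal, Ideal.span_le]
  have hdel (i : Fin n) : DiffOp.del i • uf = -(logDer n r i * uf) :=
    (del_smul_eq _ i _).trans (locDer_inv i)
  rintro _ (⟨i, hi, rfl⟩ | ⟨i, hi, rfl⟩)
  · rw [SetLike.mem_coe, Ideal.mem_torsionOf_iff, hdel, logDer_of_le hi, zero_mul, neg_zero]
  · rw [SetLike.mem_coe, Ideal.mem_torsionOf_iff, add_smul, one_smul, mul_smul, hdel, mul_smul_eq,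
      mul_neg, ← mul_assoc, coord_mul_logDer hi, one_mul, neg_add_cancel]

/-- The top coefficients of an operator annihilating `1/f`: `c_m` lies in the ideal of the `xᵢ`
that occur in the multi-index `m`. In the relation `∑ k_m c_m x^(A-m) = 0` obtained by clearing
denominators, the operator `∂^B`, where `B` is the part of `A - m₀` with indices in `m₀`, singles
out the term `m₀`: every other monomial `x^(A-m)` stays divisible by some `xᵢ`, `i ∈ m₀`. -/
theorem coeff_mem_of_smul_inv_eq_zero {c : Multiset (Fin n) →₀ HolGerm n}
    (hc : opOfCoeff c • uf = 0) {m₀ : Multiset (Fin n)}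
    (hcard : ∀ m ∈ c.support, m.card ≤ m₀.card) (hm₀ : ∀ i ∈ m₀, i.val < r) :
    c m₀ ∈ Ideal.span (coord '' (m₀.toFinset : Set (Fin n))) := by
  by_cases hs : m₀ ∈ c.support
  swap
  · rw [Finsupp.notMem_support_iff.1 hs]
    exact zero_mem _
  choose k hk0 hk using exists_delPow_smul_inv (n := n) r
  set A : Multiset (Fin n) := m₀.card • (Finset.univ.filter fun i : Fin n => i.val < r).val with hA
  have hAmem : ∀ i ∈ A, i.val < r := fun i hi => by
    simpa using Multiset.mem_of_mem_nsmul hi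
  have hcountA {i : Fin n} (hi : i.val < r) : A.count i = m₀.card := by
    rw [hA, Multiset.count_nsmul, Multiset.count_eq_one_of_mem (Finset.nodup _) (by simpa using hi),
      mul_one]
  have hle {m : Multiset (Fin n)} (hm : m ∈ c.support) (hmr : ∀ i ∈ m, i.val < r) : m ≤ A :=
    Multiset.le_iff_count.2 fun i => by
      by_cases hi : i ∈ m
      · rw [hcountA (hmr i hi)]
        exact (Multiset.count_le_card i m).trans (hcard m hm)
      · rw [Multiset.count_eq_zero_of_notMem hi]
        exact Nat.zero_le _
  let G : Finset (Multiset (Fin n)) := c.support.filter fun m => ∀ i ∈ m, i.val < r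
  -- the equation `P (1/f) = 0`, multiplied by `x^A f`
  have hsum : ∑ m ∈ G, algebraMap ℂ (HolGerm n) (k m) * c m * coordPow (A - m) = 0 := by
    refine algebraMap_meroGerm_injective n r ?_
    rw [map_zero, map_sum]
    rw [opOfCoeff_apply, Finset.sum_smul] at hc
    have hc' := congrArg (fun s => ιf (coordPow A) * ιf (crossing n r) * s) hc
    simp only [mul_zero, Finset.mul_sum] at hc'
    rw [← hc', Finset.sum_filter]
    refine Finset.sum_congr rfl fun m hm => ?_
    rw [mul_smul, hk, mulHom_apply, mul_smul_eq]
    split_ifs with hmr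
    · rw [map_mul, map_mul, ← IsScalarTower.algebraMap_apply]
      have h1 : ιf (coordPow A) = ιf (coordPow (A - m)) * ιf (coordPow m) := by
        rw [← map_mul, ← coordPow_add, tsub_add_cancel_of_le (hle hm hmr)]
      rw [h1]
      have h2 := coordPow_mul_logDerPow hmr
      have h3 := crossing_mul_inv (n := n) (r := r)
      generalize algebraMap ℂ (MeroGerm (crossing n r)) (k m) = z
      generalize ιf (coordPow (A - m)) = a
      linear_combination (-(z * ιf (c m) * a)) * h2 -
        (z * ιf (c m) * a * ιf (coordPow m) * logDerPow n r m) * h3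
    · push Not at hmr
      obtain ⟨i, him, hi⟩ := hmr
      rw [logDerPow_eq_zero him hi]
      simp
  -- apply `∂^B` for the part `B` of `A - m₀` with indices in `m₀`
  set I := Ideal.span (coord '' (m₀.toFinset : Set (Fin n))) with hI
  set B := (A - m₀).filter (· ∈ m₀) with hB
  set C := (A - m₀).filter (· ∉ m₀) with hC
  have hBI : ∀ i ∈ m₀, coord i ∈ I := fun i hi => Ideal.subset_span ⟨i, by simpa using hi, rfl⟩
  have hBC : A - m₀ = B + C := (Multiset.filter_add_not _ _).symm
  have hother : ∀ m ∈ G, m ≠ m₀ →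
      (delPow B).1 (algebraMap ℂ (HolGerm n) (k m) * c m * coordPow (A - m)) ∈ I := by
    intro m hm hne
    obtain ⟨hm, hmr⟩ := Finset.mem_filter.1 hm
    obtain ⟨i, hi⟩ : ∃ i, m.count i < m₀.count i := by
      by_contra hcon
      push Not at hcon
      exact hne (Multiset.eq_of_le_of_card_le (Multiset.le_iff_count.2 hcon) (hcard m hm)).symm
    have him : i ∈ m₀ := Multiset.count_pos.1 (by omega)
    refine I.mem_of_dvd (coord_dvd_delPow_apply_coordPow ?_ _) (hBI i him)
    rw [hB, Multiset.count_filter_of_pos him, Multiset.count_sub, Multiset.count_sub,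
      hcountA (hm₀ i him)]
    have := Multiset.count_le_card i m₀
    omega
  have hm₀G : m₀ ∈ G := Finset.mem_filter.2 ⟨hs, hm₀⟩
  have h0 := congrArg (delPow B).1 hsum
  rw [map_sum, map_zero, ← Finset.add_sum_erase _ _ hm₀G] at h0
  have h1 : (delPow B).1 (algebraMap ℂ (HolGerm n) (k m₀) * c m₀ * coordPow (A - m₀)) ∈ I := by
    rw [eq_neg_of_add_eq_zero_left h0]
    exact neg_mem (sum_mem fun m hm => hother m (Finset.mem_of_mem_erase hm)
      (Finset.ne_of_mem_erase hm))
  obtain ⟨l, hl0, hl⟩ := exists_delPow_apply_mul_coordPow (I := I) B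
    (fun i hi => hBI i (Multiset.mem_filter.1 hi).2)
    (algebraMap ℂ (HolGerm n) (k m₀) * c m₀ * coordPow C)
  rw [mul_assoc _ (coordPow C), mul_comm (coordPow C), ← coordPow_add, ← hBC] at hl
  have h2 := sub_mem h1 hl
  rw [sub_sub_cancel] at h2
  have h3 : c m₀ * coordPow C ∈ I := by
    have h4 := I.mul_mem_left (algebraMap ℂ (HolGerm n) ((l : ℂ)⁻¹ * (k m₀)⁻¹)) h2
    convert h4 using 1
    have h5 : (l : HolGerm n) = algebraMap ℂ (HolGerm n) l := (map_natCast _ _).symm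
    rw [h5, ← mul_assoc, ← mul_assoc, ← mul_assoc, ← map_mul, ← map_mul]
    have h6 : (l : ℂ)⁻¹ * (k m₀)⁻¹ * l * k m₀ = 1 := by
      have := hk0 m₀
      have : (l : ℂ) ≠ 0 := by exact_mod_cast hl0
      field_simp
    rw [h6, map_one, one_mul]
  refine mem_span_coord_of_mul_coordPow_mem (fun i hi => ?_) h3
  simpa using (Multiset.mem_filter.1 hi).2

/-- The operators that are, modulo the left ideal of the `∂ᵢ`, `i ≥ r`, and the `xᵢ∂ᵢ + 1`, `i < r`,
of order `< d`. -/
def ordFiltration (n r d : ℕ) : AddSubgroup (DiffOp n) :=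
  (logIdeal n r).toAddSubgroup ⊔ (Finsupp.supported (HolGerm n) (HolGerm n)
    {m : Multiset (Fin n) | m.card < d}).toAddSubgroup.map opOfCoeff

theorem mem_ordFiltration_of_mem_logIdeal {P : DiffOp n} (hP : P ∈ logIdeal n r) (d : ℕ) :
    P ∈ ordFiltration n r d :=
  (le_sup_left : (logIdeal n r).toAddSubgroup ≤ _) hP

theorem mulHom_mul_delPow_mem_ordFiltration (c : HolGerm n) {m : Multiset (Fin n)} {d : ℕ}
    (hm : m.card < d) : mulHom c * delPow m ∈ ordFiltration n r d := by
  refine (le_sup_right : _ ≤ ordFiltration n r d) ⟨Finsupp.single m c, ?_, opOfCoeff_single m c⟩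
  exact Finsupp.single_mem_supported (HolGerm n) c hm

theorem mulHom_coord_mul_delPow_mem_ordFiltration {m : Multiset (Fin n)} {i : Fin n}
    (him : i ∈ m) (hi : i.val < r) (b : HolGerm n) :
    mulHom (b * coord i) * delPow m ∈ ordFiltration n r m.card := by
  obtain ⟨m, rfl⟩ := Multiset.exists_cons_of_mem him
  have h1 := Ideal.mul_mem_left _ (mulHom b) (coord_mul_delPow_cons hi m)
  have h2 : mulHom (b * ((m.count i + 1 : ℕ) : HolGerm n)) * delPow m ∈
      ordFiltration n r (i ::ₘ m).card :=
    mulHom_mul_delPow_mem_ordFiltration _ (by simp)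
  have h3 := sub_mem (mem_ordFiltration_of_mem_logIdeal h1 _) h2
  rw [map_mul, mul_assoc]
  convert h3 using 1
  rw [map_mul, map_natCast, mul_add, mul_assoc (mulHom b) (Nat.cast _), add_sub_cancel_right]

/-- An operator that annihilates `1/f` has, modulo the ideal, smaller and smaller order. -/
theorem mem_logIdeal_of_mem_ordFiltration {d : ℕ} {P : DiffOp n} (hP : P ∈ ordFiltration n r d)
    (h0 : P • uf = 0) : P ∈ logIdeal n r := by
  induction d generalizing P with
  | zero =>
    obtain ⟨Q, hQ, _, ⟨c, hc, rfl⟩, rfl⟩ := AddSubgroup.mem_sup.1 hP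
    have hc0 : c = 0 := by
      have : (c.support : Set (Multiset (Fin n))) ⊆ {m | m.card < 0} := hc
      ext1 m
      by_contra hm
      exact absurd (this (Finsupp.mem_support_iff.2 hm)) (Nat.not_lt_zero _)
    rw [hc0, map_zero, add_zero]
    exact hQ
  | succ d ih =>
    refine ih ?_ h0
    obtain ⟨Q, hQ, _, ⟨c, hc, rfl⟩, rfl⟩ := AddSubgroup.mem_sup.1 hP
    have hQ0 : Q • uf = 0 := logIdeal_le_torsionOf n r hQ
    rw [add_smul, hQ0, zero_add] at h0
    refine add_mem (mem_ordFiltration_of_mem_logIdeal hQ _) ?_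
    have hcard : ∀ m ∈ c.support, m.card < d + 1 := fun m hm => hc hm
    rw [opOfCoeff_apply]
    refine sum_mem fun m hm => ?_
    rcases (Nat.lt_succ_iff.1 (hcard m hm)).lt_or_eq with hlt | rfl
    · exact mulHom_mul_delPow_mem_ordFiltration _ hlt
    by_cases hmr : ∀ i ∈ m, i.val < r
    · have h1 := coeff_mem_of_smul_inv_eq_zero h0
        (fun m' hm' => Nat.lt_succ_iff.1 (hcard m' hm')) hmr
      have h2 : ∀ a ∈ Ideal.span (coord '' (m.toFinset : Set (Fin n))), ∀ b,
          mulHom (b * a) * delPow m ∈ ordFiltration n r m.card := by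
        intro a ha
        induction ha using Submodule.span_induction with
        | mem a ha =>
          obtain ⟨i, hi, rfl⟩ := ha
          have him : i ∈ m := by simpa using hi
          exact mulHom_coord_mul_delPow_mem_ordFiltration him (hmr i him)
        | zero =>
          intro b
          rw [mul_zero, map_zero, zero_mul]
          exact zero_mem _
        | add a a' _ _ ha ha' =>
          intro b
          rw [mul_add, map_add, add_mul]
          exact add_mem (ha b) (ha' b)
        | smul a' a _ ha =>
          intro b
          rw [smul_eq_mul, ← mul_assoc]
          exact ha (b * a')
      simpa using h2 _ h1 1
    · push Not at hmr
      obtain ⟨i, him, hi⟩ := hmr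
      exact mem_ordFiltration_of_mem_logIdeal
        (Ideal.mul_mem_left _ _ (delPow_mem_logIdeal hi him)) _

variable (n r) in
theorem torsionOf_inv_eq : Ideal.torsionOf (DiffOp n)
    (MeroGerm (crossing n r)) (MeroGerm.inv (crossing n r)) = logIdeal n r := by
  refine le_antisymm (fun P hP => ?_) (logIdeal_le_torsionOf n r)
  obtain ⟨c, hc⟩ := opOfCoeff_surjective P
  refine mem_logIdeal_of_mem_ordFiltration (d := c.support.sup Multiset.card + 1)
    ((le_sup_right : _ ≤ ordFiltration n r _) ⟨c, fun m hm => ?_, hc⟩) hP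
  exact Nat.lt_succ_of_le (Finset.le_sup (f := Multiset.card) hm)

end Action

/-! ### Logarithmic frames -/

section Frame

/-- The diagonal endomorphism of `ℂⁿ` with entries `zᵢ`. -/
def diagMap (z : Fin n → ℂ) : (Fin n → ℂ) →L[ℂ] (Fin n → ℂ) :=
  ∑ i, z i • (ContinuousLinearMap.proj (R := ℂ) (φ := fun _ : Fin n => ℂ) i).smulRight
    (Pi.single i (1 : ℂ) : Fin n → ℂ)

theorem diagMap_apply (z v : Fin n → ℂ) (i : Fin n) : diagMap z v i = z i * v i := by
  simp [diagMap, _root_.sum_apply, Finset.sum_apply, Pi.single_apply]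

theorem diagMap_comp_diagMap_inv {z : Fin n → ℂ} (hz : ∀ i, z i ≠ 0) :
    (diagMap z).comp (diagMap z⁻¹) = ContinuousLinearMap.id ℂ _ := by
  ext v i
  simp [diagMap_apply, hz i]

theorem diagMap_inv_comp_diagMap {z : Fin n → ℂ} (hz : ∀ i, z i ≠ 0) :
    (diagMap z⁻¹).comp (diagMap z) = ContinuousLinearMap.id ℂ _ := by
  ext v i
  simp [diagMap_apply, hz i]

theorem diagMap_analyticAt {E : Type*} [NormedAddCommGroup E] [NormedSpace ℂ E]
    {z : E → Fin n → ℂ} {x : E} (hz : ∀ i, AnalyticAt ℂ (fun y => z y i) x) :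
    AnalyticAt ℂ (fun y => diagMap (z y)) x :=
  Finset.analyticAt_fun_sum _ fun i _ => (hz i).smul analyticAt_const

variable (r : ℕ) (ξ : (Fin n → ℂ) → (Fin n → ℂ))

/-- The `i`-th coordinate `ξᵢ` if `ξᵢ = 0` is a component of the divisor `ξ₁ ⋯ ξ_r = 0`, and `1`
otherwise. -/
def divCoord (x : Fin n → ℂ) (i : Fin n) : ℂ := if i.val < r then ξ x i else 1

/-- The frame of logarithmic vector fields `ξᵢ ∂/∂ξᵢ` (`i < r`), `∂/∂ξᵢ` (`i ≥ r`), as a field of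
endomorphisms of `ℂⁿ`. -/
def logFrame (x : Fin n → ℂ) : (Fin n → ℂ) →L[ℂ] (Fin n → ℂ) :=
  (fderiv ℂ ξ x).inverse.comp (diagMap (divCoord r ξ x))

/-- The dual coframe `dξᵢ/ξᵢ` (`i < r`), `dξᵢ` (`i ≥ r`), as a field of endomorphisms of `ℂⁿ`. -/
def logCoframe (x : Fin n → ℂ) : (Fin n → ℂ) →L[ℂ] (Fin n → ℂ) :=
  (diagMap (divCoord r ξ x)⁻¹).comp (fderiv ℂ ξ x)

/-- The monomial `∏ ξᵢ^(Nᵢ)`, the product being over `i < r`. -/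
def divPow (N : Fin n → ℕ) (x : Fin n → ℂ) : ℂ := ∏ i, divCoord r ξ x i ^ N i

/-- The logarithmic derivative of `∏ ξᵢ^(Nᵢ)`, in the logarithmic frame. -/
def divWeight (N : Fin n → ℕ) : (Fin n → ℂ) →L[ℂ] ℂ :=
  ∑ i, (N i * (if i.val < r then 1 else 0) : ℂ) •
    ContinuousLinearMap.proj (R := ℂ) (φ := fun _ : Fin n => ℂ) i

theorem divWeight_apply (N : Fin n → ℕ) (v : Fin n → ℂ) :
    divWeight r N v = ∑ i, (N i * (if i.val < r then 1 else 0) : ℂ) * v i := by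
  simp only [divWeight, _root_.sum_apply, _root_.smul_apply,
    ContinuousLinearMap.proj_apply, smul_eq_mul]

/-- The points where `ξ` is a local coordinate system and which are off the divisor. -/
structure IsLogPoint (x : Fin n → ℂ) : Prop where
  analyticAt : AnalyticAt ℂ ξ x
  isInvertible : (fderiv ℂ ξ x).IsInvertible
  ne_zero : ∀ i, divCoord r ξ x i ≠ 0

variable {r ξ} {x : Fin n → ℂ}

theorem fderiv_logFrame_apply (hx : (fderiv ℂ ξ x).IsInvertible) (v : Fin n → ℂ) :
    fderiv ℂ ξ x (logFrame r ξ x v) = diagMap (divCoord r ξ x) v := by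
  obtain ⟨e, he⟩ := hx
  simp [logFrame, ← he]

theorem logCoframe_comp_logFrame (hx : IsLogPoint r ξ x) :
    (logCoframe r ξ x).comp (logFrame r ξ x) = ContinuousLinearMap.id ℂ _ := by
  ext1 v
  rw [ContinuousLinearMap.comp_apply, logCoframe, ContinuousLinearMap.comp_apply,
    fderiv_logFrame_apply hx.isInvertible, ← ContinuousLinearMap.comp_apply,
    diagMap_inv_comp_diagMap hx.ne_zero]

theorem logFrame_comp_logCoframe (hx : IsLogPoint r ξ x) :
    (logFrame r ξ x).comp (logCoframe r ξ x) = ContinuousLinearMap.id ℂ _ := by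
  ext1 v
  obtain ⟨e, he⟩ := hx.isInvertible
  have h := ContinuousLinearMap.ext_iff.1 (diagMap_comp_diagMap_inv hx.ne_zero) (e v)
  rw [ContinuousLinearMap.comp_apply] at h
  simp only [logFrame, logCoframe, ContinuousLinearMap.comp_apply, ← he,
    ContinuousLinearMap.inverse_equiv, ContinuousLinearEquiv.coe_coe, h]
  simp

theorem hasFDerivAt_divCoord (hx : DifferentiableAt ℂ ξ x) (i : Fin n) :
    HasFDerivAt (fun y => divCoord r ξ y i)
      ((if i.val < r then (1 : ℂ) else 0) • (ContinuousLinearMap.proj (R := ℂ)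
        (φ := fun _ : Fin n => ℂ) i).comp (fderiv ℂ ξ x)) x := by
  by_cases hi : i.val < r
  · simp only [divCoord, hi, if_true, one_smul]
    exact (ContinuousLinearMap.proj (R := ℂ) (φ := fun _ : Fin n => ℂ) i).hasFDerivAt.comp x
      hx.hasFDerivAt
  · simp only [divCoord, hi, if_false]
    convert hasFDerivAt_const (1 : ℂ) x
    ext v
    simp

theorem divCoord_analyticAt (hx : AnalyticAt ℂ ξ x) (i : Fin n) :
    AnalyticAt ℂ (fun y => divCoord r ξ y i) x := by
  by_cases hi : i.val < r
  · simp only [divCoord, hi, if_true]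
    exact ((ContinuousLinearMap.proj (R := ℂ) (φ := fun _ : Fin n => ℂ) i).analyticAt _).comp hx
  · simp only [divCoord, hi, if_false]
    exact analyticAt_const

theorem divPow_analyticAt (hx : AnalyticAt ℂ ξ x) (N : Fin n → ℕ) :
    AnalyticAt ℂ (divPow r ξ N) x :=
  Finset.analyticAt_fun_prod _ fun i _ => (divCoord_analyticAt hx i).pow _

theorem divPow_ne_zero (hx : ∀ i, divCoord r ξ x i ≠ 0) (N : Fin n → ℕ) : divPow r ξ N x ≠ 0 :=
  Finset.prod_ne_zero_iff.2 fun i _ => pow_ne_zero _ (hx i)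

theorem divPow_add (N M : Fin n → ℕ) (x : Fin n → ℂ) :
    divPow r ξ (N + M) x = divPow r ξ N x * divPow r ξ M x := by
  simp only [divPow, Pi.add_apply, pow_add, Finset.prod_mul_distrib]

theorem divPow_zero (x : Fin n → ℂ) : divPow r ξ 0 x = 1 := by simp [divPow]

theorem divPow_single (i : Fin n) (x : Fin n → ℂ) :
    divPow r ξ (Pi.single i 1) x = divCoord r ξ x i := by
  rw [divPow, Finset.prod_eq_single i (fun j _ hj => by simp [hj]) (by simp)]
  simp

theorem divPow_nsmul (k : ℕ) (N : Fin n → ℕ) (x : Fin n → ℂ) :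
    divPow r ξ (k • N) x = divPow r ξ N x ^ k := by
  simp only [divPow, ← Finset.prod_pow, ← pow_mul, Pi.smul_apply, smul_eq_mul, mul_comm k]

theorem fderiv_divPow_logFrame (hx : DifferentiableAt ℂ ξ x)
    (hx' : (fderiv ℂ ξ x).IsInvertible) (N : Fin n → ℕ) (v : Fin n → ℂ) :
    fderiv ℂ (divPow r ξ N) x (logFrame r ξ x v) = divPow r ξ N x * divWeight r N v := by
  have h := HasFDerivAt.finsetProd (u := Finset.univ) (x := x)
    fun i _ => (hasFDerivAt_divCoord (r := r) hx i).pow (N i)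
  have h' : fderiv ℂ (divPow r ξ N) x = _ := h.fderiv
  rw [h', divWeight_apply, _root_.sum_apply, Finset.mul_sum]
  refine Finset.sum_congr rfl fun i hi => ?_
  simp only [_root_.smul_apply, ContinuousLinearMap.comp_apply,
    fderiv_logFrame_apply hx', ContinuousLinearMap.proj_apply, diagMap_apply, smul_eq_mul]
  rw [divPow, ← Finset.prod_erase_mul _ _ hi]
  cases hN : N i with
  | zero => simp
  | succ k =>
    rw [Nat.add_sub_cancel, pow_succ]
    push_cast
    ring

/-- The coframe consists of closed forms. -/
theorem fderiv_logCoframe_symm (hx : IsLogPoint r ξ x) (v w : Fin n → ℂ) :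
    fderiv ℂ (logCoframe r ξ) x v w = fderiv ℂ (logCoframe r ξ) x w v := by
  have hA : DifferentiableAt ℂ (logCoframe r ξ) x := by
    refine DifferentiableAt.clm_comp ?_ hx.analyticAt.fderiv.differentiableAt
    exact (diagMap_analyticAt fun i =>
      (divCoord_analyticAt hx.analyticAt i).inv (hx.ne_zero i)).differentiableAt
  have key (i : Fin n) (v w : Fin n → ℂ) : fderiv ℂ (logCoframe r ξ) x v w i =
      (divCoord r ξ x i)⁻¹ * fderiv ℂ (fderiv ℂ ξ) x v w i -
      (divCoord r ξ x i ^ 2)⁻¹ * (if i.val < r then (1 : ℂ) else 0) *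
        (fderiv ℂ ξ x v i * fderiv ℂ ξ x w i) := by
    let L : ((Fin n → ℂ) →L[ℂ] (Fin n → ℂ)) →L[ℂ] ℂ :=
      (ContinuousLinearMap.proj (R := ℂ) (φ := fun _ : Fin n => ℂ) i).comp
        (ContinuousLinearMap.apply ℂ (Fin n → ℂ) w)
    have h1 : HasFDerivAt (fun y => L (logCoframe r ξ y))
        (L.comp (fderiv ℂ (logCoframe r ξ) x)) x := L.hasFDerivAt.comp x hA.hasFDerivAt
    have h2 : HasFDerivAt (fun y => L (fderiv ℂ ξ y)) (L.comp (fderiv ℂ (fderiv ℂ ξ) x)) x :=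
      L.hasFDerivAt.comp x hx.analyticAt.fderiv.differentiableAt.hasFDerivAt
    have h3 := (HasFDerivAt.comp x (hasFDerivAt_inv (hx.ne_zero i))
      (hasFDerivAt_divCoord (r := r) hx.analyticAt.differentiableAt i)).mul h2
    have h4 : (fun y => L (logCoframe r ξ y)) =
        fun y => (divCoord r ξ y i)⁻¹ * L (fderiv ℂ ξ y) := by
      funext y
      simp [L, logCoframe, diagMap_apply]
    rw [h4] at h1
    have h5 := ContinuousLinearMap.ext_iff.1 (h1.unique h3) v
    simp only [ContinuousLinearMap.comp_apply, _root_.add_apply,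
      _root_.smul_apply, ContinuousLinearMap.proj_apply, smul_eq_mul, L,
      ContinuousLinearMap.apply_apply, ContinuousLinearMap.toSpanSingleton_apply,
      Function.comp_apply] at h5
    rw [h5]
    ring
  have hsymm : fderiv ℂ (fderiv ℂ ξ) x v w = fderiv ℂ (fderiv ℂ ξ) x w v :=
    (hx.analyticAt.contDiffAt (n := ω)).isSymmSndFDerivAt (by simp) v w
  ext i
  rw [key, key, hsymm, mul_comm (fderiv ℂ ξ x v i)]

/-! ### Forms in a logarithmic frame -/

variable (r ξ)

/-- The form `∏ ξᵢ^(-Nᵢ) ∑ a_I e_I`, where `e` is the logarithmic coframe and the coefficients `a_I`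
are those of `a`. -/
def poleForm {q : ℕ} (N : Fin n → ℕ) (a : (Fin n → ℂ) → AltForm n q) (x : Fin n → ℂ) :
    AltForm n q :=
  ((divPow r ξ N x)⁻¹ • a x).compContinuousLinearMap (logCoframe r ξ x)

/-- The exterior derivative, read on the coefficients of `∏ ξᵢ^(-Nᵢ) ∑ a_I e_I` in the logarithmic
coframe. -/
def frameD {q : ℕ} (N : Fin n → ℕ) (a : (Fin n → ℂ) → AltForm n q) (x : Fin n → ℂ) :
    AltForm n (q + 1) :=
  ContinuousAlternatingMap.alternatizeUncurryFin
    ((fderiv ℂ a x).comp (logFrame r ξ x) - (divWeight r N).smulRight (a x))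

variable {r ξ}

theorem poleForm_eq_iff {q : ℕ} (hx : IsLogPoint r ξ x) {b c : AltForm n q} :
    b.compContinuousLinearMap (logCoframe r ξ x) = c.compContinuousLinearMap (logCoframe r ξ x) ↔
      b = c := by
  refine ⟨fun h => ?_, fun h => h ▸ rfl⟩
  ext v
  have h1 (w : Fin n → ℂ) : logCoframe r ξ x (logFrame r ξ x w) = w :=
    ContinuousLinearMap.ext_iff.1 (logCoframe_comp_logFrame hx) w
  have := congrArg (fun F : AltForm n q => F (logFrame r ξ x ∘ v)) h
  simpa [ContinuousAlternatingMap.compContinuousLinearMap_apply, Function.comp_def, h1] using this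

theorem extDeriv_comp_logCoframe {q : ℕ} (hx : IsLogPoint r ξ x)
    {b : (Fin n → ℂ) → AltForm n q} (hb : DifferentiableAt ℂ b x) :
    extDeriv (fun y => (b y).compContinuousLinearMap (logCoframe r ξ y)) x =
      (ContinuousAlternatingMap.alternatizeUncurryFin
        ((fderiv ℂ b x).comp (logFrame r ξ x))).compContinuousLinearMap (logCoframe r ξ x) := by
  have hA : DifferentiableAt ℂ (logCoframe r ξ) x := by
    refine DifferentiableAt.clm_comp ?_ hx.analyticAt.fderiv.differentiableAt
    exact (diagMap_analyticAt fun i =>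
      (divCoord_analyticAt hx.analyticAt i).inv (hx.ne_zero i)).differentiableAt
  rw [extDeriv, fderiv_continuousAlternatingMapCompContinuousLinearMap hb hA,
    ContinuousAlternatingMap.alternatizeUncurryFin_add,
    ContinuousAlternatingMap.alternatizeUncurryFin_fderivCompContinuousLinearMap_eq_zero _ _
      (fderiv_logCoframe_symm hx), add_zero]
  ext v
  have h1 (w : Fin n → ℂ) : logFrame r ξ x (logCoframe r ξ x w) = w :=
    ContinuousLinearMap.ext_iff.1 (logFrame_comp_logCoframe hx) w
  simp +unfoldPartialApp [ContinuousAlternatingMap.alternatizeUncurryFin_apply, Fin.removeNth,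
    Function.comp_def, h1]

theorem extDeriv_poleForm {q : ℕ} (hx : IsLogPoint r ξ x) (N : Fin n → ℕ)
    {a : (Fin n → ℂ) → AltForm n q} (ha : DifferentiableAt ℂ a x) :
    extDeriv (poleForm r ξ N a) x = poleForm r ξ N (frameD r ξ N a) x := by
  have hN : DifferentiableAt ℂ (divPow r ξ N) x :=
    (divPow_analyticAt hx.analyticAt N).differentiableAt
  have hN0 := divPow_ne_zero hx.ne_zero N
  have h1 := ((HasFDerivAt.comp x (hasFDerivAt_inv hN0) hN.hasFDerivAt).smul ha.hasFDerivAt)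
  have h2 := extDeriv_comp_logCoframe hx h1.differentiableAt
  refine h2.trans ?_
  rw [h1.fderiv, poleForm, frameD, ← ContinuousAlternatingMap.alternatizeUncurryFin_smul]
  congr 2
  ext1 v
  simp only [ContinuousLinearMap.comp_apply, _root_.add_apply, _root_.smul_apply,
    ContinuousLinearMap.smulRight_apply, Function.comp_apply,
    fderiv_divPow_logFrame hx.analyticAt.differentiableAt hx.isInvertible,
    ContinuousLinearMap.toSpanSingleton_apply, _root_.sub_apply, smul_sub, smul_eq_mul, smul_smul]
  ext w
  simp only [ContinuousAlternatingMap.add_apply, ContinuousAlternatingMap.sub_apply,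
    ContinuousAlternatingMap.smul_apply, smul_eq_mul]
  field_simp
  ring

end Frame

/-! ### Analyticity of forms -/

section AnalyticForms

variable {q : ℕ}

/-- The components of an alternating form in the standard basis. -/
def altCoeff (n q : ℕ) : AltForm n q →ₗ[ℂ] ((Fin q → Fin n) → ℂ) where
  toFun a t := a fun k => Pi.single (t k) 1
  map_add' _ _ := rfl
  map_smul' _ _ := rfl

theorem altForm_ext_of_injective {a b : AltForm n q}
    (h : ∀ t : Fin q → Fin n, Function.Injective t → altCoeff n q a t = altCoeff n q b t) :
    a = b := by
  refine ContinuousAlternatingMap.toAlternatingMap_injective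
    ((Pi.basisFun ℂ (Fin n)).ext_alternating fun t ht => ?_)
  simp only [Pi.basisFun_apply]
  exact h t ht

theorem exists_altCoeff_leftInverse (n q : ℕ) :
    ∃ σ : ((Fin q → Fin n) → ℂ) →L[ℂ] AltForm n q, ∀ a, σ (altCoeff n q a) = a := by
  obtain ⟨σ, hσ⟩ := (altCoeff n q).exists_leftInverse_of_injective
    (LinearMap.ker_eq_bot.2 fun a b h =>
      altForm_ext_of_injective fun t _ => congrFun h t)
  exact ⟨LinearMap.toContinuousLinearMap σ, fun a => LinearMap.ext_iff.1 hσ a⟩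

variable {E : Type*} [NormedAddCommGroup E] [NormedSpace ℂ E] {x : E}

theorem altForm_analyticAt {F : E → AltForm n q}
    (h : ∀ t, AnalyticAt ℂ (fun y => altCoeff n q (F y) t) x) : AnalyticAt ℂ F x := by
  obtain ⟨σ, hσ⟩ := exists_altCoeff_leftInverse n q
  have h1 : AnalyticAt ℂ (fun y => altCoeff n q (F y)) x := AnalyticAt.pi h
  have h2 := (σ.analyticAt _).comp h1
  exact h2.congr (Eventually.of_forall fun y => hσ (F y))

theorem altForm_compContinuousLinearMap_analyticAt {F : E → AltForm n q}
    {B : E → (Fin n → ℂ) →L[ℂ] (Fin n → ℂ)} (hF : AnalyticAt ℂ F x) (hB : AnalyticAt ℂ B x) :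
    AnalyticAt ℂ (fun y => (F y).compContinuousLinearMap (B y)) x := by
  refine altForm_analyticAt fun t => ?_
  have h1 : AnalyticAt ℂ (fun y => (F y, fun k : Fin q => B y (Pi.single (t k) 1))) x :=
    hF.prod (AnalyticAt.pi fun k => ((ContinuousLinearMap.apply ℂ (Fin n → ℂ)
      (Pi.single (t k) (1 : ℂ) : Fin n → ℂ)).analyticAt (B x)).fun_comp hB)
  exact ((ContinuousAlternatingMap.toContinuousMultilinearMapCLM (𝕜 := ℂ) (E := Fin n → ℂ)
    (F := ℂ) (ι := Fin q) ℂ).analyticAt_uncurry_of_multilinear).comp h1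

theorem clm_comp_analyticAt {V W Z : Type*} [NormedAddCommGroup V] [NormedSpace ℂ V]
    [NormedAddCommGroup W] [NormedSpace ℂ W] [NormedAddCommGroup Z] [NormedSpace ℂ Z]
    {L : E → W →L[ℂ] Z} {M : E → V →L[ℂ] W} (hL : AnalyticAt ℂ L x) (hM : AnalyticAt ℂ M x) :
    AnalyticAt ℂ (fun y => (L y).comp (M y)) x :=
  ((ContinuousLinearMap.compL ℂ V W Z).analyticAt_bilinear (L x, M x)).comp
    (f := fun y => (L y, M y)) (hL.prod hM)

theorem smulRight_analyticAt {V W : Type*} [NormedAddCommGroup V] [NormedSpace ℂ V]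
    [NormedAddCommGroup W] [NormedSpace ℂ W] (ν : V →L[ℂ] ℂ) {a : E → W}
    (ha : AnalyticAt ℂ a x) : AnalyticAt ℂ (fun y => ν.smulRight (a y)) x :=
  ((ContinuousLinearMap.smulRightL ℂ V W ν).analyticAt _).comp ha

theorem clm_apply_analyticAt {V W : Type*} [NormedAddCommGroup V] [NormedSpace ℂ V]
    [NormedAddCommGroup W] [NormedSpace ℂ W] {L : E → V →L[ℂ] W} {v : E → V}
    (hL : AnalyticAt ℂ L x) (hv : AnalyticAt ℂ v x) : AnalyticAt ℂ (fun y => L y (v y)) x :=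
  ((ContinuousLinearMap.id ℂ (V →L[ℂ] W)).analyticAt_bilinear (L x, v x)).comp
    (f := fun y => (L y, v y)) (hL.prod hv)

/-- Contraction of alternating forms with a vector. -/
def contr (v : Fin n → ℂ) : AltForm n (q + 1) →L[ℂ] AltForm n q :=
  (ContinuousLinearMap.apply ℂ (AltForm n q) v).comp
    (ContinuousAlternatingMap.curryLeftLI (𝕜 := ℂ) (E := Fin n → ℂ)
      (F := ℂ)).toContinuousLinearMap

theorem contr_apply (v : Fin n → ℂ) (a : AltForm n (q + 1)) (w : Fin q → Fin n → ℂ) :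
    contr v a w = a (Matrix.vecCons v w) := rfl

theorem contr_zero_left (a : AltForm n (q + 1)) : contr 0 a = 0 := by
  ext w
  rw [contr_apply]
  exact a.map_coord_zero 0 rfl

theorem contr_smul_left (c : ℂ) (v : Fin n → ℂ) (a : AltForm n (q + 1)) :
    contr (c • v) a = c • contr v a :=
  (ContinuousAlternatingMap.curryLeft a).map_smul c v

theorem contr_compContinuousLinearMap (v : Fin n → ℂ) (a : AltForm n (q + 1))
    (B : (Fin n → ℂ) →L[ℂ] (Fin n → ℂ)) :
    contr v (a.compContinuousLinearMap B) = (contr (B v) a).compContinuousLinearMap B :=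
  ContinuousAlternatingMap.curryLeft_compContinuousLinearMap a B v

theorem contr_analyticAt {F : E → AltForm n (q + 1)} {w : E → Fin n → ℂ}
    (hF : AnalyticAt ℂ F x) (hw : AnalyticAt ℂ w x) :
    AnalyticAt ℂ (fun y => contr (w y) (F y)) x := by
  refine altForm_analyticAt fun t => ?_
  have h1 : AnalyticAt ℂ (fun y => (F y, (Matrix.vecCons (w y) fun k : Fin q =>
      (Pi.single (t k) 1 : Fin n → ℂ)))) x :=
    hF.prod (AnalyticAt.pi fun k => by
      refine Fin.cases ?_ (fun k => ?_) k
      · exact hw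
      · exact analyticAt_const)
  exact ((ContinuousAlternatingMap.toContinuousMultilinearMapCLM (𝕜 := ℂ) (E := Fin n → ℂ)
    (F := ℂ) (ι := Fin (q + 1)) ℂ).analyticAt_uncurry_of_multilinear).comp h1

/-- The homotopy formula behind Cartan's formula: contraction is an antiderivation with respect to
alternatization. -/
theorem contr_alternatizeUncurryFin (L : (Fin n → ℂ) →L[ℂ] AltForm n (q + 1)) (v : Fin n → ℂ) :
    contr v (ContinuousAlternatingMap.alternatizeUncurryFin L) +
      ContinuousAlternatingMap.alternatizeUncurryFin ((contr v).comp L) = L v := by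
  ext w
  rw [ContinuousAlternatingMap.add_apply, contr_apply,
    ContinuousAlternatingMap.alternatizeUncurryFin_apply,
    ContinuousAlternatingMap.alternatizeUncurryFin_apply, Fin.sum_univ_succ, add_assoc,
    ← Finset.sum_add_distrib]
  rw [Finset.sum_eq_zero]
  · simp [Matrix.vecCons]
  · intro i _
    have h1 : Fin.removeNth i.succ (Matrix.vecCons v w) = Matrix.vecCons v (Fin.removeNth i w) := by
      funext k
      refine Fin.cases ?_ (fun k => ?_) k
      · simp [Fin.removeNth]
      · simp [Fin.removeNth]
    rw [h1, ContinuousLinearMap.comp_apply, contr_apply, Fin.val_succ, pow_succ]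
    simp

theorem contr_alternatizeUncurryFin_zero (L : (Fin n → ℂ) →L[ℂ] AltForm n 0) (v : Fin n → ℂ) :
    contr v (ContinuousAlternatingMap.alternatizeUncurryFin L) = L v := by
  ext w
  rw [contr_apply, ContinuousAlternatingMap.alternatizeUncurryFin_apply]
  simp

theorem altForm_comp_diagMap (a : AltForm n q) (z : Fin n → ℂ) (t : Fin q → Fin n) :
    altCoeff n q (a.compContinuousLinearMap (diagMap z)) t =
      (∏ k, z (t k)) * altCoeff n q a t := by
  have h (k : Fin q) : diagMap z (Pi.single (t k) 1) =
      z (t k) • (Pi.single (t k) 1 : Fin n → ℂ) := by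
    ext i
    rw [diagMap_apply, Pi.smul_apply, smul_eq_mul]
    by_cases hi : i = t k
    · rw [hi]
    · rw [Pi.single_eq_of_ne hi, mul_zero, mul_zero]
  change a (fun k => diagMap z (Pi.single (t k) 1)) = _
  simp only [h]
  exact a.toAlternatingMap.map_smul_univ (fun k => z (t k)) fun k => Pi.single (t k) 1

/-- `(∏ zᵢ) · a ∘ diag(z)⁻¹` depends polynomially on `z`: it is the sum, over the sets `S` of `q`
indices, of the products of the `zᵢ`, `i ∉ S`, by the components of `a` with indices in `S`. -/
theorem prod_smul_comp_diagMap_inv (a : AltForm n q) {z : Fin n → ℂ} (hz : ∀ i, z i ≠ 0) :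
    (∏ i, z i) • a.compContinuousLinearMap (diagMap z⁻¹) =
      ∑ S ∈ Finset.univ.powersetCard q, (∏ i ∈ Sᶜ, z i) •
        a.compContinuousLinearMap (diagMap fun i => if i ∈ S then 1 else 0) := by
  refine altForm_ext_of_injective fun t ht => ?_
  rw [map_smul, map_sum, Pi.smul_apply, Finset.sum_apply, altForm_comp_diagMap, smul_eq_mul]
  rw [Finset.sum_eq_single (Finset.univ.image t)]
  · rw [map_smul, Pi.smul_apply, altForm_comp_diagMap, smul_eq_mul,
      ← Finset.prod_mul_prod_compl (Finset.univ.image t), Finset.prod_image (by simpa using ht)]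
    have h1 : (∏ k, if t k ∈ Finset.univ.image t then (1 : ℂ) else 0) = 1 :=
      Finset.prod_eq_one fun k _ => if_pos (by simp)
    rw [h1, one_mul]
    simp only [Pi.inv_apply, Finset.prod_inv_distrib]
    have h2 : (∏ k, z (t k)) ≠ 0 := Finset.prod_ne_zero_iff.2 fun k _ => hz _
    field_simp
  · intro S hS hne
    obtain ⟨k, hk⟩ : ∃ k, t k ∉ S := by
      by_contra hcon
      push Not at hcon
      refine hne (Finset.eq_of_subset_of_card_le (fun i hi => ?_) ?_).symm
      · obtain ⟨k, -, rfl⟩ := Finset.mem_image.1 hi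
        exact hcon k
      · rw [Finset.card_image_of_injective _ ht, (Finset.mem_powersetCard.1 hS).2]
        simp
    rw [map_smul, Pi.smul_apply, altForm_comp_diagMap,
      Finset.prod_eq_zero (Finset.mem_univ k) (if_neg hk), zero_mul, smul_zero]
  · intro h
    exfalso
    refine h (Finset.mem_powersetCard.2 ⟨Finset.subset_univ _, ?_⟩)
    rw [Finset.card_image_of_injective _ ht]
    simp

end AnalyticForms

/-! ### Adapted coordinates -/

/-- `ξ` is a local coordinate system centred at `p`, with inverse `ψ`, in which the complement of
the open set `U` is `ξ₁ ⋯ ξ_r = 0`. All conditions are on germs: nothing is required of `ξ` away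
from `p`, nor of `ψ` away from the origin. -/
structure IsAdapted (U : TopologicalSpace.Opens (Fin n → ℂ)) (p : Fin n → ℂ) (r : ℕ)
    (ξ ψ : (Fin n → ℂ) → (Fin n → ℂ)) : Prop where
  analyticAt : AnalyticAt ℂ ξ p
  inv_analyticAt : AnalyticAt ℂ ψ 0
  map_point : ξ p = 0
  left_inv : ∀ᶠ x in 𝓝 p, ψ (ξ x) = x
  right_inv : ∀ᶠ y in 𝓝 0, ξ (ψ y) = y
  mem_iff : ∀ᶠ x in 𝓝 p, x ∈ U ↔ ∀ i, divCoord r ξ x i ≠ 0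

namespace IsAdapted

variable {U : TopologicalSpace.Opens (Fin n → ℂ)} {p : Fin n → ℂ} {r : ℕ}
  {ξ ψ : (Fin n → ℂ) → (Fin n → ℂ)} (C : IsAdapted U p r ξ ψ)
include C

theorem inv_map_zero : ψ 0 = p := by
  rw [← C.map_point]; exact C.left_inv.self_of_nhds

theorem tendsto : Tendsto ξ (𝓝 p) (𝓝 0) := by
  simpa only [C.map_point] using C.analyticAt.continuousAt.tendsto

theorem tendsto_inv : Tendsto ψ (𝓝 0) (𝓝 p) := by
  simpa only [C.inv_map_zero] using C.inv_analyticAt.continuousAt.tendsto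

theorem isInvertible_fderiv : (fderiv ℂ ξ p).IsInvertible := by
  have h1 : HasFDerivAt ξ (fderiv ℂ ξ p) p := C.analyticAt.differentiableAt.hasFDerivAt
  have h2 : HasFDerivAt ψ (fderiv ℂ ψ 0) 0 := C.inv_analyticAt.differentiableAt.hasFDerivAt
  have h3 : (fderiv ℂ ψ 0).comp (fderiv ℂ ξ p) = ContinuousLinearMap.id ℂ _ := by
    have h4 := HasFDerivAt.comp p (by rwa [C.map_point]) h1 (g := ψ) (g' := fderiv ℂ ψ 0)
    exact (h4.congr_of_eventuallyEq (C.left_inv.mono fun x hx => hx.symm)).unique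
      (hasFDerivAt_id p)
  have h5 : (fderiv ℂ ξ p).comp (fderiv ℂ ψ 0) = ContinuousLinearMap.id ℂ _ := by
    have h4 := HasFDerivAt.comp 0 (by rwa [C.inv_map_zero]) h2 (g := ξ) (g' := fderiv ℂ ξ p)
    exact (h4.congr_of_eventuallyEq (C.right_inv.mono fun x hx => hx.symm)).unique
      (hasFDerivAt_id 0)
  exact ⟨ContinuousLinearEquiv.equivOfInverse _ _ (fun v => ContinuousLinearMap.ext_iff.1 h3 v)
    (fun v => ContinuousLinearMap.ext_iff.1 h5 v), rfl⟩

theorem eventually_isInvertible : ∀ᶠ x in 𝓝 p, (fderiv ℂ ξ x).IsInvertible := by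
  obtain ⟨e, he⟩ := C.isInvertible_fderiv
  have h := C.analyticAt.fderiv.continuousAt.tendsto
  rw [← he] at h
  filter_upwards [h.eventually (ContinuousLinearEquiv.nhds e)] with x hx
  exact hx

theorem inverse_fderiv_analyticAt : AnalyticAt ℂ (fun x => (fderiv ℂ ξ x).inverse) p := by
  obtain ⟨e, he⟩ := C.isInvertible_fderiv
  have h : AnalyticAt ℂ (ContinuousLinearMap.inverse :
      ((Fin n → ℂ) →L[ℂ] (Fin n → ℂ)) → _) (fderiv ℂ ξ p) := by
    rw [← he]
    exact (contDiffAt_map_inverse (n := ω) e).analyticAt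
  exact h.comp C.analyticAt.fderiv

theorem logFrame_analyticAt : AnalyticAt ℂ (logFrame r ξ) p :=
  clm_comp_analyticAt C.inverse_fderiv_analyticAt
    (diagMap_analyticAt fun i => divCoord_analyticAt C.analyticAt i)

theorem eventually_isLogPoint : ∀ᶠ x in 𝓝[U] p, IsLogPoint r ξ x := by
  filter_upwards [self_mem_nhdsWithin, nhdsWithin_le_nhds C.mem_iff,
    nhdsWithin_le_nhds C.eventually_isInvertible,
    nhdsWithin_le_nhds C.analyticAt.eventually_analyticAt] with x hU h1 h2 h3
  exact ⟨h3, h2, h1.1 hU⟩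

/-- The equation `ξ₁ ⋯ ξ_r` of the divisor. -/
theorem eventually_divPow_one_eq_zero_iff :
    ∀ᶠ x in 𝓝 p, divPow r ξ 1 x = 0 ↔ x ∉ U := by
  filter_upwards [C.mem_iff] with x hx
  rw [hx, divPow, Finset.prod_eq_zero_iff]
  simp

omit C in
theorem divPow_one_eq_prod (x : Fin n → ℂ) :
    divPow r ξ 1 x = ∏ i : Fin n with i.val < r, ξ x i := by
  simp [divPow, divCoord, Finset.prod_filter]

theorem frequently_divPow_one_ne_zero : ∃ᶠ x in 𝓝 p, divPow r ξ 1 x ≠ 0 := by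
  intro h
  refine crossing_ne_zero n r (Subtype.ext (?_ : _ = ((fun _ => 0 : (Fin n → ℂ) → ℂ) :
    Germ (𝓝 (0 : Fin n → ℂ)) ℂ)))
  rw [crossing, prod_coord_val]
  refine Germ.coe_eq.2 ?_
  filter_upwards [C.tendsto_inv.eventually h, C.right_inv] with y hy hy'
  rw [not_not, divPow_one_eq_prod, hy'] at hy
  exact hy

/-- A holomorphic germ that vanishes on the divisor is divisible by `ξ₁ ⋯ ξ_r`. -/
theorem exists_eq_mul_divPow_one {g : (Fin n → ℂ) → ℂ} (hg : AnalyticAt ℂ g p)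
    (h : ∀ᶠ x in 𝓝 p, x ∉ U → g x = 0) :
    ∃ a : (Fin n → ℂ) → ℂ, AnalyticAt ℂ a p ∧ g =ᶠ[𝓝 p] a * divPow r ξ 1 := by
  have hgψ : AnalyticAt ℂ (g ∘ ψ) 0 :=
    AnalyticAt.comp (by rwa [C.inv_map_zero]) C.inv_analyticAt
  have hr : ∀ i ∈ Finset.univ.filter fun i : Fin n => i.val < r,
      restr i (HolGerm.mk (g ∘ ψ) hgψ) = 0 := by
    intro i hi
    rw [restr_mk]
    refine Subtype.ext (Germ.coe_eq.2 ?_)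
    have ht := C.tendsto_inv.comp (tendsto_hyperProj i)
    filter_upwards [ht.eventually h, ht.eventually C.mem_iff,
      (tendsto_hyperProj i).eventually C.right_inv] with y h1 h2 h3
    refine h1 fun hU => h2.1 hU i ?_
    rw [divCoord, if_pos (Finset.mem_filter.1 hi).2]
    simp only [Function.comp_apply, h3, hyperProj_apply_self]
  obtain ⟨φ, hφ⟩ := prod_coord_dvd hr
  obtain ⟨b, hb, rfl⟩ := φ.exists_rep
  have h2 : g ∘ ψ =ᶠ[𝓝 0] fun x => (∏ i : Fin n with i.val < r, x i) * b x := by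
    have h3 := congrArg Subtype.val hφ
    change _ = (∏ i : Fin n with i.val < r, coord i : HolGerm n).1 * _ at h3
    rw [prod_coord_val] at h3
    exact Germ.coe_eq.1 h3
  refine ⟨b ∘ ξ, AnalyticAt.comp (by rwa [C.map_point]) C.analyticAt, ?_⟩
  filter_upwards [C.tendsto.eventually h2, C.left_inv] with x hx hx'
  rw [Function.comp_apply, hx'] at hx
  rw [hx, Pi.mul_apply, divPow_one_eq_prod, mul_comm, Function.comp_apply]

theorem isReducedEquation : IsReducedEquation U p (divPow r ξ 1) where
  analyticAt := divPow_analyticAt C.analyticAt 1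
  ne_zero := C.frequently_divPow_one_ne_zero
  eq_zero_iff := C.eventually_divPow_one_eq_zero_iff
  dvd _ hg h := C.exists_eq_mul_divPow_one hg h

theorem eventually_eq_zero {F : Type*} [NormedAddCommGroup F] [NormedSpace ℂ F] [CompleteSpace F]
    {g : (Fin n → ℂ) → F} (hg : AnalyticAt ℂ g p) (h : ∀ᶠ x in 𝓝[U] p, g x = 0) :
    ∀ᶠ x in 𝓝 p, g x = 0 := by
  refine eventually_eq_zero_of_smul_eq_zero (divPow_analyticAt C.analyticAt 1) hg
    C.frequently_divPow_one_ne_zero ?_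
  filter_upwards [eventually_nhdsWithin_iff.1 h, C.eventually_divPow_one_eq_zero_iff]
    with x h1 h2
  by_cases hx : x ∈ U
  · rw [h1 hx, smul_zero]
  · rw [h2.2 hx, zero_smul]

/-! ### Germs of meromorphic forms in adapted coordinates -/

theorem frameD_analyticAt {q : ℕ} (N : Fin n → ℕ) {a : (Fin n → ℂ) → AltForm n q}
    (ha : AnalyticAt ℂ a p) : AnalyticAt ℂ (frameD r ξ N a) p := by
  have h1 : AnalyticAt ℂ (fun x => (fderiv ℂ a x).comp (logFrame r ξ x) -
      (divWeight r N).smulRight (a x)) p :=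
    (clm_comp_analyticAt ha.fderiv C.logFrame_analyticAt).sub
      (smulRight_analyticAt _ ha)
  exact ((ContinuousAlternatingMap.alternatizeUncurryFinCLM ℂ (Fin n → ℂ) ℂ
    (n := q)).analyticAt _).comp h1

theorem extGerm_poleForm {q : ℕ} (N : Fin n → ℕ) {a : (Fin n → ℂ) → AltForm n q}
    (ha : AnalyticAt ℂ a p) : extGerm U p q (FormGerm.mk U p (poleForm r ξ N a)) =
      FormGerm.mk U p (poleForm r ξ N (frameD r ξ N a)) := by
  rw [extGerm_mk]
  refine Germ.coe_eq.2 ?_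
  filter_upwards [C.eventually_isLogPoint, nhdsWithin_le_nhds ha.eventually_analyticAt] with x h1 h2
  exact extDeriv_poleForm h1 N h2.differentiableAt

theorem mk_poleForm_eq_mk_iff {q : ℕ} (N M : Fin n → ℕ) (a b : (Fin n → ℂ) → AltForm n q) :
    FormGerm.mk U p (poleForm r ξ N a) = FormGerm.mk U p (poleForm r ξ M b) ↔
      ∀ᶠ x in 𝓝[U] p, (divPow r ξ N x)⁻¹ • a x = (divPow r ξ M x)⁻¹ • b x := by
  rw [FormGerm.mk_eq_mk]
  refine eventually_congr ?_
  filter_upwards [C.eventually_isLogPoint] with x h1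
  exact poleForm_eq_iff h1

theorem mk_poleForm_eq_mk_of_le {q : ℕ} (N M : Fin n → ℕ) (a : (Fin n → ℂ) → AltForm n q) :
    FormGerm.mk U p (poleForm r ξ N a) =
      FormGerm.mk U p (poleForm r ξ (N + M) (fun x => divPow r ξ M x • a x)) := by
  rw [C.mk_poleForm_eq_mk_iff]
  filter_upwards [C.eventually_isLogPoint] with x h1
  have hN := divPow_ne_zero h1.ne_zero N
  have hM := divPow_ne_zero h1.ne_zero M
  rw [divPow_add, smul_smul]
  congr 1
  field_simp

end IsAdapted

/-! ### The order of the pole of a meromorphic form -/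

section Germs

variable {U : TopologicalSpace.Opens (Fin n → ℂ)} {p : Fin n → ℂ} {r : ℕ}
  {ξ ψ : (Fin n → ℂ) → (Fin n → ℂ)} {q : ℕ}

theorem mulBy_congr {g g' : (Fin n → ℂ) → ℂ} (h : g =ᶠ[𝓝 p] g') (φ : FormGerm U p q) :
    mulBy U p g q φ = mulBy U p g' q φ := by
  obtain ⟨α, rfl⟩ := φ.exists_rep
  refine Germ.coe_eq.2 ?_
  filter_upwards [nhdsWithin_le_nhds h] with x hx
  exact congrArg (· • α x) hx

theorem mulBy_mem_regForm_of_eq_mul {g g' c : (Fin n → ℂ) → ℂ} (hc : AnalyticAt ℂ c p)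
    (h : g =ᶠ[𝓝 p] c * g') {φ : FormGerm U p q} (hφ : mulBy U p g' q φ ∈ regForm U p q) :
    mulBy U p g q φ ∈ regForm U p q := by
  rw [mulBy_congr h, mulBy_mulBy]
  exact mulBy_mem_regForm U p hc hφ

variable (r ξ) in
/-- `φ` is the product of `∏ ξᵢ^(-Nᵢ)` by a form with holomorphic coefficients in the logarithmic
coframe. -/
def HasPole (N : Fin n → ℕ) (φ : FormGerm U p q) : Prop :=
  ∃ a : (Fin n → ℂ) → AltForm n q, AnalyticAt ℂ a p ∧ φ = FormGerm.mk U p (poleForm r ξ N a)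

theorem logFrame_single (x : Fin n → ℂ) (j : Fin n) : logFrame r ξ x (Pi.single j 1) =
    divCoord r ξ x j • (fderiv ℂ ξ x).inverse (Pi.single j 1) := by
  rw [logFrame, ContinuousLinearMap.comp_apply, ← map_smul]
  congr 1
  ext i
  rw [diagMap_apply, Pi.smul_apply, smul_eq_mul]
  by_cases hi : i = j
  · rw [hi]
  · rw [Pi.single_eq_of_ne hi, mul_zero, mul_zero]

theorem divWeight_single (N : Fin n → ℕ) {j : Fin n} (hj : j.val < r) :
    divWeight r N (Pi.single j 1) = N j := by
  rw [divWeight_apply, Finset.sum_eq_single j (fun i _ hi => by simp [hi]) (by simp)]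
  simp [hj]

/-- Cartan's formula for the logarithmic vector field `ξⱼ ∂/∂ξⱼ`. -/
theorem contr_frameD_add (N : Fin n → ℕ) {a : (Fin n → ℂ) → AltForm n (q + 1)} {x : Fin n → ℂ}
    (ha : DifferentiableAt ℂ a x) {j : Fin n} (hj : j.val < r) :
    contr (Pi.single j 1) (frameD r ξ N a x) +
      frameD r ξ N (fun y => contr (Pi.single j 1) (a y)) x =
      divCoord r ξ x j • fderiv ℂ a x ((fderiv ℂ ξ x).inverse (Pi.single j 1)) -
        (N j : ℂ) • a x := by
  have h1 : fderiv ℂ (fun y => contr (Pi.single j 1 : Fin n → ℂ) (a y)) x =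
      (contr (Pi.single j 1 : Fin n → ℂ)).comp (fderiv ℂ a x) :=
    ((contr (Pi.single j 1 : Fin n → ℂ)).hasFDerivAt.comp x ha.hasFDerivAt).fderiv
  have h2 := contr_alternatizeUncurryFin ((fderiv ℂ a x).comp (logFrame r ξ x) -
    (divWeight r N).smulRight (a x)) (Pi.single j 1)
  have h3 : (contr (Pi.single j 1)).comp ((fderiv ℂ a x).comp (logFrame r ξ x) -
      (divWeight r N).smulRight (a x)) = ((contr (Pi.single j 1)).comp (fderiv ℂ a x)).comp
        (logFrame r ξ x) - (divWeight r N).smulRight (contr (Pi.single j 1) (a x)) := by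
    ext1 v
    simp
  rw [h3] at h2
  rw [frameD, frameD, h1, h2]
  simp only [_root_.sub_apply, ContinuousLinearMap.comp_apply,
    ContinuousLinearMap.smulRight_apply, logFrame_single, divWeight_single N hj, map_smul]

theorem contr_frameD_zero (N : Fin n → ℕ) {a : (Fin n → ℂ) → AltForm n 0} {x : Fin n → ℂ}
    {j : Fin n} (hj : j.val < r) :
    contr (Pi.single j 1) (frameD r ξ N a x) =
      divCoord r ξ x j • fderiv ℂ a x ((fderiv ℂ ξ x).inverse (Pi.single j 1)) -
        (N j : ℂ) • a x := by
  rw [frameD, contr_alternatizeUncurryFin_zero]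
  simp only [_root_.sub_apply, ContinuousLinearMap.comp_apply,
    ContinuousLinearMap.smulRight_apply, logFrame_single, divWeight_single N hj, map_smul]

variable (C : IsAdapted U p r ξ ψ)
include C

theorem HasPole.add_exponent {N : Fin n → ℕ} {φ : FormGerm U p q} (h : HasPole r ξ N φ)
    (M : Fin n → ℕ) : HasPole r ξ (N + M) φ := by
  obtain ⟨a, ha, rfl⟩ := h
  exact ⟨_, (divPow_analyticAt C.analyticAt M).smul ha, C.mk_poleForm_eq_mk_of_le N M a⟩

theorem mulBy_divPow_mk_poleForm (N M : Fin n → ℕ) (a : (Fin n → ℂ) → AltForm n q) :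
    mulBy U p (divPow r ξ N) q (FormGerm.mk U p (poleForm r ξ (M + N) a)) =
      FormGerm.mk U p (poleForm r ξ M a) := by
  rw [mulBy_mk]
  refine Germ.coe_eq.2 ?_
  filter_upwards [C.eventually_isLogPoint] with x hx
  have hN := divPow_ne_zero hx.ne_zero N
  rw [Pi.smul_apply', poleForm, poleForm, divPow_add]
  ext v
  simp only [ContinuousAlternatingMap.smul_apply,
    ContinuousAlternatingMap.compContinuousLinearMap_apply, smul_eq_mul]
  field_simp

/-- Forms with holomorphic coefficients in the logarithmic coframe have at most a simple pole. -/
theorem mulBy_divPow_one_mem_regForm {φ : FormGerm U p q} (h : HasPole r ξ 0 φ) :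
    mulBy U p (divPow r ξ 1) q φ ∈ regForm U p q := by
  obtain ⟨a, ha, rfl⟩ := h
  refine ⟨fun x => ∑ S ∈ Finset.univ.powersetCard q, (∏ i ∈ Sᶜ, divCoord r ξ x i) •
    (a x).compContinuousLinearMap ((diagMap fun i => if i ∈ S then 1 else 0).comp
      (fderiv ℂ ξ x)), ?_, ?_⟩
  · refine Finset.analyticAt_fun_sum _ fun S _ => AnalyticAt.fun_smul ?_ ?_
    · exact Finset.analyticAt_fun_prod _ fun i _ => divCoord_analyticAt C.analyticAt i
    · exact altForm_compContinuousLinearMap_analyticAt ha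
        (clm_comp_analyticAt analyticAt_const C.analyticAt.fderiv)
  · rw [mulBy_mk]
    refine Germ.coe_eq.2 ?_
    filter_upwards [C.eventually_isLogPoint] with x hx
    have h1 := congrArg (fun b : AltForm n q => b.compContinuousLinearMap (fderiv ℂ ξ x))
      (prod_smul_comp_diagMap_inv (a x) hx.ne_zero)
    have h2 : divPow r ξ 1 x = ∏ i, divCoord r ξ x i := by simp [divPow]
    rw [Pi.smul_apply', poleForm, divPow_zero, inv_one, one_smul, h2]
    refine Eq.trans ?_ (h1.trans ?_)
    · rfl
    · ext v
      simp only [ContinuousAlternatingMap.compContinuousLinearMap_apply,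
        ContinuousAlternatingMap.sum_apply, ContinuousAlternatingMap.smul_apply]
      rfl

/-- A form with a pole of some order is meromorphic: raising the exponents, they may be supposed
to be all equal. -/
theorem HasPole.exists_mulBy_mem_regForm {N : Fin n → ℕ} {φ : FormGerm U p q}
    (h : HasPole r ξ N φ) : ∃ k : ℕ, mulBy U p (divPow r ξ 1 ^ k) q φ ∈ regForm U p q := by
  obtain ⟨k, hk⟩ : ∃ k : ℕ, ∀ i, N i ≤ k :=
    ⟨Finset.univ.sup N, fun i => Finset.le_sup (Finset.mem_univ i)⟩
  have h1 := h.add_exponent C (fun i => k - N i)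
  have h2 : N + (fun i => k - N i) = 0 + k • (1 : Fin n → ℕ) := by
    funext i
    have := hk i
    simp
    omega
  rw [h2] at h1
  obtain ⟨a, ha, rfl⟩ := h1
  have h3 : divPow r ξ 1 ^ k = divPow r ξ (k • (1 : Fin n → ℕ)) :=
    funext fun x => (divPow_nsmul k 1 x).symm
  refine ⟨1 + k, ?_⟩
  rw [pow_add, pow_one, mulBy_mulBy, h3, mulBy_divPow_mk_poleForm C]
  exact mulBy_divPow_one_mem_regForm C ⟨a, ha, rfl⟩

/-- The coefficients of a meromorphic form in the logarithmic coframe: those of the holomorphic form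
`η`, evaluated on the logarithmic frame, which is holomorphic across the divisor. -/
theorem eq_mk_poleForm_of_mulBy_eq {k : ℕ} {φ : FormGerm U p q} {η : (Fin n → ℂ) → AltForm n q}
    (h : mulBy U p (divPow r ξ 1 ^ k) q φ = FormGerm.mk U p η) :
    φ = FormGerm.mk U p (poleForm r ξ (k • (1 : Fin n → ℕ))
      fun x => (η x).compContinuousLinearMap (logFrame r ξ x)) := by
  obtain ⟨α, rfl⟩ := φ.exists_rep
  have h1 : ∀ᶠ x in 𝓝[U] p, (divPow r ξ 1 ^ k • α) x = η x := Germ.coe_eq.1 h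
  refine Germ.coe_eq.2 ?_
  filter_upwards [h1, C.eventually_isLogPoint] with x hx hx'
  rw [poleForm, divPow_nsmul, ← hx, Pi.smul_apply', Pi.pow_apply]
  have h2 (w : Fin n → ℂ) : logFrame r ξ x (logCoframe r ξ x w) = w :=
    ContinuousLinearMap.ext_iff.1 (logFrame_comp_logCoframe hx') w
  have h3 := divPow_ne_zero hx'.ne_zero 1
  ext v
  simp only [ContinuousAlternatingMap.compContinuousLinearMap_apply,
    ContinuousAlternatingMap.smul_apply, Function.comp_def, h2, smul_eq_mul]
  field_simp

theorem comp_logFrame_analyticAt {η : (Fin n → ℂ) → AltForm n q} (hη : AnalyticAt ℂ η p) :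
    AnalyticAt ℂ (fun x => (η x).compContinuousLinearMap (logFrame r ξ x)) p :=
  altForm_compContinuousLinearMap_analyticAt hη C.logFrame_analyticAt

/-- If `dη` has a smaller order than `η` along `ξⱼ = 0`, its coefficients in the scale of `η` are
divisible by `ξⱼ`. -/
theorem eventually_frameD_eq {N M : Fin n → ℕ} {j : Fin n} (hN : N = M + Pi.single j 1)
    {a : (Fin n → ℂ) → AltForm n q} {b : (Fin n → ℂ) → AltForm n (q + 1)}
    (hab : FormGerm.mk U p (poleForm r ξ N (frameD r ξ N a)) =
      FormGerm.mk U p (poleForm r ξ M b)) :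
    ∀ᶠ x in 𝓝[U] p, frameD r ξ N a x = divCoord r ξ x j • b x := by
  filter_upwards [(C.mk_poleForm_eq_mk_iff _ _ _ _).1 hab, C.eventually_isLogPoint] with x h1 h2
  have hN0 := divPow_ne_zero h2.ne_zero N
  have hM0 := divPow_ne_zero h2.ne_zero M
  rw [inv_smul_eq_iff₀ hN0, smul_smul, hN, divPow_add, divPow_single] at h1
  rw [hN, h1]
  congr 1
  field_simp

theorem inverse_single_analyticAt (j : Fin n) :
    AnalyticAt ℂ (fun x => (fderiv ℂ ξ x).inverse (Pi.single j 1)) p := by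
  have h := AnalyticAt.fun_comp ((ContinuousLinearMap.apply ℂ (Fin n → ℂ)
    (Pi.single j (1 : ℂ) : Fin n → ℂ)).analyticAt _) C.inverse_fderiv_analyticAt
  exact h

theorem fderiv_inverse_single_analyticAt {a : (Fin n → ℂ) → AltForm n q} (ha : AnalyticAt ℂ a p)
    (j : Fin n) : AnalyticAt ℂ
      (fun x => fderiv ℂ a x ((fderiv ℂ ξ x).inverse (Pi.single j 1))) p :=
  clm_apply_analyticAt ha.fderiv (inverse_single_analyticAt C j)

/-- For a function `η`, the component of `dη` along `ξⱼ ∂/∂ξⱼ` determines the part of order `Nⱼ` of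
`η`: the order of the pole of `η` is at most that of `dη`. -/
theorem HasPole.reduce_zero {N M : Fin n → ℕ} {j : Fin n} (hj : j.val < r)
    (hN : N = M + Pi.single j 1) {η : FormGerm U p 0} (hη : HasPole r ξ N η)
    (hdη : HasPole r ξ M (extGerm U p 0 η)) : HasPole r ξ M η := by
  obtain ⟨a, ha, rfl⟩ := hη
  obtain ⟨b, hb, hab⟩ := hdη
  rw [C.extGerm_poleForm N ha] at hab
  have hNj : N j ≠ 0 := by simp [hN]
  refine ⟨fun x => (N j : ℂ)⁻¹ • (fderiv ℂ a x ((fderiv ℂ ξ x).inverse (Pi.single j 1)) -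
    contr (Pi.single j 1) (b x)), ?_, ?_⟩
  · exact analyticAt_const.fun_smul ((fderiv_inverse_single_analyticAt C ha j).sub
      (contr_analyticAt hb analyticAt_const))
  · rw [C.mk_poleForm_eq_mk_iff]
    filter_upwards [eventually_frameD_eq C hN hab, C.eventually_isLogPoint] with x h1 h2
    have h3 := contr_frameD_zero (ξ := ξ) N (a := a) (x := x) hj
    rw [h1, map_smul] at h3
    have hM0 := divPow_ne_zero h2.ne_zero M
    have hl0 := h2.ne_zero j
    have hNj' : (N j : ℂ) ≠ 0 := Nat.cast_ne_zero.2 hNj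
    -- `Nⱼ a` is divisible by `ξⱼ`
    have h4 : a x = (N j : ℂ)⁻¹ • divCoord r ξ x j •
        (fderiv ℂ a x ((fderiv ℂ ξ x).inverse (Pi.single j 1)) - contr (Pi.single j 1) (b x)) := by
      rw [smul_sub (divCoord r ξ x j), h3, sub_sub_cancel, inv_smul_smul₀ hNj']
    conv_lhs => rw [h4]
    rw [hN, divPow_add, divPow_single, ← hN, smul_smul, smul_smul, smul_smul]
    congr 1
    field_simp

/-- Reduction of the order of the pole along `ξⱼ = 0`: the Lie derivative along `ξⱼ ∂/∂ξⱼ` acts on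
the part of order `Nⱼ` as the multiplication by `-Nⱼ`, and it is homotopic to zero. -/
theorem HasPole.reduce_succ {N M : Fin n → ℕ} {j : Fin n} (hj : j.val < r)
    (hN : N = M + Pi.single j 1) {η : FormGerm U p (q + 1)} (hη : HasPole r ξ N η)
    (hdη : HasPole r ξ M (extGerm U p (q + 1) η)) :
    ∃ κ : FormGerm U p q, HasPole r ξ N κ ∧ HasPole r ξ M (η + extGerm U p q κ) := by
  obtain ⟨a, ha, rfl⟩ := hη
  obtain ⟨b, hb, hab⟩ := hdη
  rw [C.extGerm_poleForm N ha] at hab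
  have hNj : N j ≠ 0 := by simp [hN]
  have hιa : AnalyticAt ℂ (fun x => contr (Pi.single j 1) (a x)) p :=
    contr_analyticAt ha analyticAt_const
  have hκ : AnalyticAt ℂ (fun x => (N j : ℂ)⁻¹ • contr (Pi.single j 1) (a x)) p :=
    analyticAt_const.fun_smul hιa
  refine ⟨FormGerm.mk U p (poleForm r ξ N fun x => (N j : ℂ)⁻¹ • contr (Pi.single j 1) (a x)),
    ⟨_, hκ, rfl⟩, fun x => (N j : ℂ)⁻¹ •
      (fderiv ℂ a x ((fderiv ℂ ξ x).inverse (Pi.single j 1)) - contr (Pi.single j 1) (b x)),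
    ?_, ?_⟩
  · exact analyticAt_const.fun_smul ((fderiv_inverse_single_analyticAt C ha j).sub
      (contr_analyticAt hb analyticAt_const))
  rw [C.extGerm_poleForm N hκ]
  have hadd : FormGerm.mk U p (poleForm r ξ N a) + FormGerm.mk U p (poleForm r ξ N
      (frameD r ξ N fun x => (N j : ℂ)⁻¹ • contr (Pi.single j 1) (a x))) =
      FormGerm.mk U p (poleForm r ξ N (a + frameD r ξ N fun x =>
        (N j : ℂ)⁻¹ • contr (Pi.single j 1) (a x))) := by
    refine Germ.coe_eq.2 (Eventually.of_forall fun x => ?_)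
    simp only [poleForm, Pi.add_apply, smul_add]
    rfl
  rw [hadd, C.mk_poleForm_eq_mk_iff]
  filter_upwards [eventually_frameD_eq C hN hab, C.eventually_isLogPoint,
    nhdsWithin_le_nhds ha.eventually_analyticAt,
    nhdsWithin_le_nhds hιa.eventually_analyticAt] with x h1 h2 h3 h4
  have h5 := contr_frameD_add (ξ := ξ) N h3.differentiableAt hj
  rw [h1, map_smul] at h5
  have hM0 := divPow_ne_zero h2.ne_zero M
  have hl0 := h2.ne_zero j
  have hNj' : (N j : ℂ) ≠ 0 := Nat.cast_ne_zero.2 hNj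
  have h6 : frameD r ξ N (fun x => (N j : ℂ)⁻¹ • contr (Pi.single j 1) (a x)) x =
      (N j : ℂ)⁻¹ • frameD r ξ N (fun x => contr (Pi.single j 1) (a x)) x := by
    have h7 : fderiv ℂ (fun x => (N j : ℂ)⁻¹ • contr (Pi.single j 1 : Fin n → ℂ) (a x)) x = _ :=
      fderiv_fun_const_smul h4.differentiableAt _
    rw [frameD, frameD, h7, ← ContinuousAlternatingMap.alternatizeUncurryFin_smul]
    congr 1
    ext1 v
    simp only [_root_.sub_apply, ContinuousLinearMap.comp_apply, _root_.smul_apply,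
      ContinuousLinearMap.smulRight_apply, smul_sub]
    rw [smul_comm]
  -- the coefficients of `η + dκ` are divisible by `ξⱼ`
  have h8 : (a + frameD r ξ N fun x => (N j : ℂ)⁻¹ • contr (Pi.single j 1) (a x)) x =
      (N j : ℂ)⁻¹ • divCoord r ξ x j •
        (fderiv ℂ a x ((fderiv ℂ ξ x).inverse (Pi.single j 1)) - contr (Pi.single j 1) (b x)) := by
    rw [Pi.add_apply, h6, smul_sub (divCoord r ξ x j)]
    have h9 : divCoord r ξ x j • fderiv ℂ a x ((fderiv ℂ ξ x).inverse (Pi.single j 1)) -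
        divCoord r ξ x j • contr (Pi.single j 1) (b x) =
        frameD r ξ N (fun y => contr (Pi.single j 1) (a y)) x + (N j : ℂ) • a x := by
      rw [sub_eq_iff_eq_add, add_assoc, add_comm ((N j : ℂ) • a x), ← add_assoc,
        ← sub_eq_iff_eq_add, ← h5]
      exact add_comm _ _
    rw [h9, smul_add, inv_smul_smul₀ hNj']
    exact add_comm _ _
  rw [h8, hN, divPow_add, divPow_single, ← hN, smul_smul, smul_smul, smul_smul]
  congr 1
  field_simp

end Germs

/-! ### Logarithmic forms in the logarithmic coframe -/

section Logarithmic

variable {U : TopologicalSpace.Opens (Fin n → ℂ)} {p : Fin n → ℂ} {r : ℕ}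
  {ξ ψ : (Fin n → ℂ) → (Fin n → ℂ)} {q : ℕ}

theorem altForm_zero_smul (a : AltForm n q) : (0 : ℂ) • a = 0 := by
  ext v
  exact zero_mul (a v)

theorem altForm_one_smul (a : AltForm n q) : (1 : ℂ) • a = a := by
  ext v
  exact one_mul (a v)

theorem divCoord_eq_zero_lt {x : Fin n → ℂ} {j : Fin n} (h : divCoord r ξ x j = 0) :
    j.val < r := by
  by_contra hj
  rw [divCoord, if_neg hj] at h
  exact one_ne_zero h

theorem fderiv_smul_apply_eq_zero {E F : Type*} [NormedAddCommGroup E] [NormedSpace ℂ E]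
    [NormedAddCommGroup F] [NormedSpace ℂ F] {c : E → ℂ} {c' : E →L[ℂ] ℂ} {K : E → F} {x v : E}
    (hc : HasFDerivAt c c' x) (hK : DifferentiableAt ℂ K x) (hx : c x = 0) (hv : c' v = 0) :
    fderiv ℂ (fun y => c y • K y) x v = 0 := by
  have h : fderiv ℂ (fun y => c y • K y) x = _ := (hc.smul hK.hasFDerivAt).fderiv
  rw [h, hx]
  simp [hv]

/-- If `b` is divisible by `ξⱼ`, then the derivatives of `b` along the logarithmic vector fields
vanish on `ξⱼ = 0`. -/
theorem frameD_eq_zero (N : Fin n → ℕ) {b K : (Fin n → ℂ) → AltForm n q} {j : Fin n}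
    (hb : ∀ y, b y = divCoord r ξ y j • K y) {x : Fin n → ℂ} (hK : DifferentiableAt ℂ K x)
    (hξ : DifferentiableAt ℂ ξ x) (hinv : (fderiv ℂ ξ x).IsInvertible)
    (hx : divCoord r ξ x j = 0) : frameD r ξ N b x = 0 := by
  have h4 : (fderiv ℂ b x).comp (logFrame r ξ x) - (divWeight r N).smulRight (b x) = 0 := by
    ext1 v
    have h1 : fderiv ℂ b x (logFrame r ξ x v) = 0 := by
      rw [funext hb]
      refine fderiv_smul_apply_eq_zero (hasFDerivAt_divCoord hξ j) hK hx ?_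
      rw [_root_.smul_apply, ContinuousLinearMap.comp_apply, fderiv_logFrame_apply hinv,
        ContinuousLinearMap.proj_apply, diagMap_apply, hx, zero_mul, smul_zero]
    have h2 : b x = 0 := by rw [hb, hx, altForm_zero_smul]
    rw [_root_.sub_apply, ContinuousLinearMap.comp_apply, h1, h2,
      ContinuousLinearMap.smulRight_apply, smul_zero, sub_zero]
    rfl
  rw [frameD, h4]
  exact map_zero (ContinuousAlternatingMap.alternatizeUncurryFinCLM ℂ (Fin n → ℂ) ℂ (n := q))

variable (C : IsAdapted U p r ξ ψ)
include C

/-- A holomorphic form that vanishes at the points of the divisor is divisible by `ξ₁ ⋯ ξ_r`. -/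
theorem exists_eq_divPow_one_smul {G : (Fin n → ℂ) → AltForm n q} (hG : AnalyticAt ℂ G p)
    (h : ∀ᶠ x in 𝓝 p, x ∉ U → G x = 0) :
    ∃ a : (Fin n → ℂ) → AltForm n q, AnalyticAt ℂ a p ∧
      ∀ᶠ x in 𝓝 p, G x = divPow r ξ 1 x • a x := by
  obtain ⟨σ, hσ⟩ := exists_altCoeff_leftInverse n q
  have h1 (t : Fin q → Fin n) : ∃ a : (Fin n → ℂ) → ℂ, AnalyticAt ℂ a p ∧
      (fun x => altCoeff n q (G x) t) =ᶠ[𝓝 p] a * divPow r ξ 1 := by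
    refine C.exists_eq_mul_divPow_one ?_ (h.mono fun x hx hU => ?_)
    · exact ((ContinuousAlternatingMap.apply ℂ (Fin n → ℂ) ℂ
        fun k => Pi.single (t k) (1 : ℂ)).analyticAt _).comp hG
    · rw [hx hU, map_zero]
      rfl
  choose a ha haG using h1
  refine ⟨fun x => σ fun t => a t x, (σ.analyticAt _).comp (AnalyticAt.pi ha), ?_⟩
  filter_upwards [eventually_all.2 haG] with x hx
  have h2 : altCoeff n q (G x) = divPow r ξ 1 x • fun t => a t x := by
    funext t
    rw [hx t, Pi.smul_apply, Pi.mul_apply, smul_eq_mul, mul_comm]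
  rw [← map_smul, ← h2, hσ]

/-- A form `φ` such that `φ` and `dφ` have at most a simple pole along the divisor has holomorphic
coefficients in the logarithmic coframe. By Cartan's formula for `ξⱼ ∂/∂ξⱼ`, the coefficients of
`ξ₁ ⋯ ξ_r φ` vanish on `ξⱼ = 0`. -/
theorem hasPole_zero_of_mulBy_mem {φ : FormGerm U p q}
    (h1 : mulBy U p (divPow r ξ 1) q φ ∈ regForm U p q)
    (h2 : mulBy U p (divPow r ξ 1) (q + 1) (extGerm U p q φ) ∈ regForm U p (q + 1)) :
    HasPole r ξ 0 φ := by
  obtain ⟨g, hg, hφ⟩ := h1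
  obtain ⟨γ, hγ, hdφ⟩ := h2
  have hφ' := eq_mk_poleForm_of_mulBy_eq C (k := 1) ((pow_one (divPow r ξ 1)).symm ▸ hφ)
  have hdφ' := eq_mk_poleForm_of_mulBy_eq C (k := 1) ((pow_one (divPow r ξ 1)).symm ▸ hdφ)
  rw [one_smul] at hφ' hdφ'
  have hG := comp_logFrame_analyticAt C hg
  have hΓ := comp_logFrame_analyticAt C hγ
  set G := fun x => (g x).compContinuousLinearMap (logFrame r ξ x) with hGdef
  set Γ := fun x => (γ x).compContinuousLinearMap (logFrame r ξ x) with hΓdef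
  rw [hφ', C.extGerm_poleForm 1 hG, C.mk_poleForm_eq_mk_iff] at hdφ'
  -- equality off the divisor, hence across it
  have hd : ∀ᶠ x in 𝓝 p, (frameD r ξ 1 G - Γ) x = 0 := by
    refine C.eventually_eq_zero ((C.frameD_analyticAt 1 hG).sub hΓ) ?_
    filter_upwards [hdφ', C.eventually_isLogPoint] with x hx hx'
    exact sub_eq_zero.2 (smul_right_injective _ (inv_ne_zero (divPow_ne_zero hx'.ne_zero 1)) hx)
  have hvan : ∀ᶠ x in 𝓝 p, x ∉ U → G x = 0 := by
    filter_upwards [hd, C.mem_iff, C.eventually_isInvertible,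
      C.analyticAt.eventually_analyticAt, hg.eventually_analyticAt, hG.eventually_analyticAt,
      C.logFrame_analyticAt.eventually_analyticAt,
      eventually_all.2 fun j => (inverse_single_analyticAt C j).eventually_analyticAt]
      with x hdx hmem hinv hξ hgx hGx hB he hxU
    obtain ⟨j, hj⟩ : ∃ j, divCoord r ξ x j = 0 := by
      by_contra hcon
      push Not at hcon
      exact hxU (hmem.2 hcon)
    have hjr := divCoord_eq_zero_lt hj
    -- `Γ` is the pullback of `γ` by the logarithmic frame, and `ξⱼ ∂/∂ξⱼ` vanishes at `x`
    have hΓx : contr (Pi.single j 1) (frameD r ξ 1 G x) = 0 := by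
      rw [sub_eq_zero.1 hdx, hΓdef]
      simp only
      rw [contr_compContinuousLinearMap, logFrame_single, hj, zero_smul, contr_zero_left]
      rfl
    cases q with
    | zero =>
      have h3 := contr_frameD_zero (ξ := ξ) 1 (a := G) (x := x) hjr
      rw [hΓx, hj, altForm_zero_smul, zero_sub, Pi.one_apply, Nat.cast_one, altForm_one_smul] at h3
      exact neg_eq_zero.1 h3.symm
    | succ q =>
      have h3 := contr_frameD_add (ξ := ξ) 1 hGx.differentiableAt hjr
      have h4 : frameD r ξ 1 (fun y => contr (Pi.single j 1) (G y)) x = 0 := by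
        refine frameD_eq_zero 1 (K := fun y => (contr ((fderiv ℂ ξ y).inverse (Pi.single j 1))
          (g y)).compContinuousLinearMap (logFrame r ξ y)) (fun y => ?_) ?_
          hξ.differentiableAt hinv hj
        · rw [hGdef]
          simp only
          rw [contr_compContinuousLinearMap, logFrame_single, contr_smul_left]
          rfl
        · exact (altForm_compContinuousLinearMap_analyticAt
            (contr_analyticAt hgx (he j)) hB).differentiableAt
      rw [hΓx, h4, hj, altForm_zero_smul, zero_sub, Pi.one_apply, Nat.cast_one, altForm_one_smul,
        add_zero] at h3
      exact neg_eq_zero.1 h3.symm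
  obtain ⟨a, ha, haG⟩ := exists_eq_divPow_one_smul C hG hvan
  refine ⟨a, ha, ?_⟩
  rw [hφ', C.mk_poleForm_eq_mk_iff]
  filter_upwards [C.eventually_isLogPoint, nhdsWithin_le_nhds haG] with x hx hx'
  rw [hx', inv_smul_smul₀ (divPow_ne_zero hx.ne_zero 1), divPow_zero, inv_one, one_smul]

variable {h : (Fin n → ℂ) → ℂ} (H : IsReducedEquation U p h)
include H

theorem exists_divPow_one_eq_mul :
    ∃ c : (Fin n → ℂ) → ℂ, AnalyticAt ℂ c p ∧ divPow r ξ 1 =ᶠ[𝓝 p] c * h :=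
  H.dvd _ (divPow_analyticAt C.analyticAt 1)
    (C.eventually_divPow_one_eq_zero_iff.mono fun _ hx => hx.2)

theorem exists_equation_eq_mul_divPow_one :
    ∃ c : (Fin n → ℂ) → ℂ, AnalyticAt ℂ c p ∧ h =ᶠ[𝓝 p] c * divPow r ξ 1 :=
  C.exists_eq_mul_divPow_one H.analyticAt (H.eq_zero_iff.mono fun _ hx => hx.2)

/-- The reduced equation `h` and `ξ₁ ⋯ ξ_r` divide each other. -/
theorem mulBy_pow_mem_regForm_iff (k : ℕ) (φ : FormGerm U p q) :
    mulBy U p (h ^ k) q φ ∈ regForm U p q ↔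
      mulBy U p (divPow r ξ 1 ^ k) q φ ∈ regForm U p q := by
  obtain ⟨c, hc, h1⟩ := exists_divPow_one_eq_mul C H
  obtain ⟨c', hc', h2⟩ := exists_equation_eq_mul_divPow_one C H
  constructor
  · refine mulBy_mem_regForm_of_eq_mul (hc.pow k) ?_
    rw [← mul_pow]
    exact h1.pow_const k
  · refine mulBy_mem_regForm_of_eq_mul (hc'.pow k) ?_
    rw [← mul_pow]
    exact h2.pow_const k

theorem mem_meroForm_iff (φ : FormGerm U p q) :
    φ ∈ meroForm H q ↔ ∃ N, HasPole r ξ N φ := by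
  constructor
  · rintro ⟨k, hk⟩
    obtain ⟨η, hη, hφ⟩ := (mulBy_pow_mem_regForm_iff C H k φ).1 hk
    exact ⟨_, _, comp_logFrame_analyticAt C hη, eq_mk_poleForm_of_mulBy_eq C hφ⟩
  · rintro ⟨N, hN⟩
    obtain ⟨k, hk⟩ := hN.exists_mulBy_mem_regForm C
    exact ⟨k, (mulBy_pow_mem_regForm_iff C H k φ).2 hk⟩

theorem mem_logForm_iff (φ : meroForm H q) : φ ∈ logForm H q ↔ HasPole r ξ 0 φ.1 := by
  have h1 (q : ℕ) (φ : FormGerm U p q) : mulBy U p h q φ ∈ regForm U p q ↔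
      mulBy U p (divPow r ξ 1) q φ ∈ regForm U p q := by
    have := mulBy_pow_mem_regForm_iff C H 1 φ
    rwa [pow_one, pow_one] at this
  constructor
  · rintro ⟨h2, h3⟩
    exact hasPole_zero_of_mulBy_mem C ((h1 _ _).1 h2) ((h1 _ _).1 h3)
  · intro h2
    refine ⟨(h1 _ _).2 (mulBy_divPow_one_mem_regForm C h2), (h1 _ _).2
      (mulBy_divPow_one_mem_regForm C ?_)⟩
    obtain ⟨a, ha, h3⟩ := h2
    refine ⟨_, C.frameD_analyticAt 0 ha, ?_⟩
    rw [← C.extGerm_poleForm 0 ha, ← h3]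
    rfl

end Logarithmic

/-! ### The local comparison theorem -/

section Homology

open CategoryTheory

/-- A morphism of complexes of vector spaces that is injective in each degree is a quasi-isomorphism
if every cochain of the target whose differential comes from the source comes, up to a
coboundary, from the source. -/
theorem quasiIso_of_forall_exists {K L : CochainComplex (ModuleCat.{0} ℂ) ℕ} (f : K ⟶ L)
    (hf : ∀ i, Function.Injective (f.f i))
    (h : ∀ i (y : L.X i), (∃ x, L.d i (i + 1) y = f.f (i + 1) x) →
      ∃ (x : K.X i) (z : L.X ((ComplexShape.up ℕ).prev i)), y = f.f i x + L.d _ i z) :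
    QuasiIso f := by
  have hsurj (A : ModuleCat.{0} ℂ) :
      Epi (ModuleCat.ofHom (Finsupp.linearCombination ℂ (id : A → A)) :
        ModuleCat.of ℂ (A →₀ ℂ) ⟶ A) :=
    (ModuleCat.epi_iff_surjective _).2 (Finsupp.linearCombination_id_surjective ℂ A)
  rw [quasiIso_iff]
  intro j
  rw [quasiIsoAt_iff_isIso_homologyMap]
  have hmono : Mono (HomologicalComplex.homologyMap f j) := by
    rw [HomologicalComplex.mono_homologyMap_iff_up_to_refinements f _ j (j + 1) rfl
      (CochainComplex.next ℕ j)]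
    intro A x₂ _ y₁ hy
    have hy' (a : A) : f.f j (x₂ a) = L.d _ j (y₁ a) :=
      congrArg (fun g : A ⟶ L.X j => g a) hy
    have key (a : A) : ∃ x, x₂ a = K.d ((ComplexShape.up ℕ).prev j) j x := by
      by_cases hj : (ComplexShape.up ℕ).Rel ((ComplexShape.up ℕ).prev j) j
      · generalize (ComplexShape.up ℕ).prev j = i at *
        obtain rfl : i + 1 = j := hj
        obtain ⟨x, z, hz⟩ := h i (y₁ a) ⟨x₂ a, (hy' a).symm⟩
        refine ⟨x, hf _ ?_⟩
        rw [hy', hz, map_add]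
        have h1 : L.d i (i + 1) (L.d _ i z) = 0 :=
          congrArg (fun g : L.X _ ⟶ L.X (i + 1) => g z) (L.d_comp_d _ i (i + 1))
        have h2 : L.d i (i + 1) (f.f i x) = f.f (i + 1) (K.d i (i + 1) x) :=
          congrArg (fun g : K.X i ⟶ L.X (i + 1) => g x) (f.comm i (i + 1))
        rw [h1, h2, add_zero]
      · refine ⟨0, hf _ ?_⟩
        rw [hy', map_zero, map_zero, L.shape _ _ hj]
        rfl
    choose x hx using key
    refine ⟨_, _, hsurj A, ModuleCat.ofHom (Finsupp.linearCombination ℂ x), ?_⟩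
    refine ModuleCat.hom_ext (Finsupp.lhom_ext' fun a => LinearMap.ext_ring ?_)
    simp [hx]
  have hepi : Epi (HomologicalComplex.homologyMap f j) := by
    rw [HomologicalComplex.epi_homologyMap_iff_up_to_refinements f _ j (j + 1) rfl
      (CochainComplex.next ℕ j)]
    intro A y₂ hy
    have hy' (a : A) : L.d j (j + 1) (y₂ a) = 0 :=
      congrArg (fun g : A ⟶ L.X (j + 1) => g a) hy
    have key (a : A) := h j (y₂ a) ⟨0, by rw [hy', map_zero]⟩
    choose x z hxz using key
    refine ⟨_, _, hsurj A, ModuleCat.ofHom (Finsupp.linearCombination ℂ x), ?_,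
      ModuleCat.ofHom (Finsupp.linearCombination ℂ z), ?_⟩
    · refine ModuleCat.hom_ext (Finsupp.lhom_ext' fun a => LinearMap.ext_ring ?_)
      simp only [ModuleCat.hom_comp, ModuleCat.hom_ofHom, LinearMap.comp_apply,
        Finsupp.lsingle_apply, Finsupp.linearCombination_single, one_smul]
      refine hf _ ?_
      have h1 : L.d j (j + 1) (L.d ((ComplexShape.up ℕ).prev j) j (z a)) = 0 :=
        congrArg (fun g : L.X _ ⟶ L.X (j + 1) => g (z a)) (L.d_comp_d _ j (j + 1))
      have h2 : L.d j (j + 1) (f.f j (x a)) = f.f (j + 1) (K.d j (j + 1) (x a)) :=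
        congrArg (fun g : K.X j ⟶ L.X (j + 1) => g (x a)) (f.comm j (j + 1))
      have h3 := hy' a
      rw [hxz, map_add, h1, h2, add_zero] at h3
      exact h3.trans (map_zero _).symm
    · refine ModuleCat.hom_ext (Finsupp.lhom_ext' fun a => LinearMap.ext_ring ?_)
      simp [hxz]
  exact isIso_of_mono_of_epi _

end Homology

section Comparison

variable {U : TopologicalSpace.Opens (Fin n → ℂ)} {p : Fin n → ℂ} {r : ℕ}
  {ξ ψ : (Fin n → ℂ) → (Fin n → ℂ)} {q : ℕ}

/-- The exponents `Nⱼ`, `j ≥ r`, play no role. -/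
theorem HasPole.of_add_single {N M : Fin n → ℕ} {j : Fin n} (hj : ¬ j.val < r)
    (hN : N = M + Pi.single j 1) {φ : FormGerm U p q} (h : HasPole r ξ N φ) :
    HasPole r ξ M φ := by
  obtain ⟨a, ha, rfl⟩ := h
  refine ⟨a, ha, congrArg _ (funext fun x => ?_)⟩
  rw [poleForm, poleForm, hN, divPow_add, divPow_single, divCoord, if_neg hj, mul_one]

theorem exists_eq_add_single {N : Fin n → ℕ} (hN : N ≠ 0) :
    ∃ (j : Fin n) (M : Fin n → ℕ), N = M + Pi.single j 1 := by
  obtain ⟨j, hj⟩ := Function.ne_iff.1 hN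
  refine ⟨j, N - Pi.single j 1, (tsub_add_cancel_of_le ?_).symm⟩
  intro i
  by_cases hi : i = j
  · rw [hi, Pi.single_eq_same]
    exact Nat.one_le_iff_ne_zero.2 hj
  · rw [Pi.single_eq_of_ne hi]
    exact Nat.zero_le _

theorem sum_lt_sum_add_single (M : Fin n → ℕ) (j : Fin n) :
    ∑ i, M i < ∑ i, (M + Pi.single j 1 : Fin n → ℕ) i := by
  simp [Finset.sum_add_distrib]

variable (C : IsAdapted U p r ξ ψ) {h : (Fin n → ℂ) → ℂ} (H : IsReducedEquation U p h)
include C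

/-- A meromorphic function with a logarithmic differential is holomorphic: the order of its pole is
lowered by one along one component at a time. -/
theorem mem_logForm_of_meroD_mem (η : meroForm H 0) (hη : meroD H 0 η ∈ logForm H 1) :
    η ∈ logForm H 0 := by
  rw [mem_logForm_iff C] at hη ⊢
  obtain ⟨N, hN⟩ := (mem_meroForm_iff C H η.1).1 η.2
  induction hk : ∑ i, N i using Nat.strong_induction_on generalizing N with | _ k ih =>
  by_cases hN0 : N = 0
  · rwa [hN0] at hN
  obtain ⟨j, M, hM⟩ := exists_eq_add_single hN0
  refine ih (∑ i, M i) ?_ M ?_ rfl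
  · rw [← hk, hM]
    exact sum_lt_sum_add_single M j
  · by_cases hj : j.val < r
    · refine HasPole.reduce_zero C hj hM hN ?_
      have h1 := hη.add_exponent C M
      rwa [zero_add] at h1
    · exact hN.of_add_single hj hM

/-- A meromorphic form with a logarithmic differential is logarithmic up to an exact form. -/
theorem exists_add_meroD_mem_logForm (η : meroForm H (q + 1))
    (hη : meroD H (q + 1) η ∈ logForm H (q + 2)) :
    ∃ κ : meroForm H q, η + meroD H q κ ∈ logForm H (q + 1) := by
  obtain ⟨N, hN⟩ := (mem_meroForm_iff C H η.1).1 η.2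
  induction hk : ∑ i, N i using Nat.strong_induction_on generalizing N η with | _ k ih =>
  by_cases hN0 : N = 0
  · refine ⟨0, ?_⟩
    rw [map_zero, add_zero, mem_logForm_iff C]
    rwa [hN0] at hN
  obtain ⟨j, M, hM⟩ := exists_eq_add_single hN0
  have hlt : ∑ i, M i < k := by
    rw [← hk, hM]
    exact sum_lt_sum_add_single M j
  by_cases hj : j.val < r
  · have hdη : HasPole r ξ M (extGerm U p (q + 1) η.1) := by
      have h1 := ((mem_logForm_iff C H _).1 hη).add_exponent C M
      rwa [zero_add] at h1
    obtain ⟨κ, hκ, hκ'⟩ := HasPole.reduce_succ C hj hM hN hdη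
    let κ₀ : meroForm H q := ⟨κ, (mem_meroForm_iff C H κ).2 ⟨N, hκ⟩⟩
    obtain ⟨κ₁, h1⟩ := ih _ hlt (η + meroD H q κ₀)
      (by rwa [map_add, meroD_meroD, add_zero]) M hκ' rfl
    exact ⟨κ₀ + κ₁, by rwa [map_add, ← add_assoc]⟩
  · exact ih _ hlt η hη M (hN.of_add_single hj hM) rfl

/-- The local logarithmic comparison theorem. -/
theorem quasiIso_logInclusion : QuasiIso (logInclusion H) := by
  refine quasiIso_of_forall_exists _ (fun i => Subtype.val_injective) fun i y hy => ?_
  rw [meroComplex_d] at hy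
  obtain ⟨x, hx⟩ := hy
  have hmem : meroD H i y ∈ logForm H (i + 1) := by
    have h1 : meroD H i y = x.1 := hx
    rw [h1]
    exact x.2
  cases i with
  | zero =>
    refine ⟨⟨y, mem_logForm_of_meroD_mem C H y hmem⟩, 0, ?_⟩
    rw [map_zero, add_zero]
    rfl
  | succ i =>
    obtain ⟨κ, hκ⟩ := exists_add_meroD_mem_logForm C H y hmem
    have hprev : (ComplexShape.up ℕ).prev (i + 1) = i := CochainComplex.prev_nat_succ i
    rw [hprev]
    refine ⟨⟨_, hκ⟩, -κ, ?_⟩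
    rw [meroComplex_d]
    have h1 (y' : meroForm H (i + 1)) : y' = (y' + meroD H i κ) + meroD H i (-κ) := by
      rw [map_neg, add_neg_cancel_right]
    exact h1 y

end Comparison

/-! ### Normal crossing divisors in complex manifolds -/

section Charts

variable {X : Type*} [TopologicalSpace X] {e e' : OpenPartialHomeomorph X (Fin n → ℂ)} {p : X}

theorem eventually_transition (hp : p ∈ e.source) (hp' : p ∈ e'.source) :
    ∀ᶠ y in 𝓝 (e p), y ∈ e.target ∧ e.symm y ∈ e'.source := by
  refine Eventually.and (e.open_target.mem_nhds (e.map_source hp)) ?_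
  refine (e.continuousAt_symm (e.map_source hp)).tendsto.eventually ?_
  rw [e.left_inv hp]
  exact e'.open_source.mem_nhds hp'

variable [ChartedSpace (Fin n → ℂ) X]

theorem transition_analyticAt (he : e ∈ IsManifold.maximalAtlas 𝓘(ℂ, Fin n → ℂ) ω X)
    (he' : e' ∈ IsManifold.maximalAtlas 𝓘(ℂ, Fin n → ℂ) ω X) (hp : p ∈ e.source)
    (hp' : p ∈ e'.source) : AnalyticAt ℂ (e' ∘ e.symm) (e p) := by
  have h1 := contMDiffAt_symm_of_mem_maximalAtlas he (e.map_source hp)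
  have h2 : ContMDiffAt 𝓘(ℂ, Fin n → ℂ) 𝓘(ℂ, Fin n → ℂ) ω e' (e.symm (e p)) := by
    rw [e.left_inv hp]
    exact contMDiffAt_of_mem_maximalAtlas he' hp'
  exact (contMDiffAt_iff_contDiffAt.1 (h2.comp _ h1)).analyticAt

/-- Coordinates in which `D` is `x₁ ⋯ x_r = 0`, read in the chart `e`. -/
theorem isAdapted_transition (he : e ∈ IsManifold.maximalAtlas 𝓘(ℂ, Fin n → ℂ) ω X)
    (he' : e' ∈ IsManifold.maximalAtlas 𝓘(ℂ, Fin n → ℂ) ω X) (hp : p ∈ e.source)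
    (hp' : p ∈ e'.source) (hp0 : e' p = 0) {D : TopologicalSpace.Closeds X} {r : ℕ}
    (hD : ∀ x ∈ e'.source, x ∈ D ↔ ∏ i : Fin n with i.val < r, e' x i = 0) :
    IsAdapted (chartCompl D e) (e p) r (e' ∘ e.symm) (e ∘ e'.symm) where
  analyticAt := transition_analyticAt he he' hp hp'
  inv_analyticAt := hp0 ▸ transition_analyticAt he' he hp' hp
  map_point := by rw [Function.comp_apply, e.left_inv hp, hp0]
  left_inv := by
    filter_upwards [eventually_transition hp hp'] with y hy
    simp only [Function.comp_apply]
    rw [e'.left_inv hy.2, e.right_inv hy.1]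
  right_inv := by
    rw [← hp0]
    filter_upwards [eventually_transition hp' hp] with y hy
    simp only [Function.comp_apply]
    rw [e.left_inv hy.2, e'.right_inv hy.1]
  mem_iff := by
    filter_upwards [eventually_transition hp hp'] with y hy
    have h1 : y ∈ chartCompl D e ↔ e.symm y ∉ D :=
      ⟨fun h => h.2, fun h => ⟨hy.1, h⟩⟩
    rw [h1, hD _ hy.2, Finset.prod_eq_zero_iff]
    simp only [divCoord, Function.comp_apply, Finset.mem_filter, Finset.mem_univ, true_and,
      not_exists, not_and]
    refine forall_congr' fun i => ?_
    by_cases hi : i.val < r <;> simp [hi]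

theorem IsNormalCrossing.satisfiesLCT {D : TopologicalSpace.Closeds X}
    (hD : IsNormalCrossing (n := n) D) : SatisfiesLCT (n := n) D := by
  intro e he p hp
  obtain ⟨e', he', hp', hp0, r, -, hr⟩ := hD p
  have C := isAdapted_transition he he' hp hp' hp0 hr
  exact ⟨⟨_, C.isReducedEquation⟩, fun h H => quasiIso_logInclusion C H⟩

end Charts

end LogComparison

end

theorem mainTheorem6 :
    (∀ n r : ℕ, 1 ≤ r → r ≤ n →
      Ideal.torsionOf (LogComparison.DiffOp n)
          (LogComparison.MeroGerm (LogComparison.crossing n r))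
          (LogComparison.MeroGerm.inv (LogComparison.crossing n r)) =
        Ideal.span
          ({P | ∃ i : Fin n, r ≤ i.val ∧ P = LogComparison.DiffOp.del i} ∪
            {P | ∃ i : Fin n, i.val < r ∧
              P = LogComparison.DiffOp.mul (LogComparison.coord i) *
                LogComparison.DiffOp.del i + 1}) ∧
      Submodule.span (LogComparison.DiffOp n)
        {LogComparison.MeroGerm.inv (LogComparison.crossing n r)} = ⊤) ∧
    ∀ (n : ℕ) (X : Type*) [TopologicalSpace X] [ChartedSpace (Fin n → ℂ) X]
      [IsManifold 𝓘(ℂ, Fin n → ℂ) ω X] (D : TopologicalSpace.Closeds X),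
      LogComparison.IsNormalCrossing (n := n) D → LogComparison.SatisfiesLCT (n := n) D :=
  ⟨fun n r _ _ => ⟨LogComparison.torsionOf_inv_eq n r, LogComparison.span_inv_eq_top n r⟩,
    fun _ _ _ _ _ _ hD => hD.satisfiesLCT⟩
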